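/- Theorem (Bochner-Martinelli). Let $\mathbb A$ be a finite-dimensional real alternative $*$-algebra with unity: a real, not necessarily associative, unital algebra with $a(ab)=(aa)b$ and $(ba)a=b(aa)$ for all $a,b$, together with a real linear map $a\mapsto a^c$ satisfying $(a^c)^c=a$, $(ab)^c=b^ca^c$ and $r^c=r$ for $r\in\mathbb R=\mathbb R1$. Put $t(x)=x+x^c$, $n(x)=xx^c$, $\mathbb S_{\mathbb A}=\{x: t(x)=0,\ n(x)=1\}$ and $Q_{\mathbb A}=\mathbb R\cup\{x: t(x),n(x)\in\mathbb R,\ 4n(x)>t(x)^2\}$. Let $M$ be a hypercomplex subspace, i.e. a linear subspace with $\mathbb R\subsetneq M\subseteq Q_{\mathbb A}$, with a fixed hypercomplex basis $(v_0,\dots,v_m)$, i.e. a basis with $m\ge1$, $v_0=1$, $v_s\in\mathbb S_{\mathbb A}$ and $v_sv_t=-v_tv_s$ for distinct $s,t\in\{1,\dots,m\}$. Let $n\ge1$ and identify $x=(x_{j,s})\in\mathbb R^{(m+1)n}$ with $(x_1,\dots,x_n)\in M^n$, $x_j=\sum_{s=0}^m x_{j,s}v_s$; $|\cdot|$ is the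 Euclidean norm of $\mathbb R^{(m+1)n}$. Differentiation and integration of $\mathbb A$-valued functions are taken componentwise in a real basis of $\mathbb A$. Let $\Omega$ be a bounded domain in $M^n$ with piecewise smooth boundary $\Gamma=\partial\Omega$, in the following sense: $\Gamma$ has finite $((m+1)n-1)$-dimensional Hausdorff measure and, outside a subset of $\Gamma$ of measure zero for it, every $y\in\Gamma$ is regular, i.e. there are a neighbourhood $U$ of $y$ and a $C^1$ function $\rho:U\to\mathbb R$ with $\nabla\rho(y)\neq0$ and $\Omega\cap U=\{\rho<0\}$. Let $\nu=(\nu_1,\dots,\nu_n)$, $\nu_j\in M$, be the unit exterior normal ($\nu(y)=\nabla\rho(y)/|\nabla\rho(y)|$ at regular points $y$), $dS$ the surface measure (the normalised Hausdorff measure) on $\Gamma$ and $dV$ Lebesgue measure. Let $f\in C^1(\overline\Omega,\mathbb A)$, i.e. $f$ is continuous on $\overline\Omega$ and $C^1$ in $\Omega$, and its first derivatives extend continuously to $\overline\Omega$. Put $$K_j(x)=\frac1{\sigma_{(m+1)n}}\frac{x_j^c}{|x|^{(m+1)n}},\qquad \sigma_N=\frac{2\pi^{N/2}}{\Gamma(N/2)},\qquad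 \bar\partial_jf=\sum_{s=0}^m v_s\frac{\partial f}{\partial x_{j,s}},$$ $$K(x,y)*f(y)=\sum_{j=1}^nK_j(y-x)\bigl(\nu_j(y)f(y)\bigr)\,dS(y).$$ Then for every $x\in\Omega\cup(M^n\setminus\overline\Omega)$ all the integrals below converge absolutely, and $$\int_\Gamma K(x,y)*f(y)-\sum_{j=1}^n\int_\Omega K_j(y-x)\bigl(\bar\partial_jf(y)\bigr)\,dV(y)=\begin{cases}f(x),&x\in\Omega,\\0,&x\in M^n\setminus\overline\Omega.\end{cases}$$ -/

import Mathlib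

open MeasureTheory Topology

noncomputable section

namespace BochnerMartinelli

/-! ## Domains with piecewise smooth boundary in a Euclidean space -/

section Boundary

variable {E : Type*} [NormedAddCommGroup E] [InnerProductSpace ℝ E] [CompleteSpace E]

/-- `ρ` is a `C¹` local defining function of `Ω` at `y`: near `y` the set `Ω` is `{ρ < 0}`, and
the gradient of `ρ` does not vanish at `y`. -/
structure IsLocalDefiningFunction (Ω : Set E) (y : E) (ρ : E → ℝ) : Prop where
  contDiffAt : ContDiffAt ℝ 1 ρ y
  gradient_ne_zero : gradient ρ y ≠ 0
  mem_iff : ∀ᶠ z in 𝓝 y, z ∈ Ω ↔ ρ z < 0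

/-- A boundary point of `Ω` near which the boundary is a `C¹` hypersurface with `Ω` on exactly
one side of it. -/
def IsRegularBoundaryPoint (Ω : Set E) (y : E) : Prop :=
  y ∈ frontier Ω ∧ ∃ ρ : E → ℝ, IsLocalDefiningFunction Ω y ρ

open Classical in
/-- The unit exterior normal `∇ρ / |∇ρ|` at a regular boundary point, where `ρ` is any local
defining function (the choice is immaterial, see `exteriorNormal_eq`). The value at
all other points is `0`. -/
def exteriorNormal (Ω : Set E) (y : E) : E :=
  if h : IsRegularBoundaryPoint Ω y then
    ‖gradient h.2.choose y‖⁻¹ • gradient h.2.choose y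
  else 0

theorem IsLocalDefiningFunction.apply_eq_zero {Ω : Set E} {y : E} {ρ : E → ℝ}
    (h : IsLocalDefiningFunction Ω y ρ) (hy : y ∈ frontier Ω) : ρ y = 0 := by
  have hc : ContinuousAt ρ y := h.contDiffAt.continuousAt
  apply le_antisymm
  · by_contra! hpos
    have h1 : ∀ᶠ z in 𝓝 y, z ∉ Ω := by
      filter_upwards [h.mem_iff, hc.eventually (lt_mem_nhds hpos)] with z hz hz' hzΩ
      exact absurd (hz.1 hzΩ) (not_lt.2 hz'.le)
    have h2 := mem_closure_iff_frequently.1 hy.1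
    exact h2 h1
  · by_contra! hneg
    have h1 : ∀ᶠ z in 𝓝 y, z ∈ Ω := by
      filter_upwards [h.mem_iff, hc.eventually (gt_mem_nhds hneg)] with z hz hz'
      exact hz.2 hz'
    exact hy.2 (mem_interior_iff_mem_nhds.2 h1)

theorem IsLocalDefiningFunction.inner_nonpos {Ω : Set E} {y : E} {ρ₁ ρ₂ : E → ℝ}
    (h₁ : IsLocalDefiningFunction Ω y ρ₁) (h₂ : IsLocalDefiningFunction Ω y ρ₂)
    (hy : y ∈ frontier Ω) (v : E) (hv : inner ℝ (gradient ρ₁ y) v < 0) :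
    inner ℝ (gradient ρ₂ y) v ≤ 0 := by
  have key : ∀ ρ : E → ℝ, IsLocalDefiningFunction Ω y ρ →
      HasDerivAt (fun t : ℝ => ρ (y + t • v)) (inner ℝ (gradient ρ y) v) 0 := by
    intro ρ h
    have hd : HasFDerivAt ρ (fderiv ℝ ρ y) (y + (0 : ℝ) • v) := by
      simpa using (h.contDiffAt.differentiableAt (by norm_num)).hasFDerivAt
    have hl : HasDerivAt (fun t : ℝ => y + t • v) v 0 := by
      simpa using ((hasDerivAt_id (0 : ℝ)).smul_const v).const_add y
    have h3 := hd.comp_hasDerivAt (0 : ℝ) hl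
    have h4 : inner ℝ (gradient ρ y) v = fderiv ℝ ρ y v := by
      simp [gradient, InnerProductSpace.toDual_symm_apply]
    rw [h4]
    exact h3
  have hl : Filter.Tendsto (fun t : ℝ => y + t • v) (𝓝[>] 0) (𝓝 y) := by
    have : ContinuousAt (fun t : ℝ => y + t • v) 0 := by fun_prop
    have h5 := this.tendsto
    simp only [zero_smul, add_zero] at h5
    exact h5.mono_left nhdsWithin_le_nhds
  have s₁ := (hasDerivAt_iff_tendsto_slope.1 (key ρ₁ h₁)).mono_left
    (nhdsWithin_mono 0 (show Set.Ioi (0 : ℝ) ⊆ {0}ᶜ from fun t ht => ne_of_gt ht))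
  have s₂ := (hasDerivAt_iff_tendsto_slope.1 (key ρ₂ h₂)).mono_left
    (nhdsWithin_mono 0 (show Set.Ioi (0 : ℝ) ⊆ {0}ᶜ from fun t ht => ne_of_gt ht))
  have z₁ := h₁.apply_eq_zero hy
  have z₂ := h₂.apply_eq_zero hy
  refine le_of_tendsto s₂ ?_
  filter_upwards [s₁.eventually (gt_mem_nhds hv), hl.eventually h₁.mem_iff,
    hl.eventually h₂.mem_iff, self_mem_nhdsWithin] with t ht m₁ m₂ hpos
  have hpos' : (0 : ℝ) < t := hpos
  simp only [slope_def_field, zero_smul, add_zero, z₁, z₂, sub_zero] at ht ⊢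
  have n₁ : ρ₁ (y + t • v) < 0 := by
    by_contra! hc
    exact absurd ht (not_lt.2 (div_nonneg hc hpos'.le))
  have n₂ : ρ₂ (y + t • v) < 0 := m₂.1 (m₁.2 n₁)
  exact (div_neg_of_neg_of_pos n₂ hpos').le

/-- The exterior normal does not depend on the local defining function. -/
theorem exteriorNormal_eq {Ω : Set E} {y : E} {ρ : E → ℝ}
    (hy : y ∈ frontier Ω) (h : IsLocalDefiningFunction Ω y ρ) :
    exteriorNormal Ω y = ‖gradient ρ y‖⁻¹ • gradient ρ y := by
  have hr : IsRegularBoundaryPoint Ω y := ⟨hy, ρ, h⟩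
  rw [exteriorNormal, dif_pos hr]
  have h' := hr.2.choose_spec
  set σ := hr.2.choose
  set a := gradient σ y
  set b := gradient ρ y
  have ha : 0 < ‖a‖ := norm_pos_iff.2 h'.gradient_ne_zero
  have hb : 0 < ‖b‖ := norm_pos_iff.2 h.gradient_ne_zero
  by_contra hne
  have hlt : inner ℝ a b < ‖a‖ * ‖b‖ := by
    refine lt_of_le_of_ne (real_inner_le_norm a b) (fun heq => hne ?_)
    have h6 := inner_eq_norm_mul_iff_real.1 heq
    rw [inv_smul_eq_iff₀ ha.ne', smul_comm, eq_comm, inv_smul_eq_iff₀ hb.ne']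
    exact h6.symm
  have h7 := h'.inner_nonpos h hy (‖a‖ • b - ‖b‖ • a) (by
    have h8 : inner ℝ a (‖a‖ • b - ‖b‖ • a) = ‖a‖ * (inner ℝ a b - ‖a‖ * ‖b‖) := by
      rw [inner_sub_right, inner_smul_right, inner_smul_right, real_inner_self_eq_norm_sq]
      ring
    change inner ℝ a (‖a‖ • b - ‖b‖ • a) < 0
    rw [h8]
    exact mul_neg_of_pos_of_neg ha (by linarith))
  have h9 : inner ℝ b (‖a‖ • b - ‖b‖ • a) = ‖b‖ * (‖a‖ * ‖b‖ - inner ℝ a b) := by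
    rw [inner_sub_right, inner_smul_right, inner_smul_right, real_inner_self_eq_norm_sq,
      real_inner_comm a b]
    ring
  change inner ℝ b (‖a‖ • b - ‖b‖ • a) ≤ 0 at h7
  rw [h9] at h7
  exact absurd h7 (not_le.2 (mul_pos hb (by linarith)))

variable [MeasurableSpace E] [BorelSpace E]

/-- The surface measure `dS` on hypersurfaces of the Euclidean space `E`: the Hausdorff measure of
dimension `dim E - 1`, normalised as Lebesgue measure on hyperplanes. -/
def surfaceMeasure (E : Type*) [NormedAddCommGroup E] [InnerProductSpace ℝ E]
    [MeasurableSpace E] [BorelSpace E] : Measure E :=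
  μHE[Module.finrank ℝ E - 1]

/-- `Ω` has piecewise smooth boundary: the boundary has finite surface area and, apart from a
set of surface measure zero (edges, corners, ...), it is a `C¹` hypersurface with `Ω` on exactly
one side. -/
structure HasPiecewiseSmoothBoundary (Ω : Set E) : Prop where
  finite_area : surfaceMeasure E (frontier Ω) < ⊤
  singular_null :
    surfaceMeasure E {y | y ∈ frontier Ω ∧ ¬ IsRegularBoundaryPoint Ω y} = 0

end Boundary

/-! ## Real alternative `*`-algebras and hypercomplex subspaces -/

/-- Alternativity of a (not necessarily associative) multiplication. -/
class IsAlternative (A : Type*) [Mul A] : Prop where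
  left_alternative : ∀ a b : A, a * (a * b) = (a * a) * b
  right_alternative : ∀ a b : A, (b * a) * a = b * (a * a)

section Algebra

variable {A : Type*} [NonAssocRing A] [Module ℝ A] [StarRing A]

/-- The sphere of imaginary units: `t(x) = x + xᶜ = 0` and `n(x) = x xᶜ = 1`. -/
def imaginarySphere (A : Type*) [NonAssocRing A] [StarRing A] : Set A :=
  {x | x + star x = 0 ∧ x * star x = 1}

/-- The quadratic cone: the real elements `r • 1`, and those `x` whose trace `t(x)` and norm
`n(x)` are real with `4 n(x) > t(x)²`. -/
def quadraticCone (A : Type*) [NonAssocRing A] [Module ℝ A] [StarRing A] : Set A :=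
  {x | (∃ r : ℝ, x = r • (1 : A)) ∨
    ∃ t n : ℝ, x + star x = t • (1 : A) ∧ x * star x = n • (1 : A) ∧ t ^ 2 < 4 * n}

/-- `M` is a hypercomplex subspace: `ℝ ⊊ M ⊆ Q_A`. -/
structure IsHypercomplexSubspace (M : Submodule ℝ A) : Prop where
  real_lt : Submodule.span ℝ {(1 : A)} < M
  subset_cone : (M : Set A) ⊆ quadraticCone A

/-- The basis `(v₀, …, v_m)` of `M` is a hypercomplex basis. -/
structure IsHypercomplexBasis {M : Submodule ℝ A} {m : ℕ}
    (v : Module.Basis (Fin (m + 1)) ℝ M) : Prop where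
  one_le : 1 ≤ m
  zero_eq_one : (v 0 : A) = 1
  mem_sphere : ∀ s, s ≠ 0 → (v s : A) ∈ imaginarySphere A
  anticomm : ∀ s t, s ≠ 0 → t ≠ 0 → s ≠ t → (v s : A) * (v t : A) = -((v t : A) * (v s : A))

end Algebra

/-! ## Calculus of `A`-valued functions on `Mⁿ = ℝ^{(m+1)n}` -/

/-- The coordinate space `ℝ^{(m+1)n}` of `Mⁿ`; the coordinate `x (j, s)` is `x_{j,s}`. -/
abbrev Coord (n m : ℕ) : Type := EuclideanSpace ℝ (Fin n × Fin (m + 1))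

section Components

variable {A : Type*} [AddCommGroup A] [Module ℝ A] {ι : Type*} [Fintype ι]
variable {X : Type*} [MeasurableSpace X]

/-- Integrability on `S` of an `A`-valued function, in terms of its components in the basis `b`. -/
def CompIntegrableOn (b : Module.Basis ι ℝ A) (g : X → A) (S : Set X) (μ : Measure X) : Prop :=
  ∀ t, IntegrableOn (fun y => b.repr (g y) t) S μ

/-- The integral `∑ₜ (∫_S g_t dμ) bₜ` of the `A`-valued function `g = ∑ₜ g_t bₜ`. -/
def compIntegral (b : Module.Basis ι ℝ A) (g : X → A) (S : Set X) (μ : Measure X) : A :=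
  ∑ t, (∫ y in S, b.repr (g y) t ∂μ) • b t

/-- `g ∈ C¹(Ω̄)` for a real-valued `g` (only the values on `Ω̄` matter): `g` is continuous on `Ω̄`
and `C¹` in `Ω`, and its derivative extends continuously to `Ω̄`. -/
structure IsC1OnClosure {E : Type*} [NormedAddCommGroup E] [NormedSpace ℝ E]
    (Ω : Set E) (g : E → ℝ) : Prop where
  continuousOn : ContinuousOn g (closure Ω)
  contDiffOn : ContDiffOn ℝ 1 g Ω
  deriv_extends : ∃ D : E → E →L[ℝ] ℝ, ContinuousOn D (closure Ω) ∧ ∀ x ∈ Ω, fderiv ℝ g x = D x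

/-- `f ∈ C¹(Ω̄, A)`: all components of `f` are in `C¹(Ω̄)`. -/
def CompC1OnClosure {E : Type*} [NormedAddCommGroup E] [NormedSpace ℝ E]
    (b : Module.Basis ι ℝ A) (Ω : Set E) (f : E → A) : Prop :=
  ∀ t, IsC1OnClosure Ω (fun y => b.repr (f y) t)

variable {n m : ℕ}

/-- The partial derivative `∂f/∂x_{j,s} = ∑ₜ (∂f_t/∂x_{j,s}) bₜ`. -/
def partialDeriv (b : Module.Basis ι ℝ A) (f : Coord n m → A) (j : Fin n) (s : Fin (m + 1))
    (x : Coord n m) : A :=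
  ∑ t, (fderiv ℝ (fun y => b.repr (f y) t) x (EuclideanSpace.single (j, s) 1)) • b t

end Components

section Kernel

variable {A : Type*} [NonAssocRing A] [Module ℝ A] [StarRing A]
variable {M : Submodule ℝ A} {n m : ℕ} {ι : Type*} [Fintype ι]

/-- The `j`-th component `x_j = ∑ₛ x_{j,s} vₛ ∈ M` of the point `x`. -/
def comp (v : Module.Basis (Fin (m + 1)) ℝ M) (x : Coord n m) (j : Fin n) : M :=
  ∑ s, x (j, s) • v s

/-- The Dirac operator `∂̄_j f = ∑ₛ vₛ ∂f/∂x_{j,s}`. -/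
def dirac (v : Module.Basis (Fin (m + 1)) ℝ M) (b : Module.Basis ι ℝ A) (j : Fin n)
    (f : Coord n m → A) (x : Coord n m) : A :=
  ∑ s, (v s : A) * partialDeriv b f j s x

/-- The surface area `2 π^{N/2} / Γ(N/2)` of the unit sphere in `ℝ^N`. -/
def sphereArea (N : ℕ) : ℝ := 2 * Real.pi ^ ((N : ℝ) / 2) / Real.Gamma ((N : ℝ) / 2)

/-- The function `K_j(x) = σ_N⁻¹ x_jᶜ / |x|^N` with `N = (m+1)n`. -/
def kernelComp (v : Module.Basis (Fin (m + 1)) ℝ M) (j : Fin n) (x : Coord n m) : A :=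
  ((sphereArea ((m + 1) * n))⁻¹ * (‖x‖ ^ ((m + 1) * n))⁻¹) • star (comp v x j : A)

/-- The density with respect to `dS(y)` of `K(x,y) ∗ f(y)` on `∂Ω`, that is
`∑_j K_j(y - x) (ν_j(y) f(y))` with `ν` the unit exterior normal. -/
def boundaryDensity (v : Module.Basis (Fin (m + 1)) ℝ M) (Ω : Set (Coord n m))
    (f : Coord n m → A) (x y : Coord n m) : A :=
  ∑ j, kernelComp v j (y - x) * ((comp v (exteriorNormal Ω y) j : A) * f y)

end Kernel

end BochnerMartinelli

end

/-!
The formula is Gauss' theorem applied to a regularisation of the kernel.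

*Gauss' theorem.* For a bounded open set `Ω` with piecewise smooth boundary and `g ∈ C¹(Ω̄)` one
has `∫_Ω ∂g/∂e dV = ∫_{∂Ω} g ⟨e, ν⟩ dS` for every direction `e` (`fluxIdentity_of_isC1OnClosure`).
Near a regular boundary point at which the unit vector `e` points outwards, `Ω` lies below the
graph of a continuous function on the hyperplane `e^⊥` (`exists_graph`). Integrating along the
lines parallel to `e`, Fubini's theorem and the fundamental theorem of calculus turn the volume
integral into an integral over `e^⊥`. It remains to see that the projection along `e` carries
`⟨e, ν⟩ dS` to Lebesgue measure on `e^⊥` (`measure_eq_setLIntegral_inner_exteriorNormal`). On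
hyperplanes the projection scales areas by the cosine of the angle
(`normDet_projAlong_orthogonal`); a small piece of a `C¹` hypersurface is nearly flat, so that, up
to a factor arbitrarily close to `1`, the same holds for it
(`exists_surfaceMeasure_projAlong_comparison`), and such local comparisons of measures with
factors tending to `1` give equality. Neither differentiability of the graph nor an area formula
is needed. A direction that does not point outwards is a difference of two that do. A partition of
unity then gives the theorem for functions vanishing near the singular boundary points. These form
a compact set of `(dim - 1)`-dimensional measure zero, so that there are cutoff functions
vanishing near it whose gradients have arbitrarily small `L¹` norm (`exists_cutoff`), and this
disposes of the singular points.

*The kernel.* Let `N = (m+1)n`, and replace `|z|^(-N)` in `K_j` by `(|z|² + ε²)^(-N/2)`. In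
components, `K_j (v_s a)` involves the products `v_{s'}ᶜ (v_s a)`, and these satisfy the Clifford
relations `v_{s'}ᶜ (v_s a) + v_sᶜ (v_{s'} a) = 2 δ_{ss'} a`, for which alternativity suffices
(`IsHypercomplexBasis.star_mul_mul_add_swap`). By these relations the sum over `j` of the
derivatives of the regularised kernel, applied to `f`, collapses to `N ε² (|z|² + ε²)^(-N/2-1) f`,
divided by `σ_N`. The scalar factors are an approximate identity of mass `σ_N`
(`tendsto_integral_regKernel`), so that Gauss' theorem for the regularised kernel yields the
formula in the limit `ε → 0`, by dominated convergence (`sum_mul_kernelDefect`). Interior and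
exterior points `x` are treated at once: in both cases the limit is the value at `x` of the
extension of `f` by zero, which is continuous at `x`.
-/

noncomputable section

namespace BochnerMartinelli

/-! ### Surface measure under projections -/

section Projection

open scoped ENNReal NNReal

variable {E : Type*} [NormedAddCommGroup E] [InnerProductSpace ℝ E]

/-- The orthogonal projection of `E` along the direction of a unit vector `e`, regarded as an
endomorphism of `E`. -/
def projAlong (e : E) : E →L[ℝ] E :=
  ContinuousLinearMap.id ℝ E - (innerSL ℝ e).smulRight e

theorem projAlong_apply (e z : E) : projAlong e z = z - inner ℝ e z • e := by
  simp [projAlong]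

theorem projAlong_add_smul (e z : E) : projAlong e z + inner ℝ e z • e = z := by
  simp [projAlong_apply]

theorem inner_projAlong {e : E} (he : ‖e‖ = 1) (z : E) : inner ℝ e (projAlong e z) = 0 := by
  simp [projAlong_apply, inner_sub_right, inner_smul_right, he]

theorem projAlong_self {e : E} (he : ‖e‖ = 1) : projAlong e e = 0 := by
  simp [projAlong_apply, he]

theorem projAlong_of_inner_eq_zero {e z : E} (h : inner ℝ e z = 0) : projAlong e z = z := by
  simp [projAlong_apply, h]

theorem norm_projAlong_le {e : E} (he : ‖e‖ = 1) (z : E) : ‖projAlong e z‖ ≤ ‖z‖ := by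
  have h : ‖projAlong e z‖ ^ 2 = ‖z‖ ^ 2 - (inner ℝ e z) ^ 2 := by
    rw [projAlong_apply, norm_sub_sq_real, inner_smul_right, norm_smul, he, real_inner_comm]
    simp only [Real.norm_eq_abs, mul_one, sq_abs]
    ring
  have : ‖projAlong e z‖ ^ 2 ≤ ‖z‖ ^ 2 := by rw [h]; nlinarith [sq_nonneg (inner ℝ e z)]
  exact le_of_sq_le_sq this (norm_nonneg _)

variable [FiniteDimensional ℝ E]

theorem finrank_orthogonal_span_singleton_eq {u : E} (hu : ‖u‖ = 1) :
    Module.finrank ℝ (ℝ ∙ u)ᗮ = Module.finrank ℝ E - 1 := by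
  have h1 := (ℝ ∙ u).finrank_add_finrank_orthogonal
  have hu0 : u ≠ 0 := by rintro rfl; simp at hu
  rw [finrank_span_singleton hu0] at h1
  omega

/-- Projecting the hyperplane `u^⊥` along `e` scales areas by the cosine of the angle between
`e` and `u`: the Gram matrix of the projected orthonormal basis is a rank-one perturbation of
the identity. -/
theorem normDet_projAlong_orthogonal {e u : E} (he : ‖e‖ = 1) (hu : ‖u‖ = 1) :
    ((projAlong e : E →ₗ[ℝ] E) ∘ₗ (ℝ ∙ u)ᗮ.subtype).normDet = |inner ℝ e u| := by
  set T := (ℝ ∙ u)ᗮ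
  let q := stdOrthonormalBasis ℝ T
  set f : T →ₗ[ℝ] E := (projAlong e : E →ₗ[ℝ] E) ∘ₗ T.subtype
  have h := f.normDet_sq_eq_det_gram q
  have hT : ∀ x : T, inner ℝ u (x : E) = 0 := fun x =>
    (Submodule.mem_orthogonal_singleton_iff_inner_right).1 x.2
  -- the tangential part of `e`
  let eT : T := ⟨projAlong u e, Submodule.mem_orthogonal_singleton_iff_inner_right.2
    (inner_projAlong hu e)⟩
  have hin : ∀ x : T, inner ℝ x eT = inner ℝ e (x : E) := by
    intro x
    change inner ℝ (x : E) (projAlong u e) = _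
    rw [projAlong_apply, inner_sub_right, inner_smul_right, real_inner_comm u (x : E), hT,
      real_inner_comm]
    simp
  set c : Fin (Module.finrank ℝ T) → ℝ := fun i => inner ℝ e (q i : E)
  have hgram : Matrix.gram ℝ (fun i => f (q i)) =
      1 + Matrix.replicateCol Unit (-c) * Matrix.replicateRow Unit c := by
    ext i j
    have h1 : inner ℝ (q i : E) (q j : E) = (1 : Matrix _ _ ℝ) i j := by
      have := orthonormal_iff_ite.1 q.orthonormal i j
      rw [Matrix.one_apply, ← this]
      rfl
    simp only [Matrix.gram_apply, f, LinearMap.comp_apply, Submodule.subtype_apply,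
      ContinuousLinearMap.coe_coe, projAlong_apply, Matrix.add_apply, Matrix.mul_apply,
      Matrix.replicateCol_apply, Matrix.replicateRow_apply, Finset.univ_unique,
      Finset.sum_singleton, Pi.neg_apply, ← h1, c]
    simp only [inner_sub_left, inner_sub_right, inner_smul_left, inner_smul_right,
      real_inner_self_eq_norm_sq, he, real_inner_comm e (q i : E)]
    simp [sub_eq_add_neg]
  have hsum : ∑ i, c i * c i = 1 - (inner ℝ e u) ^ 2 := by
    have h2 := q.sum_sq_norm_inner_right eT
    have h3 : ‖eT‖ ^ 2 = 1 - (inner ℝ e u) ^ 2 := by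
      change ‖projAlong u e‖ ^ 2 = _
      rw [projAlong_apply, norm_sub_sq_real, inner_smul_right, norm_smul, hu, he,
        real_inner_comm u e]
      simp only [Real.norm_eq_abs, mul_one, sq_abs]
      ring
    rw [← h3, ← h2]
    refine Finset.sum_congr rfl fun i _ => ?_
    rw [hin, Real.norm_eq_abs, sq_abs, sq]
  have hdet : f.normDet ^ 2 = (inner ℝ e u) ^ 2 := by
    have h4 : ((f.normDet ^ 2 : ℝ)) = (Matrix.gram ℝ (fun i => f (q i))).det := by
      exact_mod_cast h
    rw [h4, hgram, Matrix.det_one_add_replicateCol_mul_replicateRow]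
    simp only [dotProduct, Pi.neg_apply, mul_neg, Finset.sum_neg_distrib, hsum]
    ring
  rw [← abs_of_nonneg f.normDet_nonneg]
  exact (sq_eq_sq_iff_abs_eq_abs _ _).1 hdet

variable [MeasurableSpace E] [BorelSpace E]

/-- Projecting a subset of the hyperplane `u^⊥` along `e` scales its area by the cosine of the angle
between `e` and `u`. -/
theorem surfaceMeasure_projAlong_image {e u : E} (he : ‖e‖ = 1) (hu : ‖u‖ = 1)
    {Q : Set E} (hQ : ∀ z ∈ Q, inner ℝ u z = 0) :
    surfaceMeasure E (projAlong e '' Q) = ENNReal.ofReal |inner ℝ e u| * surfaceMeasure E Q := by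
  have h := ((projAlong e : E →ₗ[ℝ] E) ∘ₗ (ℝ ∙ u)ᗮ.subtype).euclideanHausdorffMeasure_image
    (Subtype.val ⁻¹' Q)
  have hQ' : Subtype.val '' (Subtype.val ⁻¹' Q : Set (ℝ ∙ u)ᗮ) = Q := by
    ext z
    refine ⟨?_, fun hz => ⟨⟨z, ?_⟩, hz, rfl⟩⟩
    · rintro ⟨w, hw, rfl⟩
      exact hw
    · exact Submodule.mem_orthogonal_singleton_iff_inner_right.2 (hQ z hz)
  rw [normDet_projAlong_orthogonal he hu, finrank_orthogonal_span_singleton_eq hu,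
    ← (ℝ ∙ u)ᗮ.subtypeₗᵢ.isometry.euclideanHausdorffMeasure_image, Submodule.coe_subtypeₗᵢ,
    Submodule.coe_subtype, hQ'] at h
  rw [surfaceMeasure, ← h, ← hQ', Set.image_image]
  simp

omit [FiniteDimensional ℝ E] in
/-- If `f` expands distances on `S` at most by the factor `k` compared with `g`, then `f '' S` is
the image of `g '' S` under a `k`-Lipschitz map. -/
theorem surfaceMeasure_image_le_of_norm_sub_le {f g : E → E} {S : Set E} {k : ℝ≥0}
    (h : ∀ z ∈ S, ∀ w ∈ S, ‖f z - f w‖ ≤ k * ‖g z - g w‖) :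
    surfaceMeasure E (f '' S) ≤
      (k : ℝ≥0∞) ^ (Module.finrank ℝ E - 1) * surfaceMeasure E (g '' S) := by
  classical
  rcases S.eq_empty_or_nonempty with rfl | ⟨z₀, hz₀⟩
  · simp
  -- `f` factors through `g` on `S` by a Lipschitz map
  have hsel : ∀ y ∈ g '' S, ∃ z ∈ S, g z = y := fun y hy => hy
  choose! s hsS hgs using hsel
  have hlip : LipschitzOnWith k (f ∘ s) (g '' S) := by
    refine LipschitzOnWith.of_dist_le_mul fun y hy y' hy' => ?_
    rw [dist_eq_norm, dist_eq_norm]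
    have := h _ (hsS y hy) _ (hsS y' hy')
    rwa [hgs y hy, hgs y' hy'] at this
  have himg : f '' S ⊆ (f ∘ s) '' (g '' S) := by
    rintro _ ⟨z, hz, rfl⟩
    refine ⟨g z, ⟨z, hz, rfl⟩, ?_⟩
    have hgz : g z ∈ g '' S := ⟨z, hz, rfl⟩
    have := h _ (hsS _ hgz) _ hz
    rw [hgs _ hgz, sub_self, norm_zero, mul_zero] at this
    exact sub_eq_zero.1 (norm_le_zero_iff.1 this)
  refine (measure_mono himg).trans ?_
  have h2 := hlip.hausdorffMeasure_image_le (d := ((Module.finrank ℝ E - 1 : ℕ) : ℝ))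
    (Nat.cast_nonneg _)
  rw [ENNReal.rpow_natCast] at h2
  simp only [surfaceMeasure, Measure.euclideanHausdorffMeasure_def, Measure.smul_apply]
  calc _ ≤ _ := smul_le_smul_of_nonneg_left h2 zero_le
    _ = _ := by rw [mul_smul_comm]

/-- A nearly flat set `S`, almost orthogonal to the unit vector `u`, changes its area under the
projection along `e` by a factor close to `⟨e, u⟩`. -/
theorem exists_surfaceMeasure_projAlong_comparison {e u : E} (he : ‖e‖ = 1) (hu : ‖u‖ = 1)
    (hc : 0 < inner ℝ e u) {K : ℝ≥0} (hK : 1 < K) :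
    ∃ δ : ℝ, 0 < δ ∧ ∀ S : Set E, (∀ z ∈ S, ∀ w ∈ S, |inner ℝ u (z - w)| ≤ δ * ‖z - w‖) →
      surfaceMeasure E (projAlong e '' S) ≤
          K * (ENNReal.ofReal (inner ℝ e u) * surfaceMeasure E S) ∧
        ENNReal.ofReal (inner ℝ e u) * surfaceMeasure E S ≤
          K * surfaceMeasure E (projAlong e '' S) := by
  set c : ℝ := inner ℝ e u
  set d := Module.finrank ℝ E - 1
  -- two Lipschitz comparisons with constant `k` change areas at most by the factor `k ^ (2 * d)`
  obtain ⟨k, hk1, hkK⟩ : ∃ k : ℝ≥0, 1 < k ∧ k ^ (2 * d) < K := by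
    have hcont : ContinuousAt (fun k : ℝ≥0 => k ^ (2 * d)) 1 := by fun_prop
    have h1 : ∀ᶠ k in 𝓝[>] (1 : ℝ≥0), k ^ (2 * d) < K := by
      refine nhdsWithin_le_nhds (hcont.eventually (gt_mem_nhds ?_))
      simpa using hK
    obtain ⟨k, hk, hk'⟩ := (h1.and self_mem_nhdsWithin).exists
    exact ⟨k, hk', hk⟩
  have hk1' : (1 : ℝ) < k := by exact_mod_cast hk1
  -- `C` bounds the inverse of the projection along `e` on the hyperplane `u^⊥`
  set C : ℝ := 1 + 1 / c
  have hC : 1 ≤ C := by simp only [C]; have := one_div_pos.2 hc; linarith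
  set a : ℝ := min ((k : ℝ) - 1) 1
  have ha : 0 < a := lt_min (by linarith) one_pos
  have hak : 1 + a ≤ k := by have := min_le_left ((k : ℝ) - 1) 1; simp only [a]; linarith
  have ha1 : a ≤ 1 := min_le_right _ _
  refine ⟨a / (4 * C), by positivity, fun S hS => ?_⟩
  set δ := a / (4 * C)
  have hδC : 4 * δ * C = a := by simp only [δ]; field_simp
  have hδ0 : 0 < δ := by simp only [δ]; positivity
  have hδa : 4 * δ ≤ a := by nlinarith
  -- the pairwise estimates between the identity, the projection to the tangent hyperplane,
  -- its composition with the projection along `e`, and the projection along `e` itself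
  have key : ∀ v : E, |inner ℝ u v| ≤ δ * ‖v‖ →
      ‖projAlong u v‖ ≤ k * ‖v‖ ∧ ‖v‖ ≤ k * ‖projAlong u v‖ ∧
      ‖projAlong e v‖ ≤ k * ‖projAlong e (projAlong u v)‖ ∧
      ‖projAlong e (projAlong u v)‖ ≤ k * ‖projAlong e v‖ := by
    intro v hv
    set p := projAlong u v
    have hup : inner ℝ u p = 0 := inner_projAlong hu v
    have hvp : v = p + inner ℝ u v • u := (projAlong_add_smul u v).symm
    have hs : ‖inner ℝ u v • u‖ ≤ δ * ‖v‖ := by rwa [norm_smul, hu, mul_one]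
    have h1 : ‖p‖ ≤ ‖v‖ := norm_projAlong_le hu v
    have h2 : ‖v‖ ≤ ‖p‖ + δ * ‖v‖ := by
      calc ‖v‖ = ‖p + inner ℝ u v • u‖ := by rw [← hvp]
        _ ≤ ‖p‖ + ‖inner ℝ u v • u‖ := norm_add_le _ _
        _ ≤ _ := by gcongr
    have hv2 : ‖v‖ ≤ 2 * ‖p‖ := by nlinarith [norm_nonneg v]
    have h3 : ‖v‖ ≤ (1 + a) * ‖p‖ := by nlinarith [norm_nonneg v, norm_nonneg p]
    -- the projection along `e` is bounded below on the tangent hyperplane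
    have h4 : ‖p‖ ≤ C * ‖projAlong e p‖ := by
      have h5 : inner ℝ u (projAlong e p) = -(inner ℝ e p * c) := by
        rw [projAlong_apply, inner_sub_right, hup, inner_smul_right, real_inner_comm e u]
        simp only [c]; ring
      have h6 : |inner ℝ e p| * c ≤ ‖projAlong e p‖ := by
        have := abs_real_inner_le_norm u (projAlong e p)
        rw [h5, abs_neg, abs_mul, abs_of_pos hc, hu, one_mul] at this
        exact this
      have h7 : |inner ℝ e p| ≤ ‖projAlong e p‖ / c := (le_div_iff₀ hc).2 h6
      calc ‖p‖ = ‖projAlong e p + inner ℝ e p • e‖ := by rw [projAlong_add_smul]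
        _ ≤ ‖projAlong e p‖ + ‖inner ℝ e p • e‖ := norm_add_le _ _
        _ = ‖projAlong e p‖ + |inner ℝ e p| := by rw [norm_smul, he, mul_one, Real.norm_eq_abs]
        _ ≤ ‖projAlong e p‖ + ‖projAlong e p‖ / c := by gcongr
        _ = C * ‖projAlong e p‖ := by simp only [C]; ring
    have h8 : ‖projAlong e v - projAlong e p‖ ≤ δ * ‖v‖ := by
      rw [← map_sub]
      refine (norm_projAlong_le he _).trans ?_
      rwa [show v - p = inner ℝ u v • u from by rw [sub_eq_iff_eq_add']; exact hvp]
    have h9 : δ * ‖v‖ ≤ a / 2 * ‖projAlong e p‖ := by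
      have : δ * ‖v‖ ≤ δ * (2 * (C * ‖projAlong e p‖)) := by
        gcongr; linarith
      calc _ ≤ _ := this
        _ = (4 * δ * C) / 2 * ‖projAlong e p‖ := by ring
        _ = _ := by rw [hδC]
    have h10 := norm_sub_norm_le (projAlong e v) (projAlong e p)
    have h11 := norm_sub_norm_le (projAlong e p) (projAlong e v)
    rw [norm_sub_rev] at h11
    have n1 := norm_nonneg v
    have n2 := norm_nonneg p
    have n3 := norm_nonneg (projAlong e v)
    have n4 := norm_nonneg (projAlong e p)
    refine ⟨by nlinarith, by nlinarith, by nlinarith, ?_⟩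
    have h12 : ‖projAlong e p‖ ≤ (1 + a) * ‖projAlong e v‖ := by nlinarith
    nlinarith
  have flat : surfaceMeasure E (projAlong e '' (projAlong u '' S)) =
      ENNReal.ofReal c * surfaceMeasure E (projAlong u '' S) := by
    rw [surfaceMeasure_projAlong_image he hu, abs_of_pos hc]
    rintro _ ⟨z, -, rfl⟩
    exact inner_projAlong hu z
  have key' : ∀ z ∈ S, ∀ w ∈ S, _ := fun z hz w hw => key (z - w) (hS z hz w hw)
  have m1 := surfaceMeasure_image_le_of_norm_sub_le (f := projAlong u) (g := id) (S := S) (k := k)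
    fun z hz w hw => by simpa only [map_sub, id] using (key' z hz w hw).1
  have m2 := surfaceMeasure_image_le_of_norm_sub_le (f := id) (g := projAlong u) (S := S) (k := k)
    fun z hz w hw => by simpa only [map_sub, id] using (key' z hz w hw).2.1
  have m3 := surfaceMeasure_image_le_of_norm_sub_le (f := projAlong e)
    (g := projAlong e ∘ projAlong u) (S := S) (k := k)
    fun z hz w hw => by
      simpa only [map_sub, Function.comp_apply] using (key' z hz w hw).2.2.1
  have m4 := surfaceMeasure_image_le_of_norm_sub_le (f := projAlong e ∘ projAlong u)
    (g := projAlong e) (S := S) (k := k)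
    fun z hz w hw => by
      simpa only [map_sub, Function.comp_apply] using (key' z hz w hw).2.2.2
  rw [Set.image_id] at m1 m2
  rw [Set.image_comp, flat] at m3 m4
  have hKK : (k : ℝ≥0∞) ^ d * (k : ℝ≥0∞) ^ d ≤ K := by
    rw [← pow_add, ← two_mul]
    exact_mod_cast hkK.le
  constructor
  · calc _ ≤ _ := m3
      _ ≤ (k : ℝ≥0∞) ^ d * (ENNReal.ofReal c * ((k : ℝ≥0∞) ^ d * surfaceMeasure E S)) := by gcongr
      _ = ((k : ℝ≥0∞) ^ d * (k : ℝ≥0∞) ^ d) * (ENNReal.ofReal c * surfaceMeasure E S) := by ring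
      _ ≤ _ := by gcongr
  · calc ENNReal.ofReal c * surfaceMeasure E S
        ≤ ENNReal.ofReal c * ((k : ℝ≥0∞) ^ d * surfaceMeasure E (projAlong u '' S)) := by gcongr
      _ = (k : ℝ≥0∞) ^ d * (ENNReal.ofReal c * surfaceMeasure E (projAlong u '' S)) := by ring
      _ ≤ (k : ℝ≥0∞) ^ d * ((k : ℝ≥0∞) ^ d * surfaceMeasure E (projAlong e '' S)) := by gcongr
      _ = ((k : ℝ≥0∞) ^ d * (k : ℝ≥0∞) ^ d) * surfaceMeasure E (projAlong e '' S) := by ring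
      _ ≤ _ := by gcongr

end Projection

section Comparison

open scoped ENNReal NNReal

/-- If near each point of `X` one measure is at most `K` times another one, for every `K > 1`,
then the first measure is at most the second one on `X`. -/
theorem measure_le_of_locally_le_mul {E : Type*} [TopologicalSpace E] [SecondCountableTopology E]
    [MeasurableSpace E] [OpensMeasurableSpace E] {μ ν : Measure E} {X : Set E}
    (hX : MeasurableSet X)
    (h : ∀ K : ℝ≥0, 1 < K → ∀ x ∈ X, ∃ V ∈ 𝓝 x, ∀ S ⊆ V ∩ X, MeasurableSet S → μ S ≤ K * ν S) :
    μ X ≤ ν X := by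
  have hK : ∀ K : ℝ≥0, 1 < K → μ X ≤ K * ν X := by
    intro K hK
    have h1 : ∀ x ∈ X, ∃ V : Set E, IsOpen V ∧ x ∈ V ∧
        ∀ S ⊆ V ∩ X, MeasurableSet S → μ S ≤ K * ν S := by
      intro x hx
      obtain ⟨V, hV, hS⟩ := h K hK x hx
      obtain ⟨W, hWV, hW, hxW⟩ := mem_nhds_iff.1 hV
      exact ⟨W, hW, hxW, fun S hSW => hS S (hSW.trans (by gcongr))⟩
    choose! V hVo hxV hVS using h1
    obtain ⟨t, htX, htc, hcov⟩ := TopologicalSpace.countable_cover_nhdsWithin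
      (f := V) (s := X) fun x hx => mem_nhdsWithin_of_mem_nhds ((hVo x hx).mem_nhds (hxV x hx))
    rcases X.eq_empty_or_nonempty with rfl | hne
    · simp
    have htne : t.Nonempty := by
      obtain ⟨x, hx⟩ := hne
      obtain ⟨y, hy, -⟩ := Set.mem_iUnion₂.1 (hcov hx)
      exact ⟨y, hy⟩
    obtain ⟨s, hs⟩ := htc.exists_eq_range htne
    have hsX : ∀ i, s i ∈ X := fun i => htX (hs ▸ Set.mem_range_self i)
    -- a countable partition of `X` subordinate to the cover
    set D : ℕ → Set E := disjointed fun i => V (s i) ∩ X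
    have hDm : ∀ i, MeasurableSet (D i) :=
      fun i => MeasurableSet.disjointed (fun i => (hVo _ (hsX i)).measurableSet.inter hX) i
    have hDX : X = ⋃ i, D i := by
      rw [iUnion_disjointed, ← Set.iUnion_inter, eq_comm, Set.inter_eq_right]
      intro x hx
      have := hcov hx
      rw [hs, Set.biUnion_range] at this
      exact this
    have hdisj : Pairwise (Function.onFun Disjoint D) := disjoint_disjointed _
    calc μ X = ∑' i, μ (D i) := by rw [hDX, measure_iUnion hdisj hDm]
      _ ≤ ∑' i, K * ν (D i) :=
        ENNReal.tsum_le_tsum fun i => hVS _ (hsX i) _ (disjointed_subset _ i) (hDm i)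
      _ = K * ν X := by rw [ENNReal.tsum_mul_left, hDX, measure_iUnion hdisj hDm]
  rcases eq_or_ne (ν X) ⊤ with hν | hν
  · rw [hν]; exact le_top
  · have hlim : Filter.Tendsto (fun K : ℝ≥0 => (K : ℝ≥0∞) * ν X) (𝓝[>] 1) (𝓝 (1 * ν X)) := by
      have h2 : Filter.Tendsto (fun K : ℝ≥0 => (K : ℝ≥0∞)) (𝓝[>] 1) (𝓝 ((1 : ℝ≥0) : ℝ≥0∞)) :=
        (ENNReal.tendsto_coe.2 Filter.tendsto_id).mono_left nhdsWithin_le_nhds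
      simpa using ENNReal.Tendsto.mul_const h2 (Or.inr hν)
    rw [one_mul] at hlim
    exact ge_of_tendsto hlim (by filter_upwards [self_mem_nhdsWithin] with K hK' using hK K hK')

end Comparison

/-! ### Local structure of the boundary at regular points -/

section Regular

variable {E : Type*} [NormedAddCommGroup E] [InnerProductSpace ℝ E] [CompleteSpace E]

theorem inner_gradient_eq_fderiv (ρ : E → ℝ) (y v : E) :
    inner ℝ (gradient ρ y) v = fderiv ℝ ρ y v := by
  simp [gradient, InnerProductSpace.toDual_symm_apply]

theorem continuousAt_gradient {ρ : E → ℝ} {y : E} (h : ContDiffAt ℝ 1 ρ y) :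
    ContinuousAt (gradient ρ) y := by
  have h1 : ContinuousAt (fderiv ℝ ρ) y := h.continuousAt_fderiv (by norm_num)
  exact (LinearIsometryEquiv.continuous _).continuousAt.comp h1

theorem IsLocalDefiningFunction.eventually {Ω : Set E} {y : E} {ρ : E → ℝ}
    (h : IsLocalDefiningFunction Ω y ρ) : ∀ᶠ z in 𝓝 y, IsLocalDefiningFunction Ω z ρ := by
  filter_upwards [h.contDiffAt.eventually (by simp), h.mem_iff.eventually_nhds,
    (continuousAt_gradient h.contDiffAt).eventually_ne h.gradient_ne_zero] with z h1 h2 h3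
  exact ⟨h1, h3, h2⟩

/-- The set of singular boundary points is closed. -/
theorem isClosed_singular (Ω : Set E) :
    IsClosed {y | y ∈ frontier Ω ∧ ¬ IsRegularBoundaryPoint Ω y} := by
  rw [← isOpen_compl_iff, isOpen_iff_mem_nhds]
  intro y hy
  by_cases hf : y ∈ frontier Ω
  · have hr : IsRegularBoundaryPoint Ω y := by
      by_contra hr
      exact hy ⟨hf, hr⟩
    obtain ⟨ρ, hρ⟩ := hr.2
    filter_upwards [hρ.eventually] with z hz hz'
    exact hz'.2 ⟨hz'.1, ρ, hz⟩
  · filter_upwards [isClosed_frontier.isOpen_compl.mem_nhds hf] with z hz hz'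
    exact hz hz'.1

theorem norm_exteriorNormal_of_regular {Ω : Set E} {y : E} (h : IsRegularBoundaryPoint Ω y) :
    ‖exteriorNormal Ω y‖ = 1 := by
  obtain ⟨ρ, hρ⟩ := h.2
  rw [exteriorNormal_eq h.1 hρ, norm_smul, norm_inv, norm_norm,
    inv_mul_cancel₀ (norm_ne_zero_iff.2 hρ.gradient_ne_zero)]

theorem norm_exteriorNormal_le (Ω : Set E) (y : E) : ‖exteriorNormal Ω y‖ ≤ 1 := by
  by_cases h : IsRegularBoundaryPoint Ω y
  · exact (norm_exteriorNormal_of_regular h).le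
  · simp [exteriorNormal, h]

theorem continuousOn_exteriorNormal (Ω : Set E) :
    ContinuousOn (exteriorNormal Ω) {y | IsRegularBoundaryPoint Ω y} := by
  intro y hy
  obtain ⟨ρ, hρ⟩ := hy.2
  have hg := continuousAt_gradient hρ.contDiffAt
  have h1 : ContinuousAt (fun z => ‖gradient ρ z‖⁻¹ • gradient ρ z) y :=
    (hg.norm.inv₀ (norm_ne_zero_iff.2 hρ.gradient_ne_zero)).smul hg
  refine h1.continuousWithinAt.congr_of_eventuallyEq ?_ (exteriorNormal_eq hy.1 hρ)
  filter_upwards [mem_nhdsWithin_of_mem_nhds hρ.eventually, self_mem_nhdsWithin] with z hz hz'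
  exact exteriorNormal_eq hz'.1 hz

/-- Near a regular boundary point the boundary is almost orthogonal to the exterior normal. -/
theorem exists_nhds_inner_exteriorNormal_le {Ω : Set E} {y : E} (h : IsRegularBoundaryPoint Ω y)
    {δ : ℝ} (hδ : 0 < δ) :
    ∃ V ∈ 𝓝 y, ∀ z ∈ V ∩ frontier Ω, ∀ w ∈ V ∩ frontier Ω,
      |inner ℝ (exteriorNormal Ω y) (z - w)| ≤ δ * ‖z - w‖ := by
  obtain ⟨ρ, hρ⟩ := h.2
  have hg : 0 < ‖gradient ρ y‖ := norm_pos_iff.2 hρ.gradient_ne_zero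
  have hs : HasStrictFDerivAt ρ (fderiv ℝ ρ y) y :=
    hρ.contDiffAt.hasStrictFDerivAt (by norm_num)
  have h1 := hs.isLittleO.def (mul_pos hδ hg)
  rw [nhds_prod_eq, Filter.eventually_prod_self_iff'] at h1
  obtain ⟨V, hV, hV'⟩ := h1
  refine ⟨V ∩ {z | IsLocalDefiningFunction Ω z ρ}, Filter.inter_mem hV hρ.eventually,
    fun z hz w hw => ?_⟩
  have h2 := hV' z hz.1.1 w hw.1.1
  simp only [hz.1.2.apply_eq_zero hz.2, hw.1.2.apply_eq_zero hw.2, sub_self, zero_sub,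
    norm_neg, Real.norm_eq_abs] at h2
  rw [exteriorNormal_eq h.1 hρ, inner_smul_left, inner_gradient_eq_fderiv, abs_mul]
  simp only [conj_trivial, abs_inv, abs_norm]
  rw [inv_mul_le_iff₀ hg]
  linarith

variable [FiniteDimensional ℝ E] [MeasurableSpace E] [BorelSpace E]

open scoped ENNReal NNReal

/-- The area of the projection along `e` of a piece `X` of the regular boundary on which the
projection is injective (so that `S ↦ area (projAlong e '' S)` is a measure `μ`) is the flux of
`e` through `X`. -/
theorem measure_eq_setLIntegral_inner_exteriorNormal {Ω : Set E} {e : E} (he : ‖e‖ = 1)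
    {μ : Measure E} {X : Set E} (hX : MeasurableSet X)
    (hreg : ∀ z ∈ X, IsRegularBoundaryPoint Ω z ∧ 0 < inner ℝ e (exteriorNormal Ω z))
    (hμ : ∀ S ⊆ X, MeasurableSet S → μ S = surfaceMeasure E (projAlong e '' S)) :
    μ X = ∫⁻ z in X, ENNReal.ofReal (inner ℝ e (exteriorNormal Ω z)) ∂(surfaceMeasure E) := by
  set q : E → ℝ := fun z => inner ℝ e (exteriorNormal Ω z)
  have hq : ContinuousOn q X := by
    have := (continuousOn_exteriorNormal Ω).mono (fun z hz => (hreg z hz).1 : X ⊆ _)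
    exact continuousOn_const.inner this
  -- on a small neighbourhood of `y` in `X` both set functions are close to `q y` times the area
  have main : ∀ K : ℝ≥0, 1 < K → ∀ y ∈ X, ∃ V ∈ 𝓝 y, ∀ S ⊆ V ∩ X, MeasurableSet S →
      μ S ≤ K * ∫⁻ z in S, ENNReal.ofReal (q z) ∂(surfaceMeasure E) ∧
      ∫⁻ z in S, ENNReal.ofReal (q z) ∂(surfaceMeasure E) ≤ K * μ S := by
    intro K hK y hy
    obtain ⟨k, hk1, hkK⟩ : ∃ k : ℝ≥0, 1 < k ∧ k * k < K := by
      have hcont : ContinuousAt (fun k : ℝ≥0 => k * k) 1 := by fun_prop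
      have h1 : ∀ᶠ k in 𝓝[>] (1 : ℝ≥0), k * k < K := by
        refine nhdsWithin_le_nhds (hcont.eventually (gt_mem_nhds ?_))
        simpa using hK
      obtain ⟨k, hk, hk'⟩ := (h1.and self_mem_nhdsWithin).exists
      exact ⟨k, hk', hk⟩
    have hk1' : (1 : ℝ) < k := by exact_mod_cast hk1
    have hqy : 0 < q y := (hreg y hy).2
    obtain ⟨δ, hδ, hcomp⟩ := exists_surfaceMeasure_projAlong_comparison he
      (norm_exteriorNormal_of_regular (hreg y hy).1) hqy hk1
    obtain ⟨V₁, hV₁, hV₁'⟩ := exists_nhds_inner_exteriorNormal_le (hreg y hy).1 hδ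
    have hev : ∀ᶠ z in 𝓝[X] y, q z < k * q y ∧ q y < k * q z := by
      have t1 : q y < k * q y := by nlinarith
      exact ((hq y hy).eventually (gt_mem_nhds t1)).and
        (((hq y hy).const_mul (k : ℝ)).eventually (lt_mem_nhds t1))
    obtain ⟨V₂, hV₂, hV₂'⟩ := mem_nhdsWithin_iff_exists_mem_nhds_inter.1 hev
    refine ⟨V₁ ∩ V₂, Filter.inter_mem hV₁ hV₂, fun S hS hSm => ?_⟩
    obtain ⟨c1, c2⟩ := hcomp S fun z hz w hw =>
      hV₁' z ⟨(hS hz).1.1, (hreg z (hS hz).2).1.1⟩ w ⟨(hS hw).1.1, (hreg w (hS hw).2).1.1⟩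
    have hz : ∀ z ∈ S, q z < k * q y ∧ q y < k * q z := fun z hz => hV₂' ⟨(hS hz).1.2, (hS hz).2⟩
    rw [hμ S (hS.trans Set.inter_subset_right) hSm]
    have b1 : ENNReal.ofReal (q y) * surfaceMeasure E S ≤
        k * ∫⁻ z in S, ENNReal.ofReal (q z) ∂(surfaceMeasure E) := by
      rw [← lintegral_const_mul' _ _ ENNReal.coe_ne_top, ← setLIntegral_const]
      refine setLIntegral_mono' hSm fun z hzS => ?_
      rw [← ENNReal.ofReal_coe_nnreal, ← ENNReal.ofReal_mul (by positivity)]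
      exact ENNReal.ofReal_le_ofReal (hz z hzS).2.le
    have b2 : ∫⁻ z in S, ENNReal.ofReal (q z) ∂(surfaceMeasure E) ≤
        k * (ENNReal.ofReal (q y) * surfaceMeasure E S) := by
      rw [← mul_assoc, ← setLIntegral_const]
      refine setLIntegral_mono' hSm fun z hzS => ?_
      rw [← ENNReal.ofReal_coe_nnreal, ← ENNReal.ofReal_mul (by positivity)]
      exact ENNReal.ofReal_le_ofReal (hz z hzS).1.le
    have hkK' : (k : ℝ≥0∞) * k ≤ K := by exact_mod_cast hkK.le
    constructor
    · calc _ ≤ _ := c1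
        _ ≤ (k : ℝ≥0∞) * (k * ∫⁻ z in S, ENNReal.ofReal (q z) ∂(surfaceMeasure E)) := by gcongr
        _ ≤ _ := by rw [← mul_assoc]; gcongr
    · calc _ ≤ _ := b2
        _ ≤ (k : ℝ≥0∞) * (k * surfaceMeasure E (projAlong e '' S)) := by gcongr
        _ ≤ _ := by rw [← mul_assoc]; gcongr
  have hden : ∀ S, MeasurableSet S →
      ((surfaceMeasure E).withDensity fun z => ENNReal.ofReal (q z)) S =
        ∫⁻ z in S, ENNReal.ofReal (q z) ∂(surfaceMeasure E) := fun S hS => withDensity_apply _ hS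
  rw [← hden X hX]
  apply le_antisymm
  · refine measure_le_of_locally_le_mul hX fun K hK y hy => ?_
    obtain ⟨V, hV, h⟩ := main K hK y hy
    exact ⟨V, hV, fun S hS hSm => by rw [hden S hSm]; exact (h S hS hSm).1⟩
  · refine measure_le_of_locally_le_mul hX fun K hK y hy => ?_
    obtain ⟨V, hV, h⟩ := main K hK y hy
    exact ⟨V, hV, fun S hS hSm => by rw [hden S hSm]; exact (h S hS hSm).2⟩

end Regular

section Graph

variable {E : Type*} [NormedAddCommGroup E] [InnerProductSpace ℝ E] [CompleteSpace E]

/-- Near a regular boundary point at which `e` points outwards, the domain is, in a cylinder with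
axis `e` over an open set `B` of the hyperplane `e^⊥`, the set below the graph of a continuous
function `γ`. -/
theorem exists_graph {Ω : Set E} {y : E} {ρ : E → ℝ} (hy : y ∈ frontier Ω)
    (hρ : IsLocalDefiningFunction Ω y ρ) {e : E} (he : ‖e‖ = 1) (hpos : 0 < fderiv ℝ ρ y e) :
    ∃ (B : Set (ℝ ∙ e)ᗮ) (a b : ℝ) (γ : (ℝ ∙ e)ᗮ → ℝ),
      IsOpen B ∧ ContinuousOn γ B ∧ (∀ h ∈ B, γ h ∈ Set.Ioo a b) ∧
      (∃ C : Set E, IsOpen C ∧ y ∈ C ∧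
        ∀ z, z ∈ C ↔ (∃ h ∈ B, (h : E) = projAlong e z) ∧ inner ℝ e z ∈ Set.Ioo a b) ∧
      (∀ h ∈ B, ∀ t ∈ Set.Icc a b, (h : E) + t • e ∈ Ω ↔ t < γ h) ∧
      (∀ h ∈ B, ∀ t ∈ Set.Icc a b, (h : E) + t • e ∈ frontier Ω ↔ t = γ h) ∧
      (∀ h ∈ B, ∀ t ∈ Set.Icc a b, (h : E) + t • e ∈ frontier Ω →
        IsRegularBoundaryPoint Ω (h + t • e) ∧
          0 < inner ℝ e (exteriorNormal Ω (h + t • e))) := by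
  have hev : ∀ᶠ z in 𝓝 y, IsLocalDefiningFunction Ω z ρ ∧ 0 < fderiv ℝ ρ z e := by
    have h1 : ContinuousAt (fun z => fderiv ℝ ρ z e) y :=
      (hρ.contDiffAt.continuousAt_fderiv (by norm_num)).clm_apply continuousAt_const
    exact hρ.eventually.and (h1.eventually (lt_mem_nhds hpos))
  obtain ⟨R, hR, hball⟩ := Metric.eventually_nhds_iff.1 hev
  set H := (ℝ ∙ e)ᗮ
  have hmemH : ∀ z : E, projAlong e z ∈ H := fun z =>
    Submodule.mem_orthogonal_singleton_iff_inner_right.2 (inner_projAlong he z)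
  set h₀ : H := ⟨projAlong e y, hmemH y⟩
  set t₀ : ℝ := inner ℝ e y
  have hy₀ : (h₀ : E) + t₀ • e = y := projAlong_add_smul e y
  set a := t₀ - R / 2
  set b := t₀ + R / 2
  have hab : a < b := by simp only [a, b]; linarith
  have hcyl : ∀ h : H, ‖h - h₀‖ < R / 2 → ∀ t ∈ Set.Icc a b, dist ((h : E) + t • e) y < R := by
    intro h hh t ht
    have h1 : (h : E) + t • e - y = ((h - h₀ : H) : E) + (t - t₀) • e := by
      rw [← hy₀, Submodule.coe_sub, sub_smul]; abel
    have h2 : ‖(t - t₀) • e‖ ≤ R / 2 := by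
      rw [norm_smul, he, mul_one, Real.norm_eq_abs, abs_le]
      simp only [a, b, Set.mem_Icc] at ht
      constructor <;> linarith [ht.1, ht.2]
    rw [dist_eq_norm, h1]
    refine (norm_add_le _ _).trans_lt ?_
    have h3 : ‖((h - h₀ : H) : E)‖ = ‖h - h₀‖ := rfl
    linarith
  have hderiv : ∀ h : H, ‖h - h₀‖ < R / 2 → ∀ t ∈ Set.Icc a b,
      HasDerivAt (fun t : ℝ => ρ (h + t • e)) (fderiv ℝ ρ (h + t • e) e) t := by
    intro h hh t ht
    have hd : HasFDerivAt ρ (fderiv ℝ ρ (h + t • e)) ((h : E) + t • e) :=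
      ((hball (hcyl h hh t ht)).1.contDiffAt.differentiableAt (by norm_num)).hasFDerivAt
    have hl : HasDerivAt (fun t : ℝ => (h : E) + t • e) e t := by
      simpa using ((hasDerivAt_id t).smul_const e).const_add (h : E)
    exact hd.comp_hasDerivAt t hl
  have hmono : ∀ h : H, ‖h - h₀‖ < R / 2 →
      StrictMonoOn (fun t : ℝ => ρ (h + t • e)) (Set.Icc a b) := by
    intro h hh
    refine strictMonoOn_of_deriv_pos (convex_Icc a b)
      (fun t ht => (hderiv h hh t ht).continuousAt.continuousWithinAt) fun t ht => ?_
    have ht' := interior_subset ht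
    rw [(hderiv h hh t ht').deriv]
    exact (hball (hcyl h hh t ht')).2
  have hcont : ∀ h : H, ‖h - h₀‖ < R / 2 → ∀ t ∈ Set.Icc a b,
      ContinuousAt (fun h' : H => ρ (h' + t • e)) h := by
    intro h hh t ht
    have hc : ContinuousAt ρ ((h : E) + t • e) :=
      (hball (hcyl h hh t ht)).1.contDiffAt.continuousAt
    exact ContinuousAt.comp' (f := fun h' : H => (h' : E) + t • e) hc (by fun_prop)
  have hR2 : ‖h₀ - h₀‖ < R / 2 := by simpa using half_pos hR
  have hρ0 : ρ (h₀ + t₀ • e) = 0 := by rw [hy₀]; exact hρ.apply_eq_zero hy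
  have ht₀ : t₀ ∈ Set.Icc a b := by constructor <;> simp only [a, b] <;> linarith
  have haI : a ∈ Set.Icc a b := Set.left_mem_Icc.2 hab.le
  have hbI : b ∈ Set.Icc a b := Set.right_mem_Icc.2 hab.le
  have hlow : ρ (h₀ + a • e) < 0 := by
    rw [← hρ0]; exact hmono h₀ hR2 haI ht₀ (by simp only [a]; linarith)
  have hupp : 0 < ρ (h₀ + b • e) := by
    rw [← hρ0]; exact hmono h₀ hR2 ht₀ hbI (by simp only [b]; linarith)
  have hevB : ∀ᶠ h in 𝓝 h₀, ‖h - h₀‖ < R / 2 ∧ ρ (h + a • e) < 0 ∧ 0 < ρ (h + b • e) := by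
    refine Filter.Eventually.and ?_ (((hcont h₀ hR2 a haI).eventually (gt_mem_nhds hlow)).and
      ((hcont h₀ hR2 b hbI).eventually (lt_mem_nhds hupp)))
    filter_upwards [Metric.ball_mem_nhds h₀ (half_pos hR)] with h hh
    simpa [dist_eq_norm] using hh
  obtain ⟨B, hB, hBo, hB₀⟩ := mem_nhds_iff.1 hevB
  have hzero : ∀ h ∈ B, ∃ t ∈ Set.Ioo a b, ρ (h + t • e) = 0 := by
    intro h hh
    have := intermediate_value_Ioo hab.le
      (fun t ht => (hderiv h (hB hh).1 t ht).continuousAt.continuousWithinAt)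
    exact this ⟨(hB hh).2.1, (hB hh).2.2⟩
  choose! γ hγ hγ0 using hzero
  have hneg : ∀ h ∈ B, ∀ t ∈ Set.Icc a b, ρ (h + t • e) < 0 ↔ t < γ h := by
    intro h hh t ht
    rw [← hγ0 h hh]
    exact (hmono h (hB hh).1).lt_iff_lt ht (Set.Ioo_subset_Icc_self (hγ h hh))
  have hpos' : ∀ h ∈ B, ∀ t ∈ Set.Icc a b, 0 < ρ (h + t • e) ↔ γ h < t := by
    intro h hh t ht
    rw [← hγ0 h hh]
    exact (hmono h (hB hh).1).lt_iff_lt (Set.Ioo_subset_Icc_self (hγ h hh)) ht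
  have hΩ : ∀ h ∈ B, ∀ t ∈ Set.Icc a b, (h : E) + t • e ∈ Ω ↔ t < γ h := by
    intro h hh t ht
    rw [← hneg h hh t ht]
    exact (hball (hcyl h (hB hh).1 t ht)).1.mem_iff.self_of_nhds
  have hfr : ∀ h ∈ B, ∀ t ∈ Set.Icc a b, (h : E) + t • e ∈ frontier Ω ↔ t = γ h := by
    intro h hh t ht
    constructor
    · intro hf
      have h0 := (hball (hcyl h (hB hh).1 t ht)).1.apply_eq_zero hf
      apply le_antisymm
      · exact not_lt.1 fun hlt => by
          have := (hpos' h hh t ht).2 hlt; linarith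
      · exact not_lt.1 fun hlt => by
          have := (hneg h hh t ht).2 hlt; linarith
    · rintro rfl
      have hnot : (h : E) + γ h • e ∉ Ω := fun hmem => lt_irrefl _ ((hΩ h hh _ ht).1 hmem)
      refine ⟨?_, fun hi => hnot (interior_subset hi)⟩
      have hl : Filter.Tendsto (fun t : ℝ => (h : E) + t • e) (𝓝[<] (γ h))
          (𝓝 ((h : E) + γ h • e)) := by
        have : ContinuousAt (fun t : ℝ => (h : E) + t • e) (γ h) := by fun_prop
        exact this.tendsto.mono_left nhdsWithin_le_nhds
      refine mem_closure_of_tendsto hl ?_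
      filter_upwards [Ioo_mem_nhdsLT (hγ h hh).1] with t' ht'
      exact (hΩ h hh t' ⟨ht'.1.le, ht'.2.le.trans (hγ h hh).2.le⟩).2 ht'.2
  refine ⟨B, a, b, γ, hBo, ?_, hγ, ?_, hΩ, hfr, ?_⟩
  · intro h hh
    refine ContinuousAt.continuousWithinAt (tendsto_order.2 ⟨fun l hl => ?_, fun l hl => ?_⟩)
    · rcases lt_or_ge l a with hla | hla
      · filter_upwards [hBo.mem_nhds hh] with h' hh'
        exact hla.trans (hγ h' hh').1
      · have hlI : l ∈ Set.Icc a b := ⟨hla, hl.le.trans (hγ h hh).2.le⟩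
        filter_upwards [hBo.mem_nhds hh, (hcont h (hB hh).1 l hlI).eventually
          (gt_mem_nhds ((hneg h hh l hlI).2 hl))] with h' hh' hlt
        exact (hneg h' hh' l hlI).1 hlt
    · rcases lt_or_ge b l with hla | hla
      · filter_upwards [hBo.mem_nhds hh] with h' hh'
        exact (hγ h' hh').2.trans hla
      · have hlI : l ∈ Set.Icc a b := ⟨(hγ h hh).1.le.trans hl.le, hla⟩
        filter_upwards [hBo.mem_nhds hh, (hcont h (hB hh).1 l hlI).eventually
          (lt_mem_nhds ((hpos' h hh l hlI).2 hl))] with h' hh' hlt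
        exact (hpos' h' hh' l hlI).1 hlt
  · have c1 : Continuous fun z : E => (⟨projAlong e z, hmemH z⟩ : H) := by fun_prop
    have c2 : Continuous fun z : E => inner ℝ e z := by fun_prop
    refine ⟨_, (hBo.preimage c1).inter ((isOpen_Ioo (a := a) (b := b)).preimage c2),
      ⟨hB₀, by constructor <;> simp only [a, b] <;> linarith⟩, fun z => ?_⟩
    refine and_congr_left fun _ => ⟨fun hz => ⟨_, hz, rfl⟩, ?_⟩
    rintro ⟨h, hh, hz⟩
    have : h = ⟨projAlong e z, hmemH z⟩ := Subtype.ext hz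
    rwa [this] at hh
  · intro h hh t ht hf
    obtain ⟨hd, hp⟩ := hball (hcyl h (hB hh).1 t ht)
    refine ⟨⟨hf, ρ, hd⟩, ?_⟩
    rw [exteriorNormal_eq hf hd, inner_smul_right, real_inner_comm, inner_gradient_eq_fderiv]
    exact mul_pos (inv_pos.2 (norm_pos_iff.2 hd.gradient_ne_zero)) hp

end Graph

/-! ### Functions of class `C¹` up to the boundary -/

section C1

variable {E : Type*} [NormedAddCommGroup E] [NormedSpace ℝ E] {Ω : Set E} {g : E → ℝ}

theorem IsC1OnClosure.differentiableAt (hg : IsC1OnClosure Ω g) (hΩ : IsOpen Ω) {z : E}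
    (hz : z ∈ Ω) : DifferentiableAt ℝ g z :=
  (hg.contDiffOn.differentiableOn (by norm_num)).differentiableAt (hΩ.mem_nhds hz)

theorem IsC1OnClosure.mul_left (hg : IsC1OnClosure Ω g) (hΩ : IsOpen Ω) {φ : E → ℝ}
    (hφ : ContDiff ℝ 1 φ) : IsC1OnClosure Ω (fun z => φ z * g z) := by
  obtain ⟨D, hD, hD'⟩ := hg.deriv_extends
  refine ⟨hφ.continuous.continuousOn.mul hg.continuousOn, hφ.contDiffOn.mul hg.contDiffOn,
    fun z => φ z • D z + g z • fderiv ℝ φ z, ?_, fun z hz => ?_⟩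
  · exact (hφ.continuous.continuousOn.smul hD).add
      (hg.continuousOn.smul (hφ.continuous_fderiv (by norm_num)).continuousOn)
  · rw [fderiv_fun_mul (hφ.differentiable (by norm_num) z) (hg.differentiableAt hΩ hz), hD' z hz]

variable [FiniteDimensional ℝ E]

theorem IsC1OnClosure.exists_bound (hg : IsC1OnClosure Ω g) (hb : Bornology.IsBounded Ω) :
    ∃ M : ℝ, 0 ≤ M ∧ ∀ z ∈ closure Ω, |g z| ≤ M := by
  have : ProperSpace E := FiniteDimensional.proper ℝ E
  obtain ⟨M, hM⟩ := hb.isCompact_closure.exists_bound_of_continuousOn hg.continuousOn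
  exact ⟨max M 0, le_max_right _ _, fun z hz => (hM z hz).trans (le_max_left _ _)⟩

theorem IsC1OnClosure.exists_bound_fderiv (hg : IsC1OnClosure Ω g)
    (hb : Bornology.IsBounded Ω) (e : E) :
    ∃ M : ℝ, 0 ≤ M ∧ ∀ z ∈ Ω, |fderiv ℝ g z e| ≤ M := by
  have : ProperSpace E := FiniteDimensional.proper ℝ E
  obtain ⟨D, hD, hD'⟩ := hg.deriv_extends
  obtain ⟨M, hM⟩ := hb.isCompact_closure.exists_bound_of_continuousOn
    (hD.clm_apply (continuousOn_const (c := e)))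
  exact ⟨max M 0, le_max_right _ _, fun z hz => by
    rw [hD' z hz]; exact (hM z (subset_closure hz)).trans (le_max_left _ _)⟩

variable [MeasurableSpace E] [BorelSpace E]

omit [FiniteDimensional ℝ E] in
theorem IsC1OnClosure.aestronglyMeasurable_fderiv (hg : IsC1OnClosure Ω g) (hΩ : IsOpen Ω) (e : E)
    (μ : Measure E) : AEStronglyMeasurable (fun z => fderiv ℝ g z e) (μ.restrict Ω) := by
  obtain ⟨D, hD, hD'⟩ := hg.deriv_extends
  have : ContinuousOn (fun z => fderiv ℝ g z e) Ω :=
    ((hD.mono subset_closure).clm_apply continuousOn_const).congr fun z hz => by rw [hD' z hz]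
  exact this.aestronglyMeasurable hΩ.measurableSet

theorem IsC1OnClosure.integrableOn_fderiv (hg : IsC1OnClosure Ω g) (hΩ : IsOpen Ω)
    (hb : Bornology.IsBounded Ω) (e : E) (μ : Measure E) [IsFiniteMeasureOnCompacts μ] :
    IntegrableOn (fun z => fderiv ℝ g z e) Ω μ := by
  have : ProperSpace E := FiniteDimensional.proper ℝ E
  obtain ⟨M, -, hM⟩ := hg.exists_bound_fderiv hb e
  exact IntegrableOn.of_bound hb.measure_lt_top
    (hg.aestronglyMeasurable_fderiv hΩ e μ) M
    ((ae_restrict_iff' hΩ.measurableSet).2 (Filter.Eventually.of_forall hM))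

end C1

/-! ### The flux identity near a boundary point -/

section LocalFlux

open scoped ENNReal NNReal

variable {E : Type*} [NormedAddCommGroup E] [InnerProductSpace ℝ E] [CompleteSpace E]
  [MeasurableSpace E] [BorelSpace E]

theorem aestronglyMeasurable_exteriorNormal {Ω : Set E} [SecondCountableTopology E]
    (h : HasPiecewiseSmoothBoundary Ω) :
    AEStronglyMeasurable (exteriorNormal Ω) ((surfaceMeasure E).restrict (frontier Ω)) := by
  have hset : {y | IsRegularBoundaryPoint Ω y} =
      frontier Ω \ {y | y ∈ frontier Ω ∧ ¬ IsRegularBoundaryPoint Ω y} := by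
    ext y
    constructor
    · exact fun hy => ⟨hy.1, fun hy' => hy'.2 hy⟩
    · rintro ⟨hy, hy'⟩
      by_contra hr
      exact hy' ⟨hy, hr⟩
  have hm : MeasurableSet {y | IsRegularBoundaryPoint Ω y} := by
    rw [hset]
    exact isClosed_frontier.measurableSet.diff (isClosed_singular Ω).measurableSet
  have h1 := (continuousOn_exteriorNormal Ω).aestronglyMeasurable (μ := surfaceMeasure E) hm
  have h2 : (surfaceMeasure E).restrict {y | IsRegularBoundaryPoint Ω y} =
      (surfaceMeasure E).restrict (frontier Ω) := by
    rw [hset]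
    exact Measure.restrict_congr_set (sdiff_null_ae_eq_self h.singular_null)
  rwa [h2] at h1

theorem integrableOn_mul_inner_exteriorNormal {Ω : Set E} [SecondCountableTopology E]
    (h : HasPiecewiseSmoothBoundary Ω) {g : E → ℝ} (hg : ContinuousOn g (frontier Ω)) {M : ℝ}
    (hM : ∀ z ∈ frontier Ω, |g z| ≤ M) (e : E) :
    IntegrableOn (fun z => g z * inner ℝ e (exteriorNormal Ω z)) (frontier Ω)
      (surfaceMeasure E) := by
  refine IntegrableOn.of_bound h.finite_area
    ((hg.aestronglyMeasurable isClosed_frontier.measurableSet).mul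
      ((aestronglyMeasurable_exteriorNormal h).const_inner)) (M * ‖e‖)
    ((ae_restrict_iff' isClosed_frontier.measurableSet).2
      (Filter.Eventually.of_forall fun z hz => ?_))
  have h1 : |inner ℝ e (exteriorNormal Ω z)| ≤ ‖e‖ :=
    (abs_real_inner_le_norm _ _).trans
      (mul_le_of_le_one_right (norm_nonneg _) (norm_exteriorNormal_le Ω z))
  rw [Real.norm_eq_abs, abs_mul]
  exact mul_le_mul (hM z hz) h1 (abs_nonneg _) ((abs_nonneg _).trans (hM z hz))

variable [FiniteDimensional ℝ E]

/-- Gauss' identity `∫_Ω ∂g/∂e dV = ∫_{∂Ω} g ⟨e, ν⟩ dS` for the function `g` and the direction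
`e`. -/
def FluxIdentity (Ω : Set E) (e : E) (g : E → ℝ) : Prop :=
  ∫ z in Ω, fderiv ℝ g z e =
    ∫ z in frontier Ω, g z * inner ℝ e (exteriorNormal Ω z) ∂(surfaceMeasure E)

theorem FluxIdentity.smul {Ω : Set E} {e : E} {g : E → ℝ} (h : FluxIdentity Ω e g) (c : ℝ) :
    FluxIdentity Ω (c • e) g := by
  unfold FluxIdentity at *
  simp only [map_smul, smul_eq_mul, inner_smul_left, conj_trivial, mul_left_comm _ c]
  rw [integral_const_mul, integral_const_mul, h]

theorem FluxIdentity.sub {Ω : Set E} {e₁ e₂ : E} {g : E → ℝ} (hΩ : IsOpen Ω)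
    (hb : Bornology.IsBounded Ω) (hbd : HasPiecewiseSmoothBoundary Ω) (hg : IsC1OnClosure Ω g)
    (h₁ : FluxIdentity Ω e₁ g) (h₂ : FluxIdentity Ω e₂ g) : FluxIdentity Ω (e₁ - e₂) g := by
  unfold FluxIdentity at *
  obtain ⟨M, -, hM⟩ := hg.exists_bound hb
  have hc := hg.continuousOn.mono frontier_subset_closure
  have hM' : ∀ z ∈ frontier Ω, |g z| ≤ M := fun z hz => hM z (frontier_subset_closure hz)
  simp only [map_sub, inner_sub_left, mul_sub]
  rw [integral_sub (hg.integrableOn_fderiv hΩ hb e₁ _) (hg.integrableOn_fderiv hΩ hb e₂ _),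
    integral_sub (integrableOn_mul_inner_exteriorNormal hbd hc hM' e₁)
      (integrableOn_mul_inner_exteriorNormal hbd hc hM' e₂), h₁, h₂]

/-- Cartesian coordinates of `E` adapted to a unit vector `e`: the point `(t, h)` of `ℝ × e^⊥`
corresponds to `h + t e`. -/
def coordAlong (e : E) (he : ‖e‖ = 1) : ℝ × (ℝ ∙ e)ᗮ ≃ᵐ E :=
  ((LinearIsometryEquiv.toSpanUnitSingleton e he).toHomeomorph.toMeasurableEquiv.prodCongr
    (MeasurableEquiv.refl _)).trans ((ℝ ∙ e).measurableEquivProd (0 : E)).symm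

omit [CompleteSpace E] in
theorem coordAlong_apply (e : E) (he : ‖e‖ = 1) (p : ℝ × (ℝ ∙ e)ᗮ) :
    coordAlong e he p = (p.2 : E) + p.1 • e := by
  simp [coordAlong, MeasurableEquiv.prodCongr, add_comm]

omit [CompleteSpace E] in
theorem measurePreserving_coordAlong (e : E) (he : ‖e‖ = 1) :
    MeasurePreserving (coordAlong e he) (volume.prod volume) volume := by
  have h1 := ((ℝ ∙ e).measurePreserving_measurableEquivProd (0 : E)).symm
  rw [InnerProductSpace.euclideanHausdorffMeasure_eq_volume] at h1
  have h2 : MeasurePreserving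
      (LinearIsometryEquiv.toSpanUnitSingleton (𝕜 := ℝ) e he).toHomeomorph.toMeasurableEquiv
      (volume : Measure ℝ) (volume : Measure (ℝ ∙ e)) :=
    (LinearIsometryEquiv.toSpanUnitSingleton (𝕜 := ℝ) e he).measurePreserving
  exact (h2.prod (MeasurePreserving.id volume)).trans h1

omit [CompleteSpace E] in
theorem integral_eq_integral_coordAlong (e : E) (he : ‖e‖ = 1) {F : E → ℝ} (hF : Integrable F) :
    ∫ z, F z = ∫ h : (ℝ ∙ e)ᗮ, ∫ t : ℝ, F (h + t • e) := by
  have hmp := measurePreserving_coordAlong e he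
  have hF' : Integrable (fun p => F (coordAlong e he p)) (volume.prod volume) :=
    hmp.integrable_comp_of_integrable hF
  rw [← hmp.integral_comp (coordAlong e he).measurableEmbedding F, integral_prod_symm _ hF']
  simp only [coordAlong_apply]

/-- Near a regular boundary point the flux identity holds in every direction pointing outwards:
there `Ω` lies below a graph, so that integration along the lines parallel to `e` reduces the volume
integral to the values of `g` on the boundary. -/
theorem exists_nhds_fluxIdentity_of_pos {Ω : Set E} (hΩ : IsOpen Ω) (hb : Bornology.IsBounded Ω)
    {y : E} {ρ : E → ℝ} (hy : y ∈ frontier Ω) (hρ : IsLocalDefiningFunction Ω y ρ) {e : E}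
    (he : ‖e‖ = 1) (hpos : 0 < fderiv ℝ ρ y e) :
    ∃ U ∈ 𝓝 y, ∀ g : E → ℝ, IsC1OnClosure Ω g → (∀ z ∈ closure Ω, z ∉ U → g z = 0) →
      FluxIdentity Ω e g := by
  obtain ⟨B, a, b, γ, hB, hγc, hγ, ⟨C, hCo, hyC, hC⟩, hΩγ, hfγ, hreg⟩ :=
    exists_graph hy hρ he hpos
  obtain ⟨r, hr, hrC⟩ := Metric.nhds_basis_closedBall.mem_iff.1 (hCo.mem_nhds hyC)
  refine ⟨Metric.closedBall y r, Metric.closedBall_mem_nhds y hr, fun g hg hg0 => ?_⟩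
  have hg0' : ∀ z ∈ closure Ω, z ∉ C → g z = 0 := fun z hz hzC => hg0 z hz fun h => hzC (hrC h)
  have hfd0 : ∀ z ∈ Ω, z ∉ C → fderiv ℝ g z e = 0 := by
    intro z hz hzC
    have : g =ᶠ[𝓝 z] fun _ => 0 := by
      filter_upwards [hΩ.mem_nhds hz, Metric.isClosed_closedBall.isOpen_compl.mem_nhds
        (fun h => hzC (hrC h) : z ∈ (Metric.closedBall y r)ᶜ)] with w hw hw'
      exact hg0 w (subset_closure hw) hw'
    rw [this.fderiv_eq]
    simp
  have hpr : ∀ (h : (ℝ ∙ e)ᗮ) (t : ℝ), projAlong e ((h : E) + t • e) = h := by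
    intro h t
    rw [map_add, map_smul, projAlong_self he, smul_zero, add_zero, projAlong_of_inner_eq_zero]
    exact Submodule.mem_orthogonal_singleton_iff_inner_right.1 h.2
  have hin : ∀ (h : (ℝ ∙ e)ᗮ) (t : ℝ), inner ℝ e ((h : E) + t • e) = t := by
    intro h t
    rw [inner_add_right, Submodule.mem_orthogonal_singleton_iff_inner_right.1 h.2,
      inner_smul_right, real_inner_self_eq_norm_sq, he]
    ring
  have hCmem : ∀ (h : (ℝ ∙ e)ᗮ) (t : ℝ), (h : E) + t • e ∈ C ↔ h ∈ B ∧ t ∈ Set.Ioo a b := by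
    intro h t
    rw [hC, hpr, hin]
    refine and_congr_left fun _ => ⟨?_, fun hh => ⟨h, hh, rfl⟩⟩
    rintro ⟨h', hh', heq⟩
    rwa [← Subtype.ext heq]
  set φ : (ℝ ∙ e)ᗮ → E := fun h => (h : E) + γ h • e
  -- integration over the fibres parallel to `e`
  have hfib : ∀ h : (ℝ ∙ e)ᗮ, ∫ t : ℝ, Ω.indicator (fun z => fderiv ℝ g z e) (h + t • e) =
      B.indicator (fun h => g (φ h)) h := by
    intro h
    by_cases hh : h ∈ B
    · rw [Set.indicator_of_mem hh]
      have haγ : a < γ h := (hγ h hh).1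
      have hγb : γ h < b := (hγ h hh).2
      have hIcc : ∀ t ∈ Set.Icc a (γ h), t ∈ Set.Icc a b := fun t ht => ⟨ht.1, ht.2.trans hγb.le⟩
      have h1 : (fun t : ℝ => Ω.indicator (fun z => fderiv ℝ g z e) (h + t • e)) =
          (Set.Ioo a (γ h)).indicator fun t => fderiv ℝ g (h + t • e) e := by
        ext t
        by_cases ht : t ∈ Set.Ioo a (γ h)
        · rw [Set.indicator_of_mem ht, Set.indicator_of_mem]
          exact (hΩγ h hh t ⟨ht.1.le, (ht.2.trans hγb).le⟩).2 ht.2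
        · rw [Set.indicator_of_notMem ht]
          by_cases hz : (h : E) + t • e ∈ Ω
          · rw [Set.indicator_of_mem hz]
            refine hfd0 _ hz fun hzC => ht ?_
            have htab := ((hCmem h t).1 hzC).2
            exact ⟨htab.1, (hΩγ h hh t (Set.Ioo_subset_Icc_self htab)).1 hz⟩
          · rw [Set.indicator_of_notMem hz]
      have hline : Continuous fun t : ℝ => (h : E) + t • e := by fun_prop
      have hcl : ∀ t ∈ Set.Icc a (γ h), (h : E) + t • e ∈ closure Ω := by
        intro t ht
        rcases ht.2.lt_or_eq with hlt | heq
        · exact subset_closure ((hΩγ h hh t (hIcc t ht)).2 hlt)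
        · exact frontier_subset_closure ((hfγ h hh t (hIcc t ht)).2 heq)
      obtain ⟨D, hD, hD'⟩ := hg.deriv_extends
      have hmemΩ : ∀ t ∈ Set.Ioo a (γ h), (h : E) + t • e ∈ Ω := fun t ht =>
        (hΩγ h hh t (hIcc t (Set.Ioo_subset_Icc_self ht))).2 ht.2
      have hDc : ContinuousOn (fun t : ℝ => D (h + t • e) e) (Set.Icc a (γ h)) :=
        (hD.comp hline.continuousOn hcl).clm_apply continuousOn_const
      have h2 : ∫ t in a..γ h, D (h + t • e) e = g (h + γ h • e) - g (h + a • e) := by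
        refine intervalIntegral.integral_eq_sub_of_hasDerivAt_of_le
          (f := fun t : ℝ => g (h + t • e)) haγ.le (hg.continuousOn.comp hline.continuousOn hcl)
          (fun t ht => ?_) ?_
        · have hd := (hg.differentiableAt hΩ (hmemΩ t ht)).hasFDerivAt
          rw [hD' _ (hmemΩ t ht)] at hd
          have hl : HasDerivAt (fun t : ℝ => (h : E) + t • e) e t := by
            simpa using ((hasDerivAt_id t).smul_const e).const_add (h : E)
          exact hd.comp_hasDerivAt t hl
        · rw [← Set.uIcc_of_le haγ.le] at hDc
          exact hDc.intervalIntegrable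
      have h3 : g (h + a • e) = 0 :=
        hg0' _ (hcl a (Set.left_mem_Icc.2 haγ.le)) fun hmem =>
          lt_irrefl _ ((hCmem h a).1 hmem).2.1
      rw [h1, integral_indicator measurableSet_Ioo,
        setIntegral_congr_fun measurableSet_Ioo fun t ht => by rw [hD' _ (hmemΩ t ht)],
        ← integral_Ioc_eq_integral_Ioo, ← intervalIntegral.integral_of_le haγ.le, h2, h3, sub_zero]
    · rw [Set.indicator_of_notMem hh]
      have : (fun t : ℝ => Ω.indicator (fun z => fderiv ℝ g z e) (h + t • e)) = fun _ => 0 := by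
        ext t
        by_cases hz : (h : E) + t • e ∈ Ω
        · rw [Set.indicator_of_mem hz]
          exact hfd0 _ hz fun hzC => hh ((hCmem h t).1 hzC).1
        · rw [Set.indicator_of_notMem hz]
      rw [this, integral_zero]
  have hvol : ∫ z in Ω, fderiv ℝ g z e = ∫ h in B, g (φ h) := by
    rw [← integral_indicator hΩ.measurableSet, integral_eq_integral_coordAlong e he
      ((integrable_indicator_iff hΩ.measurableSet).2 (hg.integrableOn_fderiv hΩ hb e volume)),
      ← integral_indicator hB.measurableSet]
    exact integral_congr_ae (Filter.Eventually.of_forall hfib)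
  -- the push-forward of Lebesgue measure to the graph is the flux density of `e`
  set X : Set E := frontier Ω ∩ C
  have hXm : MeasurableSet X := isClosed_frontier.measurableSet.inter hCo.measurableSet
  have hXφ : ∀ z, z ∈ X ↔ ∃ h ∈ B, φ h = z := by
    intro z
    constructor
    · rintro ⟨hzf, hzC⟩
      obtain ⟨⟨h, hh, hhz⟩, ht⟩ := (hC z).1 hzC
      have hz : z = (h : E) + (inner ℝ e z : ℝ) • e := by rw [hhz, projAlong_add_smul]
      refine ⟨h, hh, ?_⟩
      rw [hz] at hzf
      have := (hfγ h hh _ (Set.Ioo_subset_Icc_self ht)).1 hzf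
      simp only [φ]
      rw [← this, ← hz]
    · rintro ⟨h, hh, rfl⟩
      exact ⟨(hfγ h hh _ (Set.Ioo_subset_Icc_self (hγ h hh))).2 rfl,
        (hCmem h _).2 ⟨hh, hγ h hh⟩⟩
  have hφc : ContinuousOn φ B :=
    continuous_subtype_val.continuousOn.add (hγc.smul continuousOn_const)
  have hφm : AEMeasurable φ (volume.restrict B) := hφc.aemeasurable hB.measurableSet
  set m : Measure E := (volume.restrict B).map φ
  have hm_apply : ∀ S, MeasurableSet S → m S = volume (φ ⁻¹' S ∩ B) := by
    intro S hS
    rw [Measure.map_apply_of_aemeasurable hφm hS,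
      Measure.restrict_apply₀ (hφm.nullMeasurableSet_preimage hS)]
  have hmproj : ∀ S ⊆ X, MeasurableSet S → m S = surfaceMeasure E (projAlong e '' S) := by
    intro S hSX hS
    have himg : Subtype.val '' (φ ⁻¹' S ∩ B) = projAlong e '' S := by
      ext w
      constructor
      · rintro ⟨h, ⟨hhS, -⟩, rfl⟩
        exact ⟨φ h, hhS, hpr h _⟩
      · rintro ⟨z, hz, rfl⟩
        obtain ⟨h, hh, rfl⟩ := (hXφ z).1 (hSX hz)
        exact ⟨h, ⟨hz, hh⟩, (hpr h _).symm⟩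
    have := (ℝ ∙ e)ᗮ.subtypeₗᵢ.isometry.euclideanHausdorffMeasure_image
      (d := Module.finrank ℝ (ℝ ∙ e)ᗮ) (φ ⁻¹' S ∩ B)
    rw [InnerProductSpace.euclideanHausdorffMeasure_eq_volume, Submodule.coe_subtypeₗᵢ,
      Submodule.coe_subtype, himg, finrank_orthogonal_span_singleton_eq he] at this
    rw [hm_apply S hS, ← this, surfaceMeasure]
  have hXreg : ∀ z ∈ X, IsRegularBoundaryPoint Ω z ∧ 0 < inner ℝ e (exteriorNormal Ω z) := by
    intro z hz
    obtain ⟨h, hh, rfl⟩ := (hXφ z).1 hz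
    exact hreg h hh _ (Set.Ioo_subset_Icc_self (hγ h hh)) hz.1
  have hmX : m Xᶜ = 0 := by
    rw [hm_apply _ hXm.compl]
    convert! measure_empty (μ := (volume : Measure (ℝ ∙ e)ᗮ))
    rw [Set.eq_empty_iff_forall_notMem]
    exact fun h hh => hh.1 ((hXφ _).2 ⟨h, hh.2, rfl⟩)
  set q : E → ℝ := fun z => inner ℝ e (exteriorNormal Ω z)
  have hmeq : m = ((surfaceMeasure E).restrict X).withDensity fun z => ENNReal.ofReal (q z) := by
    ext S hS
    rw [withDensity_apply _ hS, Measure.restrict_restrict hS,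
      ← measure_eq_setLIntegral_inner_exteriorNormal he (hS.inter hXm)
        (fun z hz => hXreg z hz.2) fun T hT => hmproj T (hT.trans Set.inter_subset_right)]
    exact (measure_inter_conull hmX).symm
  have hgX : AEStronglyMeasurable g ((surfaceMeasure E).restrict X) :=
    (hg.continuousOn.mono fun z hz => frontier_subset_closure hz.1).aestronglyMeasurable hXm
  have hgm : AEStronglyMeasurable g m := by
    rw [hmeq]
    exact hgX.mono_ac (withDensity_absolutelyContinuous _ _)
  have hqm : AEMeasurable (fun z => ENNReal.ofReal (q z)) ((surfaceMeasure E).restrict X) := by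
    have : ContinuousOn q X := continuousOn_const.inner
      ((continuousOn_exteriorNormal Ω).mono fun z hz => (hXreg z hz).1)
    exact (this.aemeasurable hXm).ennreal_ofReal
  unfold FluxIdentity
  rw [hvol, ← integral_map hφm hgm]
  change ∫ z, g z ∂m = _
  rw [hmeq, integral_withDensity_eq_integral_toReal_smul₀ hqm
    (Filter.Eventually.of_forall fun _ => ENNReal.ofReal_lt_top)]
  have h5 : ∫ z in frontier Ω, g z * q z ∂(surfaceMeasure E) =
      ∫ z in X, g z * q z ∂(surfaceMeasure E) := by
    refine setIntegral_eq_of_subset_of_forall_sdiff_eq_zero isClosed_frontier.measurableSet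
      Set.inter_subset_left fun z hz => ?_
    rw [hg0' z (frontier_subset_closure hz.1) fun hzC => hz.2 ⟨hz.1, hzC⟩, zero_mul]
  rw [h5]
  refine setIntegral_congr_fun hXm fun z hz => ?_
  simp only [smul_eq_mul]
  rw [ENNReal.toReal_ofReal (hXreg z hz).2.le, mul_comm]

/-- Near a regular boundary point the flux identity holds in every direction, since every vector
is a difference of vectors pointing outwards. -/
theorem exists_nhds_fluxIdentity_of_regular {Ω : Set E} (hΩ : IsOpen Ω)
    (hb : Bornology.IsBounded Ω) (hbd : HasPiecewiseSmoothBoundary Ω) {y : E}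
    (hy : IsRegularBoundaryPoint Ω y) (e : E) :
    ∃ U ∈ 𝓝 y, ∀ g : E → ℝ, IsC1OnClosure Ω g → (∀ z ∈ closure Ω, z ∉ U → g z = 0) →
      FluxIdentity Ω e g := by
  obtain ⟨ρ, hρ⟩ := hy.2
  have main : ∀ v : E, 0 < fderiv ℝ ρ y v → ∃ U ∈ 𝓝 y, ∀ g : E → ℝ, IsC1OnClosure Ω g →
      (∀ z ∈ closure Ω, z ∉ U → g z = 0) → FluxIdentity Ω v g := by
    intro v hv
    have hv0 : v ≠ 0 := by rintro rfl; simp at hv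
    have hvn : 0 < ‖v‖ := norm_pos_iff.2 hv0
    obtain ⟨U, hU, h⟩ := exists_nhds_fluxIdentity_of_pos hΩ hb hy.1 hρ (e := ‖v‖⁻¹ • v)
      (by rw [norm_smul, norm_inv, norm_norm, inv_mul_cancel₀ hvn.ne'])
      (by rw [map_smul]; exact mul_pos (inv_pos.2 hvn) hv)
    refine ⟨U, hU, fun g hg hg0 => ?_⟩
    have := (h g hg hg0).smul ‖v‖
    rwa [smul_smul, mul_inv_cancel₀ hvn.ne', one_smul] at this
  set w := gradient ρ y
  have hw : 0 < fderiv ℝ ρ y w := by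
    rw [← inner_gradient_eq_fderiv, real_inner_self_eq_norm_sq]
    have := norm_pos_iff.2 hρ.gradient_ne_zero
    positivity
  obtain ⟨c, hc⟩ : ∃ c : ℝ, 0 < c ∧ 0 < fderiv ℝ ρ y e + c * fderiv ℝ ρ y w := by
    refine ⟨(|fderiv ℝ ρ y e| + 1) / fderiv ℝ ρ y w, by positivity, ?_⟩
    rw [div_mul_cancel₀ _ hw.ne']
    linarith [neg_abs_le (fderiv ℝ ρ y e)]
  obtain ⟨U₁, hU₁, h₁⟩ := main (e + c • w) (by simpa using hc.2)
  obtain ⟨U₂, hU₂, h₂⟩ := main (c • w) (by simpa using mul_pos hc.1 hw)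
  refine ⟨U₁ ∩ U₂, Filter.inter_mem hU₁ hU₂, fun g hg hg0 => ?_⟩
  have := FluxIdentity.sub hΩ hb hbd hg (h₁ g hg fun z hz hzU => hg0 z hz fun h => hzU h.1)
    (h₂ g hg fun z hz hzU => hg0 z hz fun h => hzU h.2)
  rwa [add_sub_cancel_right] at this

end LocalFlux

/-! ### Cutting off the singular part of the boundary -/

section Cutoff

open scoped ENNReal NNReal

/-- A compact set of vanishing `d`-dimensional Hausdorff measure has finite covers by balls of
arbitrarily small total `d`-dimensional size. -/
theorem exists_finite_ball_cover_of_hausdorffMeasure_eq_zero {X : Type*} [MetricSpace X]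
    [Nonempty X] [MeasurableSpace X] [BorelSpace X] {S : Set X} (hS : IsCompact S) {d : ℕ}
    (h0 : μH[(d : ℝ)] S = 0) {η : ℝ≥0∞} (hη : 0 < η) :
    ∃ (F : Finset ℕ) (x : ℕ → X) (r : ℕ → ℝ), (∀ i ∈ F, x i ∈ S ∧ 0 < r i) ∧
      S ⊆ ⋃ i ∈ F, Metric.ball (x i) (r i) ∧ ∑ i ∈ F, ENNReal.ofReal (r i) ^ d ≤ η := by
  rcases S.eq_empty_or_nonempty with rfl | ⟨s₀, hs₀⟩
  · exact ⟨∅, fun _ => Classical.arbitrary X, fun _ => 0, by simp⟩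
  have hη2 : 0 < η / 2 := ENNReal.half_pos hη.ne'
  rw [Measure.hausdorffMeasure_apply] at h0
  have h1 := ENNReal.iSup_eq_zero.1 (ENNReal.iSup_eq_zero.1 h0 1) one_pos
  have h2 := h1.trans_lt hη2
  simp only [iInf_lt_iff] at h2
  obtain ⟨t, hcov, hdiam, hsum⟩ := h2
  obtain ⟨ε, hε, hεsum⟩ := ENNReal.exists_pos_sum_of_countable hη2.ne' ℕ
  -- each set of the cover lies in an open ball of slightly larger radius than its diameter
  have hr : ∀ n, ∃ r : ℝ, 0 < r ∧ Metric.ediam (t n) < ENNReal.ofReal r ∧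
      ENNReal.ofReal r ^ d < Metric.ediam (t n) ^ d + ε n := by
    intro n
    have hfin : Metric.ediam (t n) < ⊤ := (hdiam n).trans_lt ENNReal.one_lt_top
    have hc : ContinuousAt (fun a : ℝ≥0∞ => a ^ d) (Metric.ediam (t n)) :=
      (ENNReal.continuous_pow d).continuousAt
    have hlt : Metric.ediam (t n) ^ d < Metric.ediam (t n) ^ d + ε n :=
      ENNReal.lt_add_right (ENNReal.pow_ne_top hfin.ne) (by exact_mod_cast (hε n).ne')
    have hev : ∀ᶠ a in 𝓝[>] Metric.ediam (t n), a ^ d < Metric.ediam (t n) ^ d + ε n :=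
      nhdsWithin_le_nhds (hc.eventually (gt_mem_nhds hlt))
    have hne : (𝓝[>] Metric.ediam (t n)).NeBot := nhdsGT_neBot_of_exists_gt ⟨⊤, hfin⟩
    obtain ⟨a, ⟨ha, ha'⟩, hatop⟩ := ((hev.and self_mem_nhdsWithin).and
      (nhdsWithin_le_nhds (gt_mem_nhds hfin))).exists
    have ha0 : 0 < a := lt_of_le_of_lt zero_le ha'
    refine ⟨a.toReal, ENNReal.toReal_pos ha0.ne' hatop.ne, ?_⟩
    rw [ENNReal.ofReal_toReal hatop.ne]
    exact ⟨ha', ha⟩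
  choose r hr0 hrdiam hrpow using hr
  have hx : ∀ n, ∃ x ∈ S, (t n ∩ S).Nonempty → x ∈ t n := by
    intro n
    by_cases h : (t n ∩ S).Nonempty
    · obtain ⟨x, hx⟩ := h
      exact ⟨x, hx.2, fun _ => hx.1⟩
    · exact ⟨s₀, hs₀, fun h' => absurd h' h⟩
  choose x hxS hxt using hx
  have htr : ∀ n, ∀ z ∈ t n ∩ S, z ∈ Metric.ball (x n) (r n) := by
    intro n z hz
    have h3 : edist z (x n) ≤ Metric.ediam (t n) :=
      Metric.edist_le_ediam_of_mem hz.1 (hxt n ⟨z, hz⟩)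
    rw [Metric.mem_ball, ← edist_lt_ofReal]
    exact h3.trans_lt (hrdiam n)
  let I : Set ℕ := {n | (t n ∩ S).Nonempty}
  have hcov' : S ⊆ ⋃ n : I, Metric.ball (x n) (r n) := by
    intro z hz
    obtain ⟨n, hn⟩ := Set.mem_iUnion.1 (hcov hz)
    exact Set.mem_iUnion.2 ⟨⟨n, z, hn, hz⟩, htr n z ⟨hn, hz⟩⟩
  obtain ⟨F, hF⟩ := hS.elim_finite_subcover _ (fun n : I => Metric.isOpen_ball) hcov'
  refine ⟨F.map (Function.Embedding.subtype _), x, r, fun i _ => ⟨hxS i, hr0 i⟩, ?_, ?_⟩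
  · intro z hz
    obtain ⟨n, hn, hzn⟩ := Set.mem_iUnion₂.1 (hF hz)
    exact Set.mem_iUnion₂.2 ⟨n, Finset.mem_map.2 ⟨n, hn, rfl⟩, hzn⟩
  · have hle : ∀ i ∈ F.map (Function.Embedding.subtype _),
        ENNReal.ofReal (r i) ^ d ≤ (⨆ _ : (t i).Nonempty, Metric.ediam (t i) ^ d) + ε i := by
      intro i hi
      obtain ⟨n, -, rfl⟩ := Finset.mem_map.1 hi
      have hne : (t n).Nonempty := n.2.mono Set.inter_subset_left
      refine (hrpow n).le.trans ?_
      refine add_le_add ?_ le_rfl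
      exact le_iSup (fun _ : (t n).Nonempty => Metric.ediam (t n) ^ d) hne
    calc _ ≤ _ := Finset.sum_le_sum hle
      _ ≤ ∑' i, ((⨆ _ : (t i).Nonempty, Metric.ediam (t i) ^ d) + (ε i : ℝ≥0∞)) :=
        ENNReal.sum_le_tsum _
      _ = (∑' i, ⨆ _ : (t i).Nonempty, Metric.ediam (t i) ^ d) + ∑' i, (ε i : ℝ≥0∞) :=
        ENNReal.tsum_add
      _ ≤ η / 2 + η / 2 := add_le_add (by exact_mod_cast hsum.le) hεsum.le
      _ = η := ENNReal.add_halves η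

theorem norm_fderiv_prod_le {E ι : Type*} [NormedAddCommGroup E] [NormedSpace ℝ E]
    (F : Finset ι) (φ : ι → E → ℝ) (hφ : ∀ i, Differentiable ℝ (φ i))
    (hφ0 : ∀ i z, 0 ≤ φ i z) (hφ1 : ∀ i z, φ i z ≤ 1) (z : E) :
    ‖fderiv ℝ (fun z => ∏ i ∈ F, φ i z) z‖ ≤ ∑ i ∈ F, ‖fderiv ℝ (φ i) z‖ := by
  classical
  induction F using Finset.induction_on with
  | empty => simp
  | insert a F ha ih =>
    simp only [Finset.prod_insert ha, Finset.sum_insert ha]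
    have hd : DifferentiableAt ℝ (fun z => ∏ i ∈ F, φ i z) z :=
      (HasFDerivAt.finsetProd fun i _ => (hφ i z).hasFDerivAt).differentiableAt
    rw [fderiv_fun_mul (hφ a z) hd]
    refine (norm_add_le _ _).trans ?_
    rw [add_comm, norm_smul, norm_smul]
    have h1 : ‖∏ i ∈ F, φ i z‖ ≤ 1 := by
      rw [Real.norm_eq_abs, abs_of_nonneg (Finset.prod_nonneg fun i _ => hφ0 i z)]
      exact Finset.prod_le_one (fun i _ => hφ0 i z) fun i _ => hφ1 i z
    have h2 : ‖φ a z‖ ≤ 1 := by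
      rw [Real.norm_eq_abs, abs_of_nonneg (hφ0 a z)]
      exact hφ1 a z
    exact add_le_add (mul_le_of_le_one_left (norm_nonneg _) h1)
      ((mul_le_of_le_one_left (norm_nonneg _) h2).trans ih)

/-- Cutoff functions vanishing near a ball of radius `r` whose gradient has `L¹` norm of order
`r ^ (dim E - 1)`. -/
theorem exists_ball_cutoff (E : Type*) [NormedAddCommGroup E] [InnerProductSpace ℝ E]
    [FiniteDimensional ℝ E] [MeasurableSpace E] [BorelSpace E] (hdim : 1 ≤ Module.finrank ℝ E) :
    ∃ C : ℝ≥0, ∀ (x : E) (r : ℝ), 0 < r → ∃ φ : E → ℝ, ContDiff ℝ 1 φ ∧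
      (∀ z, 0 ≤ φ z) ∧ (∀ z, φ z ≤ 1) ∧ (∀ z ∈ Metric.ball x r, φ z = 0) ∧
      (∀ z, 2 * r ≤ dist z x → φ z = 1) ∧
      ∫⁻ z, ‖fderiv ℝ φ z‖ₑ ≤ C * ENNReal.ofReal r ^ (Module.finrank ℝ E - 1) := by
  -- rescale a fixed cutoff function: the gradient has size `r⁻¹` on a set of volume `r ^ dim E`
  let χ : ContDiffBump (0 : E) := ⟨1, 2, one_pos, one_lt_two⟩
  have hχ : ContDiff ℝ 1 χ := χ.contDiff
  obtain ⟨C, hC⟩ := (χ.hasCompactSupport.fderiv (𝕜 := ℝ)).exists_bound_of_continuous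
    (hχ.continuous_fderiv (by norm_num))
  have hC0 : 0 ≤ C := (norm_nonneg _).trans (hC 0)
  set N := Module.finrank ℝ E
  set b : ℝ≥0∞ := volume (Metric.ball (0 : E) 1)
  have hb : b ≠ ⊤ := measure_ball_lt_top.ne
  refine ⟨(ENNReal.ofReal C * ENNReal.ofReal 2 ^ N * b).toNNReal, fun x r hr => ?_⟩
  rw [ENNReal.coe_toNNReal (ENNReal.mul_ne_top (ENNReal.mul_ne_top ENNReal.ofReal_ne_top
    (ENNReal.pow_ne_top ENNReal.ofReal_ne_top)) hb)]
  set A : E → E := fun z => r⁻¹ • (z - x)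
  have hA : ContDiff ℝ 1 A := contDiff_const.smul (contDiff_id.sub contDiff_const)
  have hAn : ∀ z, ‖A z‖ = r⁻¹ * dist z x := fun z => by
    rw [norm_smul, Real.norm_eq_abs, abs_of_pos (inv_pos.2 hr), dist_eq_norm]
  have hout : ∀ z, 2 * r ≤ dist z x → χ (A z) = 0 := by
    intro z hz
    refine χ.zero_of_le_dist ?_
    change 2 ≤ dist (A z) 0
    rw [dist_zero_right, hAn, inv_mul_eq_div, le_div_iff₀ hr]
    exact hz
  refine ⟨fun z => 1 - χ (A z), contDiff_const.sub (hχ.comp hA), fun z => ?_, fun z => ?_,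
    fun z hz => ?_, fun z hz => ?_, ?_⟩
  · exact sub_nonneg.2 χ.le_one
  · exact sub_le_self _ χ.nonneg
  · change 1 - χ (A z) = 0
    rw [χ.one_of_mem_closedBall, sub_self]
    change A z ∈ Metric.closedBall 0 1
    rw [mem_closedBall_zero_iff, hAn, inv_mul_eq_div, div_le_one hr]
    exact (Metric.mem_ball.1 hz).le
  · change 1 - χ (A z) = 1
    rw [hout z hz, sub_zero]
  · have hA' : ∀ z, HasFDerivAt A (r⁻¹ • ContinuousLinearMap.id ℝ E) z := fun z =>
      ((hasFDerivAt_id z).sub_const x).const_smul r⁻¹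
    have hder : ∀ z, ‖fderiv ℝ (fun z => 1 - χ (A z)) z‖ ≤ C * r⁻¹ := by
      intro z
      have h1 : HasFDerivAt (fun z => χ (A z))
          ((fderiv ℝ χ (A z)).comp (r⁻¹ • ContinuousLinearMap.id ℝ E)) z :=
        (hχ.differentiable (by norm_num) (A z)).hasFDerivAt.comp z (hA' z)
      rw [(h1.const_sub 1).fderiv, norm_neg, ContinuousLinearMap.comp_smul, norm_smul,
        ContinuousLinearMap.comp_id, Real.norm_eq_abs, abs_of_pos (inv_pos.2 hr), mul_comm]
      exact mul_le_mul_of_nonneg_right (hC _) (inv_pos.2 hr).le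
    have hder0 : ∀ z ∉ Metric.closedBall x (2 * r), fderiv ℝ (fun z => 1 - χ (A z)) z = 0 := by
      intro z hz
      have : (fun z => 1 - χ (A z)) =ᶠ[𝓝 z] fun _ => 1 := by
        filter_upwards [Metric.isClosed_closedBall.isOpen_compl.mem_nhds hz] with w hw
        have hw' : 2 * r < dist w x := not_le.1 hw
        rw [hout w hw'.le, sub_zero]
      rw [this.fderiv_eq]
      simp
    calc ∫⁻ z, ‖fderiv ℝ (fun z => 1 - χ (A z)) z‖ₑ
        ≤ ∫⁻ z, (Metric.closedBall x (2 * r)).indicator (fun _ => ENNReal.ofReal (C * r⁻¹)) z := by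
          refine lintegral_mono fun z => ?_
          by_cases hz : z ∈ Metric.closedBall x (2 * r)
          · rw [Set.indicator_of_mem hz, ← ofReal_norm]
            exact ENNReal.ofReal_le_ofReal (hder z)
          · rw [← ofReal_norm, hder0 z hz, norm_zero, ENNReal.ofReal_zero]
            exact zero_le
      _ = ENNReal.ofReal (C * r⁻¹) * (ENNReal.ofReal ((2 * r) ^ N) * b) := by
          rw [lintegral_indicator_const measurableSet_closedBall,
            Measure.addHaar_closedBall _ _ (by positivity)]
      _ = _ := by
          obtain ⟨d, hd⟩ : ∃ d, N = d + 1 := ⟨N - 1, by omega⟩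
          have hr' : ENNReal.ofReal (r⁻¹) * ENNReal.ofReal r = 1 := by
            rw [← ENNReal.ofReal_mul (inv_pos.2 hr).le, inv_mul_cancel₀ hr.ne',
              ENNReal.ofReal_one]
          rw [hd, Nat.add_sub_cancel, ENNReal.ofReal_mul hC0, ENNReal.ofReal_pow (by positivity),
            ENNReal.ofReal_mul (by norm_num), mul_pow, pow_succ (ENNReal.ofReal r)]
          calc _ = ENNReal.ofReal C * ENNReal.ofReal 2 ^ (d + 1) * b * ENNReal.ofReal r ^ d *
                (ENNReal.ofReal (r⁻¹) * ENNReal.ofReal r) := by ring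
            _ = _ := by rw [hr', mul_one]

/-- A compact set of vanishing surface measure can be cut off by functions whose gradients have
arbitrarily small `L¹` norm: cover it by balls and multiply cutoff functions of the balls. -/
theorem exists_cutoff {E : Type*} [NormedAddCommGroup E] [InnerProductSpace ℝ E]
    [FiniteDimensional ℝ E] [MeasurableSpace E] [BorelSpace E] {S : Set E} (hS : IsCompact S)
    (h0 : surfaceMeasure E S = 0) (hdim : 2 ≤ Module.finrank ℝ E) {ε : ℝ} (hε : 0 < ε) :
    ∃ ψ : E → ℝ, ContDiff ℝ 1 ψ ∧ (∀ z, 0 ≤ ψ z) ∧ (∀ z, ψ z ≤ 1) ∧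
      (∃ W, IsOpen W ∧ S ⊆ W ∧ ∀ z ∈ W, ψ z = 0) ∧
      (∀ z, (∀ s ∈ S, ε ≤ dist z s) → ψ z = 1) ∧
      ∫⁻ z, ‖fderiv ℝ ψ z‖ₑ ≤ ENNReal.ofReal ε := by
  obtain ⟨C, hC⟩ := exists_ball_cutoff E (by omega)
  set d := Module.finrank ℝ E - 1
  have hd : d ≠ 0 := by simp only [d]; omega
  have h0' : μH[(d : ℝ)] S = 0 := by
    rw [surfaceMeasure, Measure.euclideanHausdorffMeasure_def, Measure.smul_apply] at h0
    rw [ENNReal.smul_def, smul_eq_mul, mul_eq_zero] at h0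
    refine h0.resolve_left fun h => ?_
    exact Measure.addHaarScalarFactor_volume_hausdorffMeasure_ne_zero d (by exact_mod_cast h)
  have hε' : 0 < ENNReal.ofReal ε := ENNReal.ofReal_pos.2 hε
  -- the first bound forces all radii to be at most `ε / 2`, the second one controls the gradient
  set η : ℝ≥0∞ := min (ENNReal.ofReal (ε / 2) ^ d) (ENNReal.ofReal ε / (C + 1))
  have hη : 0 < η := by
    refine lt_min (ENNReal.pow_pos (ENNReal.ofReal_pos.2 (half_pos hε)) d) ?_
    exact ENNReal.div_pos hε'.ne' (by finiteness)
  obtain ⟨F, x, r, hF, hcov, hsum⟩ :=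
    exists_finite_ball_cover_of_hausdorffMeasure_eq_zero hS h0' hη
  have hφ : ∀ i, ∃ φ : E → ℝ, ContDiff ℝ 1 φ ∧ (∀ z, 0 ≤ φ z) ∧ (∀ z, φ z ≤ 1) ∧ (i ∈ F →
      (∀ z ∈ Metric.ball (x i) (r i), φ z = 0) ∧ (∀ z, 2 * r i ≤ dist z (x i) → φ z = 1) ∧
      ∫⁻ z, ‖fderiv ℝ φ z‖ₑ ≤ C * ENNReal.ofReal (r i) ^ d) := by
    intro i
    by_cases hi : i ∈ F
    · obtain ⟨φ, h1, h2, h3, h4⟩ := hC (x i) (r i) (hF i hi).2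
      exact ⟨φ, h1, h2, h3, fun _ => h4⟩
    · exact ⟨fun _ => 1, contDiff_const, fun _ => zero_le_one, fun _ => le_rfl,
        fun h => absurd h hi⟩
  choose φ hφ1 hφ0 hφle hφF using hφ
  refine ⟨fun z => ∏ i ∈ F, φ i z, contDiff_prod fun i _ => hφ1 i,
    fun z => Finset.prod_nonneg fun i _ => hφ0 i z,
    fun z => Finset.prod_le_one (fun i _ => hφ0 i z) fun i _ => hφle i z,
    ⟨⋃ i ∈ F, Metric.ball (x i) (r i), isOpen_biUnion fun _ _ => Metric.isOpen_ball, hcov, ?_⟩,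
    ?_, ?_⟩
  · intro z hz
    obtain ⟨i, hi, hzi⟩ := Set.mem_iUnion₂.1 hz
    exact Finset.prod_eq_zero hi ((hφF i hi).1 z hzi)
  · intro z hz
    refine Finset.prod_eq_one fun i hi => (hφF i hi).2.1 z ?_
    have h1 : ENNReal.ofReal (r i) ^ d ≤ ENNReal.ofReal (ε / 2) ^ d :=
      (Finset.single_le_sum (f := fun i => ENNReal.ofReal (r i) ^ d)
        (fun _ _ => zero_le) hi).trans (hsum.trans (min_le_left _ _))
    have h2 : ENNReal.ofReal (r i) ≤ ENNReal.ofReal (ε / 2) := (ENNReal.pow_le_pow_left_iff hd).1 h1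
    have h3 : r i ≤ ε / 2 := (ENNReal.ofReal_le_ofReal_iff (half_pos hε).le).1 h2
    linarith [hz _ (hF i hi).1]
  · have hm : ∀ i, Measurable fun z => ‖fderiv ℝ (φ i) z‖ₑ := fun i =>
      ((hφ1 i).continuous_fderiv (by norm_num)).enorm.measurable
    calc ∫⁻ z, ‖fderiv ℝ (fun z => ∏ i ∈ F, φ i z) z‖ₑ
        ≤ ∫⁻ z, ∑ i ∈ F, ‖fderiv ℝ (φ i) z‖ₑ := by
          refine lintegral_mono fun z => ?_
          simp only [← ofReal_norm]
          rw [← ENNReal.ofReal_sum_of_nonneg fun i _ => norm_nonneg _]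
          exact ENNReal.ofReal_le_ofReal (norm_fderiv_prod_le F φ
            (fun i => (hφ1 i).differentiable (by norm_num)) hφ0 hφle z)
      _ = ∑ i ∈ F, ∫⁻ z, ‖fderiv ℝ (φ i) z‖ₑ := lintegral_finsetSum _ fun i _ => hm i
      _ ≤ ∑ i ∈ F, C * ENNReal.ofReal (r i) ^ d := Finset.sum_le_sum fun i hi => (hφF i hi).2.2
      _ = C * ∑ i ∈ F, ENNReal.ofReal (r i) ^ d := by rw [Finset.mul_sum]
      _ ≤ (C + 1) * (ENNReal.ofReal ε / (C + 1)) :=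
          mul_le_mul' le_self_add (hsum.trans (min_le_right _ _))
      _ ≤ ENNReal.ofReal ε := ENNReal.mul_div_le

end Cutoff

/-! ### Gauss' theorem -/

section Gauss

open scoped ENNReal NNReal

variable {E : Type*} [NormedAddCommGroup E] [InnerProductSpace ℝ E] [CompleteSpace E]
  [MeasurableSpace E] [BorelSpace E] [FiniteDimensional ℝ E] {Ω : Set E} {e : E}

theorem fluxIdentity_of_eqOn_zero (hΩ : IsOpen Ω) {g : E → ℝ} (h : ∀ z ∈ closure Ω, g z = 0) :
    FluxIdentity Ω e g := by
  unfold FluxIdentity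
  have h1 : ∀ z ∈ Ω, fderiv ℝ g z e = 0 := by
    intro z hz
    have : g =ᶠ[𝓝 z] fun _ => 0 := by
      filter_upwards [hΩ.mem_nhds hz] with w hw using h w (subset_closure hw)
    rw [this.fderiv_eq]
    simp
  rw [setIntegral_eq_zero_of_forall_eq_zero h1, setIntegral_eq_zero_of_forall_eq_zero]
  intro z hz
  rw [h z (frontier_subset_closure hz), zero_mul]

theorem FluxIdentity.add_fun (hΩ : IsOpen Ω) (hb : Bornology.IsBounded Ω)
    (hbd : HasPiecewiseSmoothBoundary Ω) {g₁ g₂ : E → ℝ} (hg₁ : IsC1OnClosure Ω g₁)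
    (hg₂ : IsC1OnClosure Ω g₂) (h₁ : FluxIdentity Ω e g₁) (h₂ : FluxIdentity Ω e g₂) :
    FluxIdentity Ω e (fun z => g₁ z + g₂ z) := by
  unfold FluxIdentity at *
  have hint : ∀ g : E → ℝ, IsC1OnClosure Ω g → IntegrableOn
      (fun z => g z * inner ℝ e (exteriorNormal Ω z)) (frontier Ω) (surfaceMeasure E) := by
    intro g hg
    obtain ⟨M, -, hM⟩ := hg.exists_bound hb
    exact integrableOn_mul_inner_exteriorNormal hbd (hg.continuousOn.mono frontier_subset_closure)
      (fun z hz => hM z (frontier_subset_closure hz)) e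
  have h3 : ∀ z ∈ Ω, fderiv ℝ (fun z => g₁ z + g₂ z) z e = fderiv ℝ g₁ z e + fderiv ℝ g₂ z e := by
    intro z hz
    rw [fderiv_fun_add (hg₁.differentiableAt hΩ hz) (hg₂.differentiableAt hΩ hz)]
    rfl
  simp only [add_mul]
  rw [setIntegral_congr_fun hΩ.measurableSet h3,
    integral_add (hg₁.integrableOn_fderiv hΩ hb e _) (hg₂.integrableOn_fderiv hΩ hb e _),
    integral_add (hint g₁ hg₁) (hint g₂ hg₂), h₁, h₂]

/-- Near an interior point both sides of the flux identity vanish. -/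
theorem exists_nhds_fluxIdentity_of_mem (hΩ : IsOpen Ω) (hb : Bornology.IsBounded Ω) {y : E}
    (hy : y ∈ Ω) (e : E) :
    ∃ U ∈ 𝓝 y, ∀ g : E → ℝ, IsC1OnClosure Ω g → (∀ z ∈ closure Ω, z ∉ U → g z = 0) →
      FluxIdentity Ω e g := by
  obtain ⟨r, hr, hrΩ⟩ := Metric.nhds_basis_closedBall.mem_iff.1 (hΩ.mem_nhds hy)
  refine ⟨Metric.closedBall y r, Metric.closedBall_mem_nhds y hr, fun g hg hg0 => ?_⟩
  have hfr : ∀ z ∈ frontier Ω, g z = 0 := fun z hz =>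
    hg0 z (frontier_subset_closure hz) fun h => (hΩ.frontier_eq ▸ hz).2 (hrΩ h)
  -- the extension of `g` by zero is differentiable on the whole space
  have hd : ∀ z, HasFDerivAt (Ω.indicator g) (Ω.indicator (fderiv ℝ g) z) z := by
    intro z
    by_cases hz : z ∈ Ω
    · rw [Set.indicator_of_mem hz]
      refine (hg.differentiableAt hΩ hz).hasFDerivAt.congr_of_eventuallyEq ?_
      filter_upwards [hΩ.mem_nhds hz] with w hw using Set.indicator_of_mem hw g
    · rw [Set.indicator_of_notMem hz]
      refine (hasFDerivAt_const (0 : ℝ) z).congr_of_eventuallyEq ?_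
      filter_upwards [Metric.isClosed_closedBall.isOpen_compl.mem_nhds
        (fun h => hz (hrΩ h) : z ∈ (Metric.closedBall y r)ᶜ)] with w hw
      by_cases hwΩ : w ∈ Ω
      · rw [Set.indicator_of_mem hwΩ]
        exact hg0 w (subset_closure hwΩ) hw
      · exact Set.indicator_of_notMem hwΩ g
  have hi : (fun z => Ω.indicator (fderiv ℝ g) z e) = Ω.indicator fun z => fderiv ℝ g z e := by
    ext z
    by_cases hz : z ∈ Ω <;> simp [hz]
  have hgi : IntegrableOn g Ω := by
    have : ProperSpace E := FiniteDimensional.proper ℝ E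
    obtain ⟨M, -, hM⟩ := hg.exists_bound hb
    exact IntegrableOn.of_bound hb.measure_lt_top
      ((hg.continuousOn.mono subset_closure).aestronglyMeasurable hΩ.measurableSet) M
      ((ae_restrict_iff' hΩ.measurableSet).2
        (Filter.Eventually.of_forall fun z hz => hM z (subset_closure hz)))
  have h := integral_bilinear_hasFDerivAt_right_eq_neg_left_of_integrable (μ := volume)
    (f := Ω.indicator g) (f' := Ω.indicator (fderiv ℝ g)) (g := fun _ : E => (1 : ℝ))
    (g' := fun _ => 0) (v := e) (B := ContinuousLinearMap.mul ℝ ℝ)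
    (by
      simp only [ContinuousLinearMap.mul_apply', mul_one]
      rw [hi, integrable_indicator_iff hΩ.measurableSet]
      exact hg.integrableOn_fderiv hΩ hb e volume)
    (by simp)
    (by
      simp only [ContinuousLinearMap.mul_apply', mul_one]
      exact (integrable_indicator_iff hΩ.measurableSet).2 hgi)
    (fun z _ => hd z) (fun z _ => hasFDerivAt_const _ _)
  simp only [ContinuousLinearMap.mul_apply', mul_one, zero_apply, mul_zero,
    integral_zero, hi] at h
  rw [integral_indicator hΩ.measurableSet] at h
  unfold FluxIdentity
  rw [neg_eq_zero.1 h.symm]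
  exact (setIntegral_eq_zero_of_forall_eq_zero fun z hz => by rw [hfr z hz, zero_mul]).symm

/-- A partition of unity glues local flux identities: if the flux identity holds for functions
vanishing outside each of finitely many balls, it holds for functions vanishing outside the union of
the concentric balls of half the radius. -/
theorem fluxIdentity_of_finite_cover (hΩ : IsOpen Ω) (hb : Bornology.IsBounded Ω)
    (hbd : HasPiecewiseSmoothBoundary Ω) (r : E → ℝ) (t : Finset E)
    (ht : ∀ y ∈ t, 0 < r y ∧ ∀ g : E → ℝ, IsC1OnClosure Ω g →
      (∀ z ∈ closure Ω, z ∉ Metric.ball y (2 * r y) → g z = 0) → FluxIdentity Ω e g)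
    (g : E → ℝ) (hg : IsC1OnClosure Ω g)
    (hg0 : ∀ z ∈ closure Ω, z ∉ ⋃ y ∈ t, Metric.ball y (r y) → g z = 0) :
    FluxIdentity Ω e g := by
  classical
  induction t using Finset.induction_on generalizing g with
  | empty => exact fluxIdentity_of_eqOn_zero hΩ fun z hz => hg0 z hz (by simp)
  | insert a t ha ih =>
    obtain ⟨hra, hla⟩ := ht a (Finset.mem_insert_self a t)
    let χ : ContDiffBump a := ⟨r a, 2 * r a, hra, by linarith⟩
    have hχ : ContDiff ℝ 1 χ := χ.contDiff
    have hg₁ : IsC1OnClosure Ω fun z => χ z * g z := hg.mul_left hΩ hχ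
    have hg₂ : IsC1OnClosure Ω fun z => (1 - χ z) * g z :=
      hg.mul_left hΩ (contDiff_const.sub hχ)
    have h₁ : FluxIdentity Ω e fun z => χ z * g z := by
      refine hla _ hg₁ fun z _ hz => ?_
      rw [χ.zero_of_le_dist (not_lt.1 hz), zero_mul]
    have h₂ : FluxIdentity Ω e fun z => (1 - χ z) * g z := by
      refine ih (fun y hy => ht y (Finset.mem_insert_of_mem hy)) _ hg₂ fun z hz hzt => ?_
      by_cases hza : z ∈ Metric.ball a (r a)
      · rw [χ.one_of_mem_closedBall (Metric.ball_subset_closedBall hza), sub_self, zero_mul]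
      · rw [hg0 z hz, mul_zero]
        rw [Finset.set_biUnion_insert]
        exact fun h => h.elim hza hzt
    have := FluxIdentity.add_fun hΩ hb hbd hg₁ hg₂ h₁ h₂
    convert! this using 1
    ext z
    ring

/-- The flux identity for functions vanishing near the singular part of the boundary. -/
theorem fluxIdentity_of_vanishing (hΩ : IsOpen Ω) (hb : Bornology.IsBounded Ω)
    (hbd : HasPiecewiseSmoothBoundary Ω) {g : E → ℝ} (hg : IsC1OnClosure Ω g) {W : Set E}
    (hW : IsOpen W) (hSW : {y | y ∈ frontier Ω ∧ ¬ IsRegularBoundaryPoint Ω y} ⊆ W)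
    (hg0 : ∀ z ∈ W, g z = 0) : FluxIdentity Ω e g := by
  have : ProperSpace E := FiniteDimensional.proper ℝ E
  have hK : IsCompact (closure Ω \ W) := hb.isCompact_closure.diff hW
  have hloc : ∀ y ∈ closure Ω \ W, ∃ r, 0 < r ∧ ∀ g : E → ℝ, IsC1OnClosure Ω g →
      (∀ z ∈ closure Ω, z ∉ Metric.ball y (2 * r) → g z = 0) → FluxIdentity Ω e g := by
    intro y hy
    have h1 : ∃ U ∈ 𝓝 y, ∀ g : E → ℝ, IsC1OnClosure Ω g →
        (∀ z ∈ closure Ω, z ∉ U → g z = 0) → FluxIdentity Ω e g := by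
      by_cases hyΩ : y ∈ Ω
      · exact exists_nhds_fluxIdentity_of_mem hΩ hb hyΩ e
      · have hyf : y ∈ frontier Ω := by
          rw [hΩ.frontier_eq]
          exact ⟨hy.1, hyΩ⟩
        refine exists_nhds_fluxIdentity_of_regular hΩ hb hbd ?_ e
        by_contra hr
        exact hy.2 (hSW ⟨hyf, hr⟩)
    obtain ⟨U, hU, h⟩ := h1
    obtain ⟨r, hr, hrU⟩ := Metric.mem_nhds_iff.1 hU
    refine ⟨r / 2, half_pos hr, fun g hg hg0 => h g hg fun z hz hzU => hg0 z hz fun hzr => ?_⟩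
    rw [mul_div_cancel₀ _ two_ne_zero] at hzr
    exact hzU (hrU hzr)
  choose! r hr using hloc
  obtain ⟨t, htK, htc⟩ := hK.elim_nhds_subcover (fun y => Metric.ball y (r y))
    fun y hy => Metric.ball_mem_nhds y (hr y hy).1
  refine fluxIdentity_of_finite_cover hΩ hb hbd r t (fun y hy => hr y (htK y hy)) g hg
    fun z hz hzt => hg0 z ?_
  by_contra hzW
  exact hzt (htc ⟨hz, hzW⟩)

/-- **Gauss' theorem** for bounded domains with piecewise smooth boundary and functions of class
`C¹` up to the boundary. -/
theorem fluxIdentity_of_isC1OnClosure (hdim : 2 ≤ Module.finrank ℝ E) (hΩ : IsOpen Ω)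
    (hb : Bornology.IsBounded Ω) (hbd : HasPiecewiseSmoothBoundary Ω) {g : E → ℝ}
    (hg : IsC1OnClosure Ω g) (e : E) : FluxIdentity Ω e g := by
  have : ProperSpace E := FiniteDimensional.proper ℝ E
  set S := {y | y ∈ frontier Ω ∧ ¬ IsRegularBoundaryPoint Ω y}
  have hSc : IsClosed S := isClosed_singular Ω
  have hSΩ : ∀ z ∈ Ω, z ∉ S := fun z hz hzS => (hΩ.frontier_eq ▸ hzS.1).2 hz
  have hS : IsCompact S := hb.isCompact_closure.of_isClosed_subset hSc
    fun z hz => frontier_subset_closure hz.1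
  have hex : ∀ k : ℕ, ∃ ψ : E → ℝ, ContDiff ℝ 1 ψ ∧ (∀ z, 0 ≤ ψ z) ∧ (∀ z, ψ z ≤ 1) ∧
      (∃ W, IsOpen W ∧ S ⊆ W ∧ ∀ z ∈ W, ψ z = 0) ∧
      (∀ z, (∀ s ∈ S, 1 / ((k : ℝ) + 1) ≤ dist z s) → ψ z = 1) ∧
      ∫⁻ z, ‖fderiv ℝ ψ z‖ₑ ≤ ENNReal.ofReal (1 / ((k : ℝ) + 1)) := fun k =>
    exists_cutoff hS hbd.singular_null hdim (by positivity)
  choose ψ hψ hψ0 hψ1 hψW hψ1' hψint using hex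
  have hψlim : ∀ z ∉ S, Filter.Tendsto (fun k => ψ k z) Filter.atTop (𝓝 1) := by
    intro z hz
    obtain ⟨η, hη, hball⟩ := Metric.isOpen_iff.1 hSc.isOpen_compl z hz
    refine tendsto_const_nhds.congr' ?_
    have h1 := tendsto_one_div_add_atTop_nhds_zero_nat (𝕜 := ℝ)
    filter_upwards [h1.eventually (gt_mem_nhds hη)] with k hk
    refine (hψ1' k z fun s hs => hk.le.trans ?_).symm
    by_contra! hlt
    exact hball (by rwa [Metric.mem_ball, dist_comm]) hs
  obtain ⟨M, hM0, hM⟩ := hg.exists_bound hb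
  obtain ⟨M', hM'0, hM'⟩ := hg.exists_bound_fderiv hb e
  have hψabs : ∀ k z, |ψ k z| ≤ 1 := fun k z => by
    rw [abs_of_nonneg (hψ0 k z)]
    exact hψ1 k z
  -- the identity for the truncated functions
  have hk : ∀ k, FluxIdentity Ω e fun z => ψ k z * g z := by
    intro k
    obtain ⟨W, hW, hSW, hW0⟩ := hψW k
    exact fluxIdentity_of_vanishing hΩ hb hbd (hg.mul_left hΩ (hψ k)) hW hSW
      fun z hz => by rw [hW0 z hz, zero_mul]
  have hdint : ∀ k, Integrable fun z => fderiv ℝ (ψ k) z := fun k =>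
    ⟨((hψ k).continuous_fderiv (by norm_num)).aestronglyMeasurable,
      (hψint k).trans_lt ENNReal.ofReal_lt_top⟩
  have hgm : AEStronglyMeasurable g (volume.restrict Ω) :=
    (hg.continuousOn.mono subset_closure).aestronglyMeasurable hΩ.measurableSet
  have hi1 : ∀ k, IntegrableOn (fun z => ψ k z * fderiv ℝ g z e) Ω := fun k => by
    refine (hg.integrableOn_fderiv hΩ hb e volume).bdd_mul
      (hψ k).continuous.aestronglyMeasurable (c := 1) (Filter.Eventually.of_forall (hψabs k))
  have hi2 : ∀ k, IntegrableOn (fun z => g z * fderiv ℝ (ψ k) z e) Ω := fun k => by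
    refine Integrable.bdd_mul ((hdint k).apply_continuousLinearMap e).integrableOn hgm (c := M)
      ((ae_restrict_iff' hΩ.measurableSet).2
        (Filter.Eventually.of_forall fun z hz => hM z (subset_closure hz)))
  have hsplit : ∀ k, ∫ z in Ω, fderiv ℝ (fun z => ψ k z * g z) z e =
      (∫ z in Ω, ψ k z * fderiv ℝ g z e) + ∫ z in Ω, g z * fderiv ℝ (ψ k) z e := by
    intro k
    rw [← integral_add (hi1 k) (hi2 k)]
    refine setIntegral_congr_fun hΩ.measurableSet fun z hz => ?_
    rw [fderiv_fun_mul ((hψ k).differentiable (by norm_num) z) (hg.differentiableAt hΩ hz)]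
    simp
  have L1 : Filter.Tendsto (fun k => ∫ z in Ω, ψ k z * fderiv ℝ g z e) Filter.atTop
      (𝓝 (∫ z in Ω, fderiv ℝ g z e)) := by
    refine tendsto_integral_of_dominated_convergence (fun _ => M')
      (fun k => (hi1 k).aestronglyMeasurable) (integrableOn_const hb.measure_lt_top.ne) ?_ ?_
    · refine fun k => (ae_restrict_iff' hΩ.measurableSet).2
        (Filter.Eventually.of_forall fun z hz => ?_)
      rw [Real.norm_eq_abs, abs_mul]
      exact (mul_le_of_le_one_left (abs_nonneg _) (hψabs k z)).trans (hM' z hz)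
    · refine (ae_restrict_iff' hΩ.measurableSet).2 (Filter.Eventually.of_forall fun z hz => ?_)
      simpa using (hψlim z (hSΩ z hz)).mul_const (fderiv ℝ g z e)
  have L2 : Filter.Tendsto (fun k => ∫ z in Ω, g z * fderiv ℝ (ψ k) z e) Filter.atTop (𝓝 0) := by
    have hbound : ∀ k, ‖∫ z in Ω, g z * fderiv ℝ (ψ k) z e‖ ≤
        M * ‖e‖ * (1 / ((k : ℝ) + 1)) := by
      intro k
      have hnorm : ∫ z, ‖fderiv ℝ (ψ k) z‖ ≤ 1 / ((k : ℝ) + 1) := by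
        rw [integral_norm_eq_lintegral_enorm (hdint k).aestronglyMeasurable]
        exact ENNReal.toReal_le_of_le_ofReal (by positivity) (hψint k)
      calc ‖∫ z in Ω, g z * fderiv ℝ (ψ k) z e‖
          ≤ ∫ z in Ω, M * ‖e‖ * ‖fderiv ℝ (ψ k) z‖ := by
            refine norm_integral_le_of_norm_le ((hdint k).norm.const_mul _).integrableOn
              ((ae_restrict_iff' hΩ.measurableSet).2 (Filter.Eventually.of_forall fun z hz => ?_))
            rw [norm_mul]
            calc ‖g z‖ * ‖fderiv ℝ (ψ k) z e‖ ≤ M * (‖fderiv ℝ (ψ k) z‖ * ‖e‖) :=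
                  mul_le_mul (hM z (subset_closure hz)) (ContinuousLinearMap.le_opNorm _ _)
                    (norm_nonneg _) hM0
              _ = _ := by ring
        _ ≤ ∫ z, M * ‖e‖ * ‖fderiv ℝ (ψ k) z‖ :=
            setIntegral_le_integral ((hdint k).norm.const_mul _)
              (Filter.Eventually.of_forall fun z => by positivity)
        _ ≤ _ := by
            rw [integral_const_mul]
            gcongr
    refine squeeze_zero_norm hbound ?_
    simpa using (tendsto_one_div_add_atTop_nhds_zero_nat (𝕜 := ℝ)).const_mul (M * ‖e‖)
  have hbint := integrableOn_mul_inner_exteriorNormal hbd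
    (hg.continuousOn.mono frontier_subset_closure)
    (fun z hz => hM z (frontier_subset_closure hz)) e
  have L3 : Filter.Tendsto (fun k => ∫ z in frontier Ω,
      ψ k z * g z * inner ℝ e (exteriorNormal Ω z) ∂(surfaceMeasure E)) Filter.atTop
      (𝓝 (∫ z in frontier Ω, g z * inner ℝ e (exteriorNormal Ω z) ∂(surfaceMeasure E))) := by
    refine tendsto_integral_of_dominated_convergence
      (fun z => ‖g z * inner ℝ e (exteriorNormal Ω z)‖) (fun k => ?_) hbint.norm ?_ ?_
    · simp only [mul_assoc]
      exact (hψ k).continuous.aestronglyMeasurable.mul hbint.aestronglyMeasurable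
    · refine fun k => Filter.Eventually.of_forall fun z => ?_
      rw [mul_assoc, norm_mul]
      exact mul_le_of_le_one_left (norm_nonneg _) (hψabs k z)
    · have hnull : ∀ᵐ z ∂(surfaceMeasure E).restrict (frontier Ω), z ∉ S :=
        ae_restrict_of_ae (measure_eq_zero_iff_ae_notMem.1 hbd.singular_null)
      filter_upwards [hnull] with z hz
      simpa [mul_assoc] using
        (hψlim z hz).mul_const (g z * inner ℝ e (exteriorNormal Ω z))
  have L12 := L1.add L2
  rw [add_zero] at L12
  refine tendsto_nhds_unique L12 (L3.congr fun k => ?_)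
  rw [← hsplit k]
  exact (hk k).symm

end Gauss

/-! ### The regularised Newtonian kernel -/

section RegKernel

/-- The function `(|z|² + ε²)^(-N/2)`, a smooth regularisation of `|z|^(-N)`. -/
def regKernel {E : Type*} [Norm E] (N : ℕ) (ε : ℝ) (z : E) : ℝ := (√(‖z‖ ^ 2 + ε ^ 2) ^ N)⁻¹

section Norm

variable {E : Type*} [NormedAddCommGroup E]

theorem regKernel_zero (N : ℕ) (z : E) : regKernel N 0 z = (‖z‖ ^ N)⁻¹ := by
  simp [regKernel, Real.sqrt_sq (norm_nonneg z)]

theorem regKernel_nonneg (N : ℕ) (ε : ℝ) (z : E) : 0 ≤ regKernel N ε z := by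
  unfold regKernel; positivity

theorem regKernel_le (N : ℕ) (ε : ℝ) {z : E} (hz : z ≠ 0) :
    regKernel N ε z ≤ (‖z‖ ^ N)⁻¹ := by
  have h0 : 0 < ‖z‖ := norm_pos_iff.2 hz
  refine inv_anti₀ (by positivity) (pow_le_pow_left₀ h0.le ?_ N)
  exact Real.le_sqrt_of_sq_le (by nlinarith [sq_nonneg ε])

/-- The relation behind the cancellation in the divergence of the regularised kernel. -/
theorem sq_add_mul_regKernel (N : ℕ) {ε : ℝ} (hε : ε ≠ 0) (z : E) :
    (‖z‖ ^ 2 + ε ^ 2) * regKernel (N + 2) ε z = regKernel N ε z := by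
  have h : 0 < ‖z‖ ^ 2 + ε ^ 2 := by positivity
  unfold regKernel
  have hs : √(‖z‖ ^ 2 + ε ^ 2) ≠ 0 := (Real.sqrt_pos.2 h).ne'
  rw [pow_add, Real.sq_sqrt h.le]
  field_simp

theorem tendsto_regKernel (N : ℕ) {z : E} (hz : z ≠ 0) :
    Filter.Tendsto (fun c : ℝ => regKernel N c⁻¹ z) Filter.atTop (𝓝 ((‖z‖ ^ N)⁻¹)) := by
  have h0 : 0 < ‖z‖ := norm_pos_iff.2 hz
  have hc : ContinuousAt (fun ε : ℝ => regKernel N ε z) 0 := by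
    unfold regKernel
    refine ContinuousAt.inv₀ (by fun_prop) ?_
    have : 0 < ‖z‖ ^ 2 + (0 : ℝ) ^ 2 := by positivity
    positivity
  have := hc.tendsto.comp tendsto_inv_atTop_zero
  rwa [regKernel_zero] at this

variable [NormedSpace ℝ E]

/-- The dilation by `c` of the regularisation with `ε = 1` is the one with `ε = c⁻¹`. -/
theorem pow_mul_regKernel_smul (N : ℕ) {c : ℝ} (hc : 0 < c) (z : E) :
    c ^ N * regKernel (N + 2) 1 (c • z) = c⁻¹ ^ 2 * regKernel (N + 2) c⁻¹ z := by
  have h1 : ‖c • z‖ ^ 2 + 1 ^ 2 = c ^ 2 * (‖z‖ ^ 2 + c⁻¹ ^ 2) := by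
    rw [norm_smul, Real.norm_eq_abs, abs_of_pos hc]
    field_simp
  unfold regKernel
  rw [h1, Real.sqrt_mul (sq_nonneg c), Real.sqrt_sq hc.le, mul_pow, mul_inv, pow_add c]
  field_simp

end Norm

section Derivative

variable {E : Type*} [NormedAddCommGroup E] [InnerProductSpace ℝ E]

theorem contDiff_regKernel (N : ℕ) {ε : ℝ} (hε : ε ≠ 0) :
    ContDiff ℝ 1 (regKernel (E := E) N ε) := by
  have h : ∀ z : E, 0 < ‖z‖ ^ 2 + ε ^ 2 := fun z => by positivity
  unfold regKernel
  refine ContDiff.inv (ContDiff.pow (ContDiff.sqrt ?_ fun z => (h z).ne') N) fun z => ?_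
  · exact (contDiff_norm_sq ℝ).add contDiff_const
  · exact pow_ne_zero _ (Real.sqrt_pos.2 (h z)).ne'

theorem hasFDerivAt_regKernel (N : ℕ) {ε : ℝ} (hε : ε ≠ 0) (z : E) :
    HasFDerivAt (regKernel N ε) (-(N * regKernel (N + 2) ε z) • innerSL ℝ z) z := by
  have h : 0 < ‖z‖ ^ 2 + ε ^ 2 := by positivity
  have hs : 0 < √(‖z‖ ^ 2 + ε ^ 2) := Real.sqrt_pos.2 h
  have h1 : HasDerivAt (fun t : ℝ => (√(t + ε ^ 2) ^ N)⁻¹)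
      (-(N / 2 * regKernel (N + 2) ε z)) (‖z‖ ^ 2) := by
    have h2 : HasDerivAt (fun t : ℝ => √(t + ε ^ 2)) (1 / (2 * √(‖z‖ ^ 2 + ε ^ 2))) (‖z‖ ^ 2) :=
      ((hasDerivAt_id (‖z‖ ^ 2)).add_const (ε ^ 2)).sqrt h.ne'
    have h3 := (h2.fun_pow N).inv (pow_ne_zero _ hs.ne')
    refine h3.congr_deriv ?_
    unfold regKernel
    rcases N with _ | k
    · simp
    · rw [Nat.add_sub_cancel]
      field_simp
      ring
  have h4 : HasFDerivAt (fun z : E => ‖z‖ ^ 2) (2 • innerSL ℝ z) z :=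
    (hasStrictFDerivAt_norm_sq z).hasFDerivAt
  have h5 := h1.comp_hasFDerivAt z h4
  refine h5.congr_fderiv ?_
  ext w
  simp
  ring

end Derivative

section Euclidean

variable {κ : Type*} [Fintype κ]

theorem contDiff_coord_mul_regKernel (i : κ) (N : ℕ) {ε : ℝ} (hε : ε ≠ 0)
    (x : EuclideanSpace ℝ κ) :
    ContDiff ℝ 1 fun y : EuclideanSpace ℝ κ => (y - x) i * regKernel N ε (y - x) := by
  have h1 : ContDiff ℝ 1 fun y : EuclideanSpace ℝ κ => y - x := contDiff_id.sub contDiff_const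
  have h2 : ContDiff ℝ 1 fun y : EuclideanSpace ℝ κ => (y - x) i :=
    (EuclideanSpace.proj (𝕜 := ℝ) i).contDiff.comp h1
  exact h2.mul ((contDiff_regKernel N hε).comp h1)

theorem fderiv_coord_mul_regKernel [DecidableEq κ] (i i' : κ) (N : ℕ) {ε : ℝ} (hε : ε ≠ 0)
    (x y : EuclideanSpace ℝ κ) :
    fderiv ℝ (fun y : EuclideanSpace ℝ κ => (y - x) i' * regKernel N ε (y - x)) y
        (EuclideanSpace.single i 1) =
      (if i = i' then regKernel N ε (y - x) else 0) -
        N * regKernel (N + 2) ε (y - x) * ((y - x) i * (y - x) i') := by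
  have h1 : HasFDerivAt (fun y : EuclideanSpace ℝ κ => y - x)
      (ContinuousLinearMap.id ℝ _) y := (hasFDerivAt_id y).sub_const x
  have h2 : HasFDerivAt (fun y : EuclideanSpace ℝ κ => (y - x) i')
      (EuclideanSpace.proj (𝕜 := ℝ) i') y :=
    (EuclideanSpace.proj (𝕜 := ℝ) i').hasFDerivAt.comp y h1
  have h3 := (hasFDerivAt_regKernel N hε (y - x)).comp y h1
  have h4 := (h2.mul h3).fderiv
  change fderiv ℝ (fun y : EuclideanSpace ℝ κ => (y - x) i' * regKernel N ε (y - x)) y = _ at h4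
  rw [h4]
  by_cases h : i = i'
  · subst h
    simp [EuclideanSpace.inner_single_right]
    ring
  · simp [EuclideanSpace.inner_single_right, h, Ne.symm h]
    ring

theorem abs_coord_le_norm (z : EuclideanSpace ℝ κ) (i : κ) : |z i| ≤ ‖z‖ := by
  simpa using PiLp.norm_apply_le z i

theorem abs_coord_mul_regKernel_le (i : κ) (N : ℕ) (ε : ℝ) (z : EuclideanSpace ℝ κ) :
    |z i * regKernel N ε z| ≤ ‖z‖ * (‖z‖ ^ N)⁻¹ := by
  rcases eq_or_ne z 0 with rfl | hz
  · simp
  · rw [abs_mul, abs_of_nonneg (regKernel_nonneg N ε z)]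
    exact mul_le_mul (abs_coord_le_norm z i) (regKernel_le N ε hz) (regKernel_nonneg N ε z)
      (norm_nonneg z)

theorem tendsto_coord_mul_regKernel (i : κ) (N : ℕ) (z : EuclideanSpace ℝ κ) :
    Filter.Tendsto (fun c : ℝ => z i * regKernel N c⁻¹ z) Filter.atTop
      (𝓝 (z i * (‖z‖ ^ N)⁻¹)) := by
  rcases eq_or_ne z 0 with rfl | hz
  · simp
  · exact (tendsto_regKernel N hz).const_mul (z i)

theorem measurable_coord_mul_inv_norm_pow (i : κ) (N : ℕ) (x : EuclideanSpace ℝ κ) :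
    Measurable fun y : EuclideanSpace ℝ κ => (y - x) i * (‖y - x‖ ^ N)⁻¹ := by
  have h2 : Continuous fun y : EuclideanSpace ℝ κ => (y - x) i :=
    (EuclideanSpace.proj (𝕜 := ℝ) i).continuous.comp (continuous_id.sub continuous_const)
  exact h2.measurable.mul (((continuous_id.sub continuous_const).norm.pow N).measurable.inv)

end Euclidean

end RegKernel

/-! ### The regularised kernel as an approximate identity -/

section ApproximateIdentity

/-- The integrand has the antiderivative `r ^ N / (r² + 1) ^ (N / 2)`. -/
theorem integral_Ioi_pow_mul_regKernel {N : ℕ} (hN : N ≠ 0) :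
    ∫ r in Set.Ioi (0 : ℝ), r ^ (N - 1) * (N * (√(r ^ 2 + 1 ^ 2) ^ (N + 2))⁻¹) = 1 := by
  have hpos : ∀ r : ℝ, 0 < r ^ 2 + 1 ^ 2 := fun r => by positivity
  have hder : ∀ r : ℝ, HasDerivAt (fun r : ℝ => r ^ N / √(r ^ 2 + 1 ^ 2) ^ N)
      (r ^ (N - 1) * (N * (√(r ^ 2 + 1 ^ 2) ^ (N + 2))⁻¹)) r := by
    intro r
    have hs : 0 < √(r ^ 2 + 1 ^ 2) := Real.sqrt_pos.2 (hpos r)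
    have hsq : √(r ^ 2 + 1 ^ 2) ^ 2 = r ^ 2 + 1 ^ 2 := Real.sq_sqrt (hpos r).le
    have h2 := (((hasDerivAt_pow 2 r).add_const ((1 : ℝ) ^ 2)).sqrt (hpos r).ne')
    have h3 := (hasDerivAt_pow N r).div (h2.fun_pow N) (pow_ne_zero N hs.ne')
    refine h3.congr_deriv ?_
    obtain ⟨k, rfl⟩ : ∃ k, N = k + 1 := ⟨N - 1, by omega⟩
    simp only [Nat.add_sub_cancel]
    set s := √(r ^ 2 + 1 ^ 2)
    have : r ^ 2 = s ^ 2 - 1 := by rw [hsq]; ring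
    field_simp
    have e1 : 2 - 1 = 1 := rfl
    rw [e1]
    push_cast
    linear_combination (2 * r ^ k * s ^ k * s ^ (k + 3)) * (-this)
  have hlim : Filter.Tendsto (fun r : ℝ => r ^ N / √(r ^ 2 + 1 ^ 2) ^ N) Filter.atTop (𝓝 1) := by
    have h1 : Filter.Tendsto (fun r : ℝ => √(1 + (r⁻¹) ^ 2)⁻¹ ^ N) Filter.atTop (𝓝 1) := by
      have hc : ContinuousAt (fun u : ℝ => √(1 + u ^ 2)⁻¹ ^ N) 0 := by
        have : (1 + (0 : ℝ) ^ 2) ≠ 0 := by norm_num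
        fun_prop (disch := assumption)
      have h2 := hc.tendsto.comp tendsto_inv_atTop_zero
      simpa only [Function.comp_def, ne_eq, OfNat.ofNat_ne_zero, not_false_eq_true, zero_pow,
        add_zero, inv_one, Real.sqrt_one, one_pow] using h2
    refine h1.congr' ?_
    filter_upwards [Filter.eventually_gt_atTop 0] with r hr
    rw [← div_pow]
    congr 1
    have h2 : r ^ 2 + 1 ^ 2 = r ^ 2 * (1 + r⁻¹ ^ 2) := by field_simp
    rw [h2, Real.sqrt_mul (sq_nonneg r), Real.sqrt_sq hr.le, Real.sqrt_inv]
    field_simp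
  have := integral_Ioi_of_hasDerivAt_of_nonneg' (a := 0) (fun r _ => hder r)
    (fun r hr => by have : (0 : ℝ) < r := hr; positivity) hlim
  rw [this]
  simp [hN]

variable {κ : Type*} [Fintype κ] [Nonempty κ]

theorem card_mul_volume_ball :
    Fintype.card κ * volume.real (Metric.ball (0 : EuclideanSpace ℝ κ) 1) =
      sphereArea (Fintype.card κ) := by
  set N := Fintype.card κ
  have hN : (0 : ℝ) < N := by exact_mod_cast Fintype.card_pos
  have hΓ : 0 < Real.Gamma ((N : ℝ) / 2) := Real.Gamma_pos_of_pos (by positivity)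
  rw [Measure.real, EuclideanSpace.volume_ball, Real.Gamma_add_one (by positivity), sphereArea,
    ENNReal.ofReal_one, one_pow, one_mul, ENNReal.toReal_ofReal (by positivity),
    Real.sqrt_eq_rpow, ← Real.rpow_natCast, ← Real.rpow_mul Real.pi_pos.le]
  have : (1 / 2 * (N : ℝ)) = (N : ℝ) / 2 := by ring
  rw [this]
  field_simp
  rfl

theorem sphereArea_pos {N : ℕ} (hN : 0 < N) : 0 < sphereArea N := by
  have hN : (0 : ℝ) < N := by exact_mod_cast hN
  have hΓ : 0 < Real.Gamma ((N : ℝ) / 2) := Real.Gamma_pos_of_pos (by positivity)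
  have := Real.pi_pos
  unfold sphereArea
  positivity

theorem integral_regKernel_add_two :
    ∫ z : EuclideanSpace ℝ κ, (Fintype.card κ : ℝ) * regKernel (Fintype.card κ + 2) 1 z =
      sphereArea (Fintype.card κ) := by
  have h := integral_fun_norm_addHaar (volume : Measure (EuclideanSpace ℝ κ))
    fun r => (Fintype.card κ : ℝ) * (√(r ^ 2 + 1 ^ 2) ^ (Fintype.card κ + 2))⁻¹
  simp only [finrank_euclideanSpace, smul_eq_mul, nsmul_eq_mul] at h
  rw [integral_Ioi_pow_mul_regKernel Fintype.card_ne_zero, mul_one, card_mul_volume_ball] at h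
  exact h

/-- The functions `N ε² (|z|² + ε²)^(-N/2-1)` are an approximate identity of total mass the area
of the unit sphere. -/
theorem tendsto_integral_regKernel {g : EuclideanSpace ℝ κ → ℝ} (hg : Integrable g)
    {x : EuclideanSpace ℝ κ} (hgx : ContinuousAt g x) :
    Filter.Tendsto (fun c : ℝ => ∫ y : EuclideanSpace ℝ κ, Fintype.card κ *
      (c⁻¹ ^ 2 * regKernel (Fintype.card κ + 2) c⁻¹ (y - x)) * g y) Filter.atTop
      (𝓝 (sphereArea (Fintype.card κ) * g x)) := by
  set N := Fintype.card κ
  have hNpos : 0 < N := Fintype.card_pos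
  have hσ : 0 < sphereArea N := sphereArea_pos hNpos
  set φ : EuclideanSpace ℝ κ → ℝ := fun z => (sphereArea N)⁻¹ * (N * regKernel (N + 2) 1 z)
  have hφ : ∀ z, 0 ≤ φ z := fun z =>
    mul_nonneg (inv_nonneg.2 hσ.le) (mul_nonneg (Nat.cast_nonneg _) (regKernel_nonneg _ _ _))
  have hφ1 : ∫ z, φ z = 1 := by
    simp only [φ]
    rw [integral_const_mul, integral_regKernel_add_two, inv_mul_cancel₀ hσ.ne']
  have hdecay : Filter.Tendsto
      (fun z => ‖z‖ ^ Module.finrank ℝ (EuclideanSpace ℝ κ) * φ z)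
      (Bornology.cobounded (EuclideanSpace ℝ κ)) (𝓝 0) := by
    rw [finrank_euclideanSpace]
    have h1 : Filter.Tendsto (fun z : EuclideanSpace ℝ κ => (sphereArea N)⁻¹ * N * (‖z‖ ^ 2)⁻¹)
        (Bornology.cobounded (EuclideanSpace ℝ κ)) (𝓝 0) := by
      have h2 := (tendsto_inv_atTop_zero.comp ((Filter.tendsto_pow_atTop two_ne_zero).comp
        (tendsto_norm_cobounded_atTop (E := EuclideanSpace ℝ κ)))).const_mul
        ((sphereArea N)⁻¹ * (N : ℝ))
      simpa using h2
    refine tendsto_of_tendsto_of_tendsto_of_le_of_le' tendsto_const_nhds h1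
      (Filter.Eventually.of_forall fun z => mul_nonneg (by positivity) (hφ z)) ?_
    filter_upwards [Bornology.eventually_ne_cobounded (0 : EuclideanSpace ℝ κ)] with z hz
    have hz' : 0 < ‖z‖ := norm_pos_iff.2 hz
    calc ‖z‖ ^ N * φ z = (sphereArea N)⁻¹ * N * (‖z‖ ^ N * regKernel (N + 2) 1 z) := by
          simp only [φ]; ring
      _ ≤ (sphereArea N)⁻¹ * N * (‖z‖ ^ N * (‖z‖ ^ (N + 2))⁻¹) := by
          gcongr
          exact regKernel_le _ _ hz
      _ = _ := by rw [pow_add]; field_simp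
  have h := (tendsto_integral_comp_smul_smul_of_integrable' hφ hφ1 hdecay hg hgx).const_mul
    (sphereArea N)
  simp only [smul_eq_mul] at h
  refine h.congr' ?_
  filter_upwards [Filter.eventually_gt_atTop 0] with c hc
  rw [← integral_const_mul]
  refine integral_congr_ae (Filter.Eventually.of_forall fun y => ?_)
  simp only [φ, finrank_euclideanSpace]
  rw [← neg_sub y x, smul_neg]
  have h1 : regKernel (N + 2) 1 (-(c • (y - x))) = regKernel (N + 2) 1 (c • (y - x)) := by
    simp [regKernel]
  rw [h1, ← pow_mul_regKernel_smul N hc]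
  change sphereArea N * (c ^ N * _ * g y) = _
  field_simp

/-- The singularity of order `N - 1` of the kernel is integrable. -/
theorem integrableOn_norm_mul_inv_norm_pow {s : Set (EuclideanSpace ℝ κ)}
    (hs : Bornology.IsBounded s) (x : EuclideanSpace ℝ κ) :
    IntegrableOn (fun y => ‖y - x‖ * (‖y - x‖ ^ Fintype.card κ)⁻¹) s := by
  set N := Fintype.card κ
  have hNpos : 0 < N := Fintype.card_pos
  obtain ⟨r, hr⟩ := hs.subset_ball x
  refine IntegrableOn.mono_set ?_ hr
  have h1 : IntegrableOn (fun z : EuclideanSpace ℝ κ => ‖z‖ * (‖z‖ ^ N)⁻¹) (Metric.ball 0 r) := by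
    rw [integrableOn_fun_norm_addHaar volume (f := fun u : ℝ => u * (u ^ N)⁻¹)]
    rw [finrank_euclideanSpace]
    have h2 : IntegrableOn (fun _ : ℝ => (1 : ℝ)) (Set.Ioo 0 r) :=
      integrableOn_const measure_Ioo_lt_top.ne
    refine h2.congr_fun (fun u hu => ?_) measurableSet_Ioo
    have hu0 : u ≠ 0 := hu.1.ne'
    obtain ⟨k, hk⟩ : ∃ k, N = k + 1 := ⟨N - 1, by omega⟩
    change 1 = u ^ (N - 1) • (u * (u ^ N)⁻¹)
    rw [hk, Nat.add_sub_cancel, smul_eq_mul, pow_succ]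
    field_simp
  have hmp : MeasurePreserving (fun y : EuclideanSpace ℝ κ => y - x) volume volume :=
    measurePreserving_sub_right volume x
  have hpre : (fun y : EuclideanSpace ℝ κ => y - x) ⁻¹' Metric.ball 0 r = Metric.ball x r := by
    ext y
    simp [dist_eq_norm]
  rw [← hpre]
  exact (hmp.integrableOn_comp_preimage
    (MeasurableEquiv.subRight x).measurableEmbedding).2 h1

end ApproximateIdentity

/-! ### The integral formula for real-valued functions -/

section Scalar

variable {κ : Type*} [Fintype κ] [Nonempty κ]
  {Ω : Set (EuclideanSpace ℝ κ)} {g : EuclideanSpace ℝ κ → ℝ} {x : EuclideanSpace ℝ κ}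

/-- The kernel is bounded on the boundary, from which `x` has positive distance. -/
theorem exists_bound_kernel_frontier (hΩ : IsOpen Ω) (hx : x ∈ Ω ∪ (closure Ω)ᶜ) :
    ∃ B : ℝ, ∀ y ∈ frontier Ω, ‖y - x‖ * (‖y - x‖ ^ Fintype.card κ)⁻¹ ≤ B := by
  have hxf : x ∉ frontier Ω := by
    rintro hxf
    rcases hx with hx | hx
    · exact (hΩ.frontier_eq ▸ hxf).2 hx
    · exact hx (frontier_subset_closure hxf)
  obtain ⟨η, hη, hball⟩ := Metric.isOpen_iff.1 isClosed_frontier.isOpen_compl x hxf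
  obtain ⟨k, hk⟩ : ∃ k, Fintype.card κ = k + 1 :=
    ⟨Fintype.card κ - 1, by have := Fintype.card_pos (α := κ); omega⟩
  refine ⟨(η ^ k)⁻¹, fun y hy => ?_⟩
  have hle : η ≤ ‖y - x‖ := by
    rw [← dist_eq_norm]
    by_contra! hlt
    exact hball hlt hy
  have h0 : 0 < ‖y - x‖ := hη.trans_le hle
  rw [hk, pow_succ, mul_inv, mul_comm, mul_assoc, inv_mul_cancel₀ h0.ne', mul_one]
  exact inv_anti₀ (by positivity) (pow_le_pow_left₀ hη.le hle k)

theorem integrableOn_kernel_frontier (hΩ : IsOpen Ω) (hb : Bornology.IsBounded Ω)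
    (hbd : HasPiecewiseSmoothBoundary Ω) (hg : IsC1OnClosure Ω g) (hx : x ∈ Ω ∪ (closure Ω)ᶜ)
    (i' : κ) (e : EuclideanSpace ℝ κ) :
    IntegrableOn (fun y => (y - x) i' * (‖y - x‖ ^ Fintype.card κ)⁻¹ *
      (g y * inner ℝ e (exteriorNormal Ω y))) (frontier Ω) (surfaceMeasure _) := by
  obtain ⟨B, hB⟩ := exists_bound_kernel_frontier hΩ hx
  obtain ⟨M, -, hM⟩ := hg.exists_bound hb
  refine (integrableOn_mul_inner_exteriorNormal hbd
    (hg.continuousOn.mono frontier_subset_closure)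
    (fun z hz => hM z (frontier_subset_closure hz)) e).bdd_mul (c := B)
    (measurable_coord_mul_inv_norm_pow i' _ x).aestronglyMeasurable
    ((ae_restrict_iff' isClosed_frontier.measurableSet).2
      (Filter.Eventually.of_forall fun y hy => le_trans ?_ (hB y hy)))
  rw [Real.norm_eq_abs, abs_mul, abs_of_nonneg (by positivity : 0 ≤ (‖y - x‖ ^ Fintype.card κ)⁻¹)]
  gcongr
  exact abs_coord_le_norm _ _

theorem integrableOn_kernel_fderiv (hΩ : IsOpen Ω) (hb : Bornology.IsBounded Ω)
    (hg : IsC1OnClosure Ω g) (x : EuclideanSpace ℝ κ) (i' : κ) (e : EuclideanSpace ℝ κ) :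
    IntegrableOn (fun y => (y - x) i' * (‖y - x‖ ^ Fintype.card κ)⁻¹ * fderiv ℝ g y e) Ω := by
  obtain ⟨M, -, hM⟩ := hg.exists_bound_fderiv hb e
  have h1 : IntegrableOn (fun y => (y - x) i' * (‖y - x‖ ^ Fintype.card κ)⁻¹) Ω := by
    refine (integrableOn_norm_mul_inv_norm_pow hb x).mono'
      (measurable_coord_mul_inv_norm_pow i' _ x).aestronglyMeasurable
      (Filter.Eventually.of_forall fun y => ?_)
    rw [Real.norm_eq_abs, abs_mul,
      abs_of_nonneg (by positivity : 0 ≤ (‖y - x‖ ^ Fintype.card κ)⁻¹)]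
    gcongr
    exact abs_coord_le_norm _ _
  exact h1.mul_bdd (c := M) (hg.aestronglyMeasurable_fderiv hΩ e volume)
    ((ae_restrict_iff' hΩ.measurableSet).2 (Filter.Eventually.of_forall hM))

theorem tendsto_integral_regKernel_frontier (hΩ : IsOpen Ω) (hb : Bornology.IsBounded Ω)
    (hbd : HasPiecewiseSmoothBoundary Ω) (hg : IsC1OnClosure Ω g) (hx : x ∈ Ω ∪ (closure Ω)ᶜ)
    (i' : κ) (e : EuclideanSpace ℝ κ) :
    Filter.Tendsto (fun c : ℝ => ∫ y in frontier Ω, (y - x) i' *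
        regKernel (Fintype.card κ) c⁻¹ (y - x) * g y * inner ℝ e (exteriorNormal Ω y)
        ∂(surfaceMeasure _)) Filter.atTop
      (𝓝 (∫ y in frontier Ω, (y - x) i' * (‖y - x‖ ^ Fintype.card κ)⁻¹ *
        (g y * inner ℝ e (exteriorNormal Ω y)) ∂(surfaceMeasure _))) := by
  obtain ⟨B, hB⟩ := exists_bound_kernel_frontier hΩ hx
  obtain ⟨M, -, hM⟩ := hg.exists_bound hb
  have hint := integrableOn_mul_inner_exteriorNormal hbd
    (hg.continuousOn.mono frontier_subset_closure)
    (fun z hz => hM z (frontier_subset_closure hz)) e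
  simp only [mul_assoc ((_ : ℝ) * regKernel _ _ _)]
  refine tendsto_integral_filter_of_dominated_convergence
    (fun y => B * ‖g y * inner ℝ e (exteriorNormal Ω y)‖) ?_ ?_ (hint.norm.const_mul B) ?_
  · filter_upwards [Filter.eventually_gt_atTop 0] with c hc
    exact (contDiff_coord_mul_regKernel i' _ (inv_ne_zero hc.ne')
      x).continuous.aestronglyMeasurable.mul hint.aestronglyMeasurable
  · refine Filter.Eventually.of_forall fun c => (ae_restrict_iff' isClosed_frontier.measurableSet).2
      (Filter.Eventually.of_forall fun y hy => ?_)
    rw [norm_mul]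
    gcongr
    exact (abs_coord_mul_regKernel_le i' _ _ _).trans (hB y hy)
  · exact Filter.Eventually.of_forall fun y =>
      (tendsto_coord_mul_regKernel i' _ (y - x)).mul_const _

theorem tendsto_integral_regKernel_fderiv (hΩ : IsOpen Ω) (hb : Bornology.IsBounded Ω)
    (hg : IsC1OnClosure Ω g) (x : EuclideanSpace ℝ κ) (i' : κ) (e : EuclideanSpace ℝ κ) :
    Filter.Tendsto (fun c : ℝ => ∫ y in Ω, (y - x) i' *
        regKernel (Fintype.card κ) c⁻¹ (y - x) * fderiv ℝ g y e) Filter.atTop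
      (𝓝 (∫ y in Ω, (y - x) i' * (‖y - x‖ ^ Fintype.card κ)⁻¹ * fderiv ℝ g y e)) := by
  obtain ⟨M, -, hM⟩ := hg.exists_bound_fderiv hb e
  refine tendsto_integral_filter_of_dominated_convergence
    (fun y => ‖y - x‖ * (‖y - x‖ ^ Fintype.card κ)⁻¹ * M) ?_ ?_
    ((integrableOn_norm_mul_inv_norm_pow hb x).mul_const M) ?_
  · filter_upwards [Filter.eventually_gt_atTop 0] with c hc
    exact (contDiff_coord_mul_regKernel i' _ (inv_ne_zero hc.ne')
      x).continuous.aestronglyMeasurable.mul (hg.aestronglyMeasurable_fderiv hΩ e volume)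
  · refine Filter.Eventually.of_forall fun c => (ae_restrict_iff' hΩ.measurableSet).2
      (Filter.Eventually.of_forall fun y hy => ?_)
    rw [norm_mul]
    exact mul_le_mul (abs_coord_mul_regKernel_le i' _ _ _) (hM y hy) (norm_nonneg _)
      (by positivity)
  · exact Filter.Eventually.of_forall fun y =>
      (tendsto_coord_mul_regKernel i' _ (y - x)).mul_const _

variable [DecidableEq κ]

/-- The difference between the boundary and the volume term of the integral formula for the
real-valued function `g`, the coordinate `i'` of the kernel and the differentiation in the
direction of the coordinate `i`. The junk value `0` of the kernel at `y = x` is immaterial, since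
points have volume zero and only points `x ∉ ∂Ω` matter. -/
def kernelDefect (Ω : Set (EuclideanSpace ℝ κ)) (g : EuclideanSpace ℝ κ → ℝ)
    (x : EuclideanSpace ℝ κ) (i i' : κ) : ℝ :=
  (∫ y in frontier Ω, (y - x) i' * (‖y - x‖ ^ Fintype.card κ)⁻¹ *
    (g y * inner ℝ (EuclideanSpace.single i 1) (exteriorNormal Ω y)) ∂(surfaceMeasure _)) -
  ∫ y in Ω, (y - x) i' * (‖y - x‖ ^ Fintype.card κ)⁻¹ *
    fderiv ℝ g y (EuclideanSpace.single i 1)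

/-- If `a` is a matrix with trace `N d` and quadratic form `d |z|²`, the corresponding combination
of the boundary terms and volume terms reproduces `g` up to a factor: the divergence of the
regularised kernel is an approximate identity. -/
theorem sum_mul_kernelDefect (hcard : 2 ≤ Fintype.card κ) (hΩ : IsOpen Ω)
    (hb : Bornology.IsBounded Ω) (hbd : HasPiecewiseSmoothBoundary Ω) (hg : IsC1OnClosure Ω g)
    (hx : x ∈ Ω ∪ (closure Ω)ᶜ) (a : κ → κ → ℝ) (d : ℝ)
    (htr : ∑ i, a i i = Fintype.card κ * d)
    (hquad : ∀ z : EuclideanSpace ℝ κ, ∑ i, ∑ i', a i i' * (z i * z i') = d * ‖z‖ ^ 2) :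
    ∑ i, ∑ i', a i i' * kernelDefect Ω g x i i' =
      sphereArea (Fintype.card κ) * d * Ω.indicator g x := by
  set N := Fintype.card κ
  have hgi : IntegrableOn g Ω := by
    obtain ⟨M, -, hM⟩ := hg.exists_bound hb
    exact IntegrableOn.of_bound hb.measure_lt_top
      ((hg.continuousOn.mono subset_closure).aestronglyMeasurable hΩ.measurableSet) M
      ((ae_restrict_iff' hΩ.measurableSet).2
        (Filter.Eventually.of_forall fun z hz => hM z (subset_closure hz)))
  have hcont : ContinuousAt (Ω.indicator g) x := by
    rcases hx with hx | hx
    · refine ((hg.differentiableAt hΩ hx).continuousAt).congr ?_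
      filter_upwards [hΩ.mem_nhds hx] with y hy using (Set.indicator_of_mem hy g).symm
    · refine (continuousAt_const (y := (0 : ℝ))).congr ?_
      filter_upwards [isClosed_closure.isOpen_compl.mem_nhds hx] with y hy
      exact (Set.indicator_of_notMem (fun h => hy (subset_closure h)) g).symm
  have L1 := (tendsto_integral_regKernel ((integrable_indicator_iff hΩ.measurableSet).2 hgi)
    hcont).const_mul d
  have L2 : Filter.Tendsto (fun c : ℝ => ∑ i, ∑ i', a i i' *
      ((∫ y in frontier Ω, (y - x) i' * regKernel N c⁻¹ (y - x) * g y *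
          inner ℝ (EuclideanSpace.single i 1) (exteriorNormal Ω y) ∂(surfaceMeasure _)) -
        ∫ y in Ω, (y - x) i' * regKernel N c⁻¹ (y - x) *
          fderiv ℝ g y (EuclideanSpace.single i 1))) Filter.atTop
      (𝓝 (∑ i, ∑ i', a i i' * kernelDefect Ω g x i i')) :=
    tendsto_finsetSum _ fun i _ => tendsto_finsetSum _ fun i' _ =>
      ((tendsto_integral_regKernel_frontier hΩ hb hbd hg hx i' _).sub
        (tendsto_integral_regKernel_fderiv hΩ hb hg x i' _)).const_mul _
  have hlim : sphereArea N * d * Ω.indicator g x = d * (sphereArea N * Ω.indicator g x) := by ring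
  rw [hlim]
  refine tendsto_nhds_unique L2 (L1.congr' ?_)
  filter_upwards [Filter.eventually_gt_atTop 0] with c hc
  have hε : c⁻¹ ≠ 0 := inv_ne_zero hc.ne'
  -- Gauss' theorem for the products of `g` with the coordinates of the regularised kernel
  have hgauss : ∀ i i', (∫ y in frontier Ω, (y - x) i' * regKernel N c⁻¹ (y - x) * g y *
          inner ℝ (EuclideanSpace.single i 1) (exteriorNormal Ω y) ∂(surfaceMeasure _)) -
        ∫ y in Ω, (y - x) i' * regKernel N c⁻¹ (y - x) *
          fderiv ℝ g y (EuclideanSpace.single i 1) =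
      ∫ y in Ω, g y * ((if i = i' then regKernel N c⁻¹ (y - x) else 0) -
        N * regKernel (N + 2) c⁻¹ (y - x) * ((y - x) i * (y - x) i')) := by
    intro i i'
    have hφ := contDiff_coord_mul_regKernel i' N hε x
    have hflux : FluxIdentity Ω _ _ := fluxIdentity_of_isC1OnClosure
      (by rw [finrank_euclideanSpace]; exact hcard) hΩ hb hbd (hg.mul_left hΩ hφ)
      (EuclideanSpace.single i (1 : ℝ))
    unfold FluxIdentity at hflux
    rw [← hflux, ← integral_sub ((hg.mul_left hΩ hφ).integrableOn_fderiv hΩ hb _ volume)]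
    · refine setIntegral_congr_fun hΩ.measurableSet fun y hy => ?_
      simp only
      rw [fderiv_fun_mul (hφ.differentiable (by norm_num) y) (hg.differentiableAt hΩ hy),
        ← fderiv_coord_mul_regKernel i i' N hε x y]
      simp
    · obtain ⟨M, -, hM⟩ := hg.exists_bound_fderiv hb (EuclideanSpace.single i (1 : ℝ))
      have h1 : IntegrableOn (fun y => (y - x) i' * regKernel N c⁻¹ (y - x)) Ω :=
        (hφ.continuous.continuousOn.integrableOn_compact hb.isCompact_closure).mono_set
          subset_closure
      exact h1.mul_bdd (c := M) (hg.aestronglyMeasurable_fderiv hΩ _ volume)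
        ((ae_restrict_iff' hΩ.measurableSet).2 (Filter.Eventually.of_forall hM))
  simp only [hgauss]
  have hint : ∀ i i', IntegrableOn (fun y => a i i' * (g y *
      ((if i = i' then regKernel N c⁻¹ (y - x) else 0) -
        N * regKernel (N + 2) c⁻¹ (y - x) * ((y - x) i * (y - x) i')))) Ω := by
    intro i i'
    have hφ := contDiff_coord_mul_regKernel i' N hε x
    have hc1 : ContinuousOn (fun y => (if i = i' then regKernel N c⁻¹ (y - x) else 0) -
        N * regKernel (N + 2) c⁻¹ (y - x) * ((y - x) i * (y - x) i')) (closure Ω) := by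
      simp only [← fderiv_coord_mul_regKernel i i' N hε x]
      exact ((hφ.continuous_fderiv (by norm_num)).clm_apply continuous_const).continuousOn
    exact (((hg.continuousOn.mul hc1).const_mul (a i i')).integrableOn_compact
      hb.isCompact_closure).mono_set subset_closure
  simp only [← integral_const_mul]
  have hL : ∀ y, d * (N * (c⁻¹ ^ 2 * regKernel (N + 2) c⁻¹ (y - x)) * Ω.indicator g y) =
      Ω.indicator (fun y => d * (N * (c⁻¹ ^ 2 * regKernel (N + 2) c⁻¹ (y - x)) * g y)) y := by
    intro y
    by_cases hy : y ∈ Ω <;> simp [hy]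
  rw [integral_congr_ae (Filter.Eventually.of_forall hL), integral_indicator hΩ.measurableSet,
    Finset.sum_congr rfl fun i _ =>
      (integral_finsetSum Finset.univ fun i' _ => hint i i').symm,
    ← integral_finsetSum Finset.univ fun i _ => integrable_finsetSum _ fun i' _ => hint i i']
  refine setIntegral_congr_fun hΩ.measurableSet fun y _ => ?_
  have hdiag : ∑ i, ∑ i', a i i' * (if i = i' then regKernel N c⁻¹ (y - x) else 0) =
      N * d * regKernel N c⁻¹ (y - x) := by
    simp only [mul_ite, mul_zero, Finset.sum_ite_eq, Finset.mem_univ, if_true]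
    rw [← Finset.sum_mul, htr]
  have hsum : ∑ i, ∑ i', a i i' * (g y * ((if i = i' then regKernel N c⁻¹ (y - x) else 0) -
        N * regKernel (N + 2) c⁻¹ (y - x) * ((y - x) i * (y - x) i'))) =
      g y * (∑ i, ∑ i', a i i' * (if i = i' then regKernel N c⁻¹ (y - x) else 0)) -
        g y * (N * regKernel (N + 2) c⁻¹ (y - x)) *
          ∑ i, ∑ i', a i i' * ((y - x) i * (y - x) i') := by
    simp only [Finset.mul_sum, ← Finset.sum_sub_distrib]
    refine Finset.sum_congr rfl fun i _ => Finset.sum_congr rfl fun i' _ => ?_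
    ring
  simp only
  rw [hsum, hdiag, hquad, ← sq_add_mul_regKernel N hε]
  ring

end Scalar

/-! ### Hypercomplex bases and the multiplication constants -/

section HypercomplexAlgebra

variable {A : Type*} [NonAssocRing A] [Module ℝ A] [StarRing A]

omit [Module ℝ A] [StarRing A] in
/-- The linearised form of left alternativity. -/
theorem mul_mul_add_mul_mul_swap [IsAlternative A] (p q a : A) :
    p * (q * a) + q * (p * a) = (p * q + q * p) * a := by
  have h := IsAlternative.left_alternative (p + q) a
  simp only [add_mul, mul_add, IsAlternative.left_alternative p a,
    IsAlternative.left_alternative q a] at h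
  rw [add_mul]
  have h' : p * p * a + (p * (q * a) + q * (p * a)) + q * q * a =
      p * p * a + (p * q * a + q * p * a) + q * q * a := by
    calc _ = p * p * a + q * (p * a) + (p * (q * a) + q * q * a) := by abel
      _ = _ := by rw [h]; abel
  exact add_left_cancel (add_right_cancel h')

variable {M : Submodule ℝ A} {m : ℕ} {v : Module.Basis (Fin (m + 1)) ℝ M}

/-- The products `v_sᶜ (v_{s'} a)` satisfy the Clifford relations although the multiplication need
not be associative. -/
theorem IsHypercomplexBasis.star_mul_mul_add_swap [IsAlternative A] (hv : IsHypercomplexBasis v)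
    (s s' : Fin (m + 1)) (a : A) :
    star (v s' : A) * ((v s : A) * a) + star (v s : A) * ((v s' : A) * a) =
      (if s = s' then (2 : ℝ) else 0) • a := by
  have hstar : ∀ s, s ≠ 0 → star (v s : A) = -(v s : A) := fun s hs =>
    (neg_eq_of_add_eq_zero_right (hv.mem_sphere s hs).1).symm
  have hsq : ∀ s, s ≠ 0 → (v s : A) * (v s : A) = -1 := fun s hs => by
    have h := (hv.mem_sphere s hs).2
    rw [hstar s hs, mul_neg] at h
    rw [← h, neg_neg]
  have h0 : (v 0 : A) = 1 := hv.zero_eq_one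
  by_cases hss : s = s'
  · subst hss
    rw [if_pos rfl, two_smul]
    by_cases hs : s = 0
    · subst hs
      simp [h0]
    · rw [hstar s hs, neg_mul, IsAlternative.left_alternative, hsq s hs]
      simp
  · rw [if_neg hss, zero_smul]
    by_cases hs : s = 0
    · subst hs
      rw [h0, hstar s' (Ne.symm hss)]
      simp
    · by_cases hs' : s' = 0
      · subst hs'
        rw [h0, hstar s hs]
        simp
      · rw [hstar s hs, hstar s' hs', neg_mul, neg_mul, ← neg_add, mul_mul_add_mul_mul_swap,
          hv.anticomm s s' hs hs' hss]
        simp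

variable {ι : Type*} [Fintype ι]

/-- The component at `b t` of `v_{s'}ᶜ (v_s b_u)`. -/
def mulCoeff (v : Module.Basis (Fin (m + 1)) ℝ M) (b : Module.Basis ι ℝ A) (t u : ι)
    (s s' : Fin (m + 1)) : ℝ :=
  b.repr (star (v s' : A) * ((v s : A) * b u)) t

omit [Fintype ι] in
theorem mulCoeff_add_swap [IsAlternative A] [DecidableEq ι] (hv : IsHypercomplexBasis v)
    (b : Module.Basis ι ℝ A) (t u : ι) (s s' : Fin (m + 1)) :
    mulCoeff v b t u s s' + mulCoeff v b t u s' s =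
      (if s = s' then (2 : ℝ) else 0) * if u = t then 1 else 0 := by
  unfold mulCoeff
  rw [← Finsupp.add_apply, ← map_add, hv.star_mul_mul_add_swap, map_smul, Finsupp.smul_apply,
    b.repr_self, Finsupp.single_apply, smul_eq_mul]

omit [Fintype ι] in
theorem mulCoeff_self [IsAlternative A] [DecidableEq ι] (hv : IsHypercomplexBasis v)
    (b : Module.Basis ι ℝ A) (t u : ι) (s : Fin (m + 1)) :
    mulCoeff v b t u s s = if u = t then 1 else 0 := by
  have := mulCoeff_add_swap hv b t u s s
  rw [if_pos rfl] at this
  linarith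

omit [Fintype ι] in
/-- The Clifford relations as an identity of quadratic forms in `z`. -/
theorem sum_sum_mulCoeff_mul [IsAlternative A] [DecidableEq ι] (hv : IsHypercomplexBasis v)
    (b : Module.Basis ι ℝ A) (t u : ι) (z : Fin (m + 1) → ℝ) :
    ∑ s, ∑ s', mulCoeff v b t u s s' * (z s * z s') = (if u = t then 1 else 0) * ∑ s, z s ^ 2 := by
  set Q := ∑ s, ∑ s', mulCoeff v b t u s s' * (z s * z s')
  have hswap : Q = ∑ s, ∑ s', mulCoeff v b t u s' s * (z s * z s') := by
    simp only [Q]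
    rw [Finset.sum_comm]
    refine Finset.sum_congr rfl fun s _ => Finset.sum_congr rfl fun s' _ => ?_
    ring
  have h2 : Q + Q = 2 * ((if u = t then 1 else 0) * ∑ s, z s ^ 2) := by
    have hc := mulCoeff_add_swap hv b t u
    generalize (if u = t then (1 : ℝ) else 0) = δ at hc ⊢
    nth_rewrite 2 [hswap]
    simp only [Q, ← Finset.sum_add_distrib, ← add_mul, hc, ite_mul, zero_mul,
      Finset.sum_ite_eq, Finset.mem_univ, if_true]
    rw [Finset.mul_sum, Finset.mul_sum]
    refine Finset.sum_congr rfl fun s _ => ?_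
    ring
  linarith

variable [IsScalarTower ℝ A A] [SMulCommClass ℝ A A]

/-- Expansion of the components of `p (w₁ w₂)` for `p` in the span of the `v_{s'}ᶜ` and `w₁` in the
span of the `v_s`. -/
theorem repr_star_sum_mul_sum (v : Module.Basis (Fin (m + 1)) ℝ M) (b : Module.Basis ι ℝ A)
    (p : Fin (m + 1) → ℝ) (w : Fin (m + 1) → ι → ℝ) (t : ι) :
    b.repr ((∑ s', p s' • star (v s' : A)) * ∑ s, (v s : A) * ∑ u, w s u • b u) t =
      ∑ u, ∑ s, ∑ s', mulCoeff v b t u s s' * (p s' * w s u) := by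
  simp only [Finset.sum_mul, Finset.mul_sum, mul_smul_comm, smul_mul_assoc, map_sum, map_smul,
    Finsupp.coe_finsetSum, Finset.sum_apply, Finsupp.smul_apply, smul_eq_mul]
  rw [Finset.sum_comm]
  refine Finset.sum_congr rfl fun u _ => Finset.sum_congr rfl fun s _ =>
    Finset.sum_congr rfl fun s' _ => ?_
  rw [mulCoeff]
  ring

variable [StarModule ℝ A] {n : ℕ}

omit [IsScalarTower ℝ A A] [SMulCommClass ℝ A A] in
theorem kernelComp_eq_sum (v : Module.Basis (Fin (m + 1)) ℝ M) (j : Fin n) (z : Coord n m) :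
    kernelComp v j z = ∑ s', ((sphereArea ((m + 1) * n))⁻¹ *
      (z (j, s') * (‖z‖ ^ ((m + 1) * n))⁻¹)) • star (v s' : A) := by
  simp only [kernelComp, comp, Submodule.coe_sum, Submodule.coe_smul, star_sum, star_smul,
    star_trivial, Finset.smul_sum, smul_smul]
  refine Finset.sum_congr rfl fun s _ => ?_
  congr 1
  ring

theorem repr_boundaryDensity (v : Module.Basis (Fin (m + 1)) ℝ M) (b : Module.Basis ι ℝ A)
    (Ω : Set (Coord n m)) (f : Coord n m → A) (x y : Coord n m) (t : ι) :
    b.repr (boundaryDensity v Ω f x y) t =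
      ∑ u, ∑ j, ∑ s, ∑ s', (sphereArea ((m + 1) * n))⁻¹ * mulCoeff v b t u s s' *
        ((y - x) (j, s') * (‖y - x‖ ^ ((m + 1) * n))⁻¹ *
          (b.repr (f y) u * inner ℝ (EuclideanSpace.single (j, s) 1) (exteriorNormal Ω y))) := by
  have hprod : ∀ j, (comp v (exteriorNormal Ω y) j : A) * f y =
      ∑ s, (v s : A) * ∑ u, (b.repr (f y) u * exteriorNormal Ω y (j, s)) • b u := by
    intro j
    nth_rewrite 1 [← b.sum_repr (f y)]
    simp only [comp, Submodule.coe_sum, Submodule.coe_smul, Finset.sum_mul, Finset.mul_sum,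
      smul_mul_assoc, mul_smul_comm, Finset.smul_sum, smul_smul]
    rw [Finset.sum_comm]
  simp only [boundaryDensity, map_sum, Finsupp.coe_finsetSum, Finset.sum_apply, hprod,
    kernelComp_eq_sum, repr_star_sum_mul_sum, EuclideanSpace.inner_single_left, map_one, one_mul]
  rw [Finset.sum_comm]
  refine Finset.sum_congr rfl fun u _ => Finset.sum_congr rfl fun j _ =>
    Finset.sum_congr rfl fun s _ => Finset.sum_congr rfl fun s' _ => ?_
  ring

theorem repr_kernelComp_mul_dirac (v : Module.Basis (Fin (m + 1)) ℝ M) (b : Module.Basis ι ℝ A)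
    (f : Coord n m → A) (x y : Coord n m) (j : Fin n) (t : ι) :
    b.repr (kernelComp v j (y - x) * dirac v b j f y) t =
      ∑ u, ∑ s, ∑ s', (sphereArea ((m + 1) * n))⁻¹ * mulCoeff v b t u s s' *
        ((y - x) (j, s') * (‖y - x‖ ^ ((m + 1) * n))⁻¹ *
          fderiv ℝ (fun y => b.repr (f y) u) y (EuclideanSpace.single (j, s) 1)) := by
  simp only [dirac, partialDeriv, kernelComp_eq_sum, repr_star_sum_mul_sum]
  refine Finset.sum_congr rfl fun u _ => Finset.sum_congr rfl fun s _ =>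
    Finset.sum_congr rfl fun s' _ => ?_
  ring

end HypercomplexAlgebra

/-! ### The Bochner-Martinelli formula -/

section Formula

/-- Sums over pairs of coordinates with a coefficient that is block diagonal. -/
theorem sum_sum_ite_fst_eq {J S : Type*} [Fintype J] [Fintype S] [DecidableEq J] (c : S → S → ℝ)
    (X : J × S → J × S → ℝ) :
    ∑ i, ∑ i', (if i.1 = i'.1 then c i.2 i'.2 else 0) * X i i' =
      ∑ j, ∑ s, ∑ s', c s s' * X (j, s) (j, s') := by
  simp only [Fintype.sum_prod_type, ite_mul, zero_mul]
  refine Finset.sum_congr rfl fun j _ => Finset.sum_congr rfl fun s _ => ?_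
  rw [Finset.sum_comm]
  refine Finset.sum_congr rfl fun s' _ => ?_
  simp

variable {A : Type*} [NonAssocRing A] [Module ℝ A] [StarRing A] [IsAlternative A]
  {M : Submodule ℝ A} {m : ℕ} {v : Module.Basis (Fin (m + 1)) ℝ M}
  {ι : Type*} {n : ℕ}

/-- The contribution of the component `u` of `f` to the component `t` of the integral formula. -/
theorem sum_mulCoeff_mul_kernelDefect [DecidableEq ι] (hv : IsHypercomplexBasis v)
    (b : Module.Basis ι ℝ A) (hn : 0 < n) {Ω : Set (Coord n m)} (hΩ : IsOpen Ω)
    (hb : Bornology.IsBounded Ω) (hbd : HasPiecewiseSmoothBoundary Ω) {g : Coord n m → ℝ}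
    (hg : IsC1OnClosure Ω g) {x : Coord n m} (hx : x ∈ Ω ∪ (closure Ω)ᶜ) (t u : ι) :
    ∑ j, ∑ s, ∑ s', mulCoeff v b t u s s' * kernelDefect Ω g x (j, s) (j, s') =
      sphereArea ((m + 1) * n) * (if u = t then 1 else 0) * Ω.indicator g x := by
  have : Nonempty (Fin n) := ⟨⟨0, hn⟩⟩
  have hcard : Fintype.card (Fin n × Fin (m + 1)) = (m + 1) * n := by simp [mul_comm]
  rw [← sum_sum_ite_fst_eq (mulCoeff v b t u), ← hcard]
  refine sum_mul_kernelDefect ?_ hΩ hb hbd hg hx _ _ ?_ fun z => ?_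
  · rw [hcard]
    have := hv.one_le
    nlinarith
  · simp [mulCoeff_self hv]
  · rw [sum_sum_ite_fst_eq (mulCoeff v b t u) fun i i' => z i * z i',
      EuclideanSpace.real_norm_sq_eq, Fintype.sum_prod_type, Finset.mul_sum]
    exact Finset.sum_congr rfl fun j _ => sum_sum_mulCoeff_mul hv b t u fun s => z (j, s)

end Formula

end BochnerMartinelli

end

theorem mainTheorem1
    {A : Type*} [NonAssocRing A] [Module ℝ A] [IsScalarTower ℝ A A] [SMulCommClass ℝ A A]
    [BochnerMartinelli.IsAlternative A] [StarRing A] [StarModule ℝ A]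
    {M : Submodule ℝ A} (hM : BochnerMartinelli.IsHypercomplexSubspace M)
    {m : ℕ} (v : Module.Basis (Fin (m + 1)) ℝ M) (hv : BochnerMartinelli.IsHypercomplexBasis v)
    {ι : Type*} [Fintype ι] (b : Module.Basis ι ℝ A)
    {n : ℕ} (hn : 0 < n)
    (Ω : Set (BochnerMartinelli.Coord n m)) (hΩ_open : IsOpen Ω) (hΩ_conn : IsConnected Ω)
    (hΩ_bdd : Bornology.IsBounded Ω) (hΩ : BochnerMartinelli.HasPiecewiseSmoothBoundary Ω)
    (f : BochnerMartinelli.Coord n m → A) (hf : BochnerMartinelli.CompC1OnClosure b Ω f) :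
    (∀ x ∈ Ω ∪ (closure Ω)ᶜ,
      BochnerMartinelli.CompIntegrableOn b (BochnerMartinelli.boundaryDensity v Ω f x)
        (frontier Ω) (BochnerMartinelli.surfaceMeasure (BochnerMartinelli.Coord n m)) ∧
      ∀ j, BochnerMartinelli.CompIntegrableOn b
        (fun y => BochnerMartinelli.kernelComp v j (y - x) * BochnerMartinelli.dirac v b j f y)
        Ω volume) ∧
    (∀ x ∈ Ω,
      BochnerMartinelli.compIntegral b (BochnerMartinelli.boundaryDensity v Ω f x)
          (frontier Ω) (BochnerMartinelli.surfaceMeasure (BochnerMartinelli.Coord n m)) -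
        ∑ j, BochnerMartinelli.compIntegral b
          (fun y => BochnerMartinelli.kernelComp v j (y - x) * BochnerMartinelli.dirac v b j f y)
          Ω volume = f x) ∧
    (∀ x ∈ (closure Ω)ᶜ,
      BochnerMartinelli.compIntegral b (BochnerMartinelli.boundaryDensity v Ω f x)
          (frontier Ω) (BochnerMartinelli.surfaceMeasure (BochnerMartinelli.Coord n m)) -
        ∑ j, BochnerMartinelli.compIntegral b
          (fun y => BochnerMartinelli.kernelComp v j (y - x) * BochnerMartinelli.dirac v b j f y)
          Ω volume = 0) := by
  classical
  have : Nonempty (Fin n) := ⟨⟨0, hn⟩⟩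
  have hcard : Fintype.card (Fin n × Fin (m + 1)) = (m + 1) * n := by simp [mul_comm]
  have hσ : 0 < BochnerMartinelli.sphereArea ((m + 1) * n) :=
    BochnerMartinelli.sphereArea_pos (by positivity)
  -- the real-valued terms of the boundary and of the volume integrals are integrable
  have ib : ∀ x ∈ Ω ∪ (closure Ω)ᶜ, ∀ (u : ι) (i i' : Fin n × Fin (m + 1)) (c : ℝ),
      IntegrableOn (fun y => c * ((y - x) i' * (‖y - x‖ ^ ((m + 1) * n))⁻¹ *
        (b.repr (f y) u * inner ℝ (EuclideanSpace.single i 1)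
          (BochnerMartinelli.exteriorNormal Ω y)))) (frontier Ω)
        (BochnerMartinelli.surfaceMeasure (BochnerMartinelli.Coord n m)) := by
    intro x hx u i i' c
    rw [← hcard]
    exact (BochnerMartinelli.integrableOn_kernel_frontier hΩ_open hΩ_bdd hΩ (hf u) hx i'
      (EuclideanSpace.single i 1)).const_mul c
  have iv : ∀ (x : BochnerMartinelli.Coord n m) (u : ι) (i i' : Fin n × Fin (m + 1)) (c : ℝ),
      IntegrableOn (fun y => c * ((y - x) i' * (‖y - x‖ ^ ((m + 1) * n))⁻¹ *
        fderiv ℝ (fun y => b.repr (f y) u) y (EuclideanSpace.single i 1))) Ω := by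
    intro x u i i' c
    rw [← hcard]
    exact (BochnerMartinelli.integrableOn_kernel_fderiv hΩ_open hΩ_bdd (hf u) x i'
      (EuclideanSpace.single i 1)).const_mul c
  have formula : ∀ x ∈ Ω ∪ (closure Ω)ᶜ,
      BochnerMartinelli.compIntegral b (BochnerMartinelli.boundaryDensity v Ω f x)
          (frontier Ω) (BochnerMartinelli.surfaceMeasure (BochnerMartinelli.Coord n m)) -
        ∑ j, BochnerMartinelli.compIntegral b
          (fun y => BochnerMartinelli.kernelComp v j (y - x) * BochnerMartinelli.dirac v b j f y)
          Ω volume = ∑ t, Ω.indicator (fun y => b.repr (f y) t) x • b t := by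
    intro x hx
    simp only [BochnerMartinelli.compIntegral]
    rw [Finset.sum_comm, ← Finset.sum_sub_distrib]
    refine Finset.sum_congr rfl fun t _ => ?_
    rw [← Finset.sum_smul, ← sub_smul]
    congr 1
    have hB : ∫ y in frontier Ω, b.repr (BochnerMartinelli.boundaryDensity v Ω f x y) t
          ∂(BochnerMartinelli.surfaceMeasure (BochnerMartinelli.Coord n m)) =
        ∑ u, ∑ j, ∑ s, ∑ s', (BochnerMartinelli.sphereArea ((m + 1) * n))⁻¹ *
          BochnerMartinelli.mulCoeff v b t u s s' *
          ∫ y in frontier Ω, (y - x) (j, s') * (‖y - x‖ ^ ((m + 1) * n))⁻¹ *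
            (b.repr (f y) u * inner ℝ (EuclideanSpace.single (j, s) 1)
              (BochnerMartinelli.exteriorNormal Ω y))
            ∂(BochnerMartinelli.surfaceMeasure (BochnerMartinelli.Coord n m)) := by
      simp only [BochnerMartinelli.repr_boundaryDensity]
      rw [integral_finsetSum _ fun u _ => integrable_finsetSum _ fun j _ =>
        integrable_finsetSum _ fun s _ => integrable_finsetSum _ fun s' _ => ib x hx u _ _ _]
      refine Finset.sum_congr rfl fun u _ => ?_
      rw [integral_finsetSum _ fun j _ =>
        integrable_finsetSum _ fun s _ => integrable_finsetSum _ fun s' _ => ib x hx u _ _ _]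
      refine Finset.sum_congr rfl fun j _ => ?_
      rw [integral_finsetSum _ fun s _ => integrable_finsetSum _ fun s' _ => ib x hx u _ _ _]
      refine Finset.sum_congr rfl fun s _ => ?_
      rw [integral_finsetSum _ fun s' _ => ib x hx u _ _ _]
      exact Finset.sum_congr rfl fun s' _ => integral_const_mul _ _
    have hV : ∑ j, ∫ y in Ω, b.repr (BochnerMartinelli.kernelComp v j (y - x) *
          BochnerMartinelli.dirac v b j f y) t =
        ∑ u, ∑ j, ∑ s, ∑ s', (BochnerMartinelli.sphereArea ((m + 1) * n))⁻¹ *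
          BochnerMartinelli.mulCoeff v b t u s s' *
          ∫ y in Ω, (y - x) (j, s') * (‖y - x‖ ^ ((m + 1) * n))⁻¹ *
            fderiv ℝ (fun y => b.repr (f y) u) y (EuclideanSpace.single (j, s) 1) := by
      simp only [BochnerMartinelli.repr_kernelComp_mul_dirac]
      rw [Finset.sum_comm (s := (Finset.univ : Finset ι))]
      refine Finset.sum_congr rfl fun j _ => ?_
      rw [integral_finsetSum _ fun u _ =>
        integrable_finsetSum _ fun s _ => integrable_finsetSum _ fun s' _ => iv x u _ _ _]
      refine Finset.sum_congr rfl fun u _ => ?_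
      rw [integral_finsetSum _ fun s _ => integrable_finsetSum _ fun s' _ => iv x u _ _ _]
      refine Finset.sum_congr rfl fun s _ => ?_
      rw [integral_finsetSum _ fun s' _ => iv x u _ _ _]
      exact Finset.sum_congr rfl fun s' _ => integral_const_mul _ _
    have hBV : ∀ u : ι, _ := fun u =>
      BochnerMartinelli.sum_mulCoeff_mul_kernelDefect hv b hn hΩ_open hΩ_bdd hΩ (hf u) hx t u
    simp only [BochnerMartinelli.kernelDefect, hcard] at hBV
    rw [hB, hV]
    simp only [← Finset.sum_sub_distrib, ← mul_sub]
    simp only [mul_assoc (BochnerMartinelli.sphereArea ((m + 1) * n))⁻¹, ← Finset.mul_sum]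
    rw [Finset.sum_congr rfl fun u _ => hBV u]
    simp only [mul_assoc, ← Finset.mul_sum]
    rw [inv_mul_cancel_left₀ hσ.ne']
    simp
  refine ⟨fun x hx => ⟨fun t => ?_, fun j t => ?_⟩, fun x hx => ?_, fun x hx => ?_⟩
  · simp only [BochnerMartinelli.repr_boundaryDensity]
    exact integrable_finsetSum _ fun u _ => integrable_finsetSum _ fun j _ =>
      integrable_finsetSum _ fun s _ => integrable_finsetSum _ fun s' _ => ib x hx u _ _ _
  · simp only [BochnerMartinelli.repr_kernelComp_mul_dirac]
    exact integrable_finsetSum _ fun u _ =>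
      integrable_finsetSum _ fun s _ => integrable_finsetSum _ fun s' _ => iv x u _ _ _
  · rw [formula x (Or.inl hx)]
    simp only [Set.indicator_of_mem hx]
    exact b.sum_repr (f x)
  · rw [formula x (Or.inr hx)]
    have hx' : x ∉ Ω := fun h => hx (subset_closure h)
    simp [Set.indicator_of_notMem hx']
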